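/- Let $1\le m<n$ be integers, and let $(M,g)$ be a complete connected (second countable, boundaryless) $n$-dimensional Riemannian manifold with differentiable structure of class $C^3$ and metric $g$ of class $C^2$; let $d_g$ be the Riemannian distance and $\nabla^g$ the Levi-Civita connection. Let $\mathrm{Gr}_m(M)=\{(x,S): x\in M,\ S\subset T_xM \text{ an } m\text{-dimensional linear subspace}\}$ be the Grassmannian bundle, with its bundle topology and projection $\pi(x,S)=x$. An $m$-varifold in $M$ is a Radon measure $V$ on $\mathrm{Gr}_m(M)$; its weight is $\|V\|=\pi_\#V$. For a compactly supported $C^1$ vector field $X$ on $M$, the first variation of $V$ is $$\delta_gV(X)=\int_{\mathrm{Gr}_m(M)}\operatorname{div}_S X(x)\,dV(x,S),\qquad \operatorname{div}_SX(x)=\sum_{i=1}^m\langle\nabla^g_{e_i}X,e_i\rangle_{g_x},$$ where $e_1,\dots,e_m$ is any $g_x$-orthonormal basis of $S$, and $V$ is stationary if $\delta_gV(X)=0$ for all such $X$. **Theorem (Constancy theorem).** Let $\Sigma\subset M$ be a connected $m$-dimensional embedded submanifold of class $C^2$, and let $V$ be a stationary $m$-varifold in $M$ with $\operatorname{supp}\|V\|\subset\Sigma$.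 Then there is a constant $\theta_0\in[0,\infty)$ such that $V=V(\Sigma,\theta_0,g)$, that is, for every Borel set $B\subset\mathrm{Gr}_m(M)$, $$V(B)=\int_{\{x\in\Sigma:\ (x,T_x\Sigma)\in B\}}\theta_0\,d\mathcal H^m_{d_g},$$ where $\mathcal H^m_{d_g}$ is the $m$-dimensional Hausdorff measure of $(M,d_g)$. -/

import Mathlib

open Bundle MeasureTheory Topology Set
open scoped Manifold ContDiff ENNReal NNReal

noncomputable section

namespace Varifold

/-- The Grassmannian of `m`-dimensional linear subspaces of `E`. -/
def Gr (m : ℕ) (E : Type*) [AddCommGroup E] [Module ℝ E] : Type _ :=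
  {S : Submodule ℝ E // Module.finrank ℝ S = m}

/-- The standard topology of `Gr(m, ℝⁿ)`: planes are close when the orthogonal projections onto
them are close. -/
instance instTopologicalSpaceGr (m n : ℕ) :
    TopologicalSpace (Gr m (EuclideanSpace ℝ (Fin n))) :=
  TopologicalSpace.induced (fun S => S.1.starProjection) inferInstance

/-- Image of an `m`-plane under a linear isomorphism. -/
def Gr.map {m : ℕ} {E F : Type*} [AddCommGroup E] [Module ℝ E] [AddCommGroup F] [Module ℝ F]
    (A : E ≃ₗ[ℝ] F) (S : Gr m E) : Gr m F :=
  ⟨S.1.map (A : E →ₗ[ℝ] F), (LinearEquiv.finrank_map_eq A S.1).trans S.2⟩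

section Manifold

variable {n : ℕ} {M : Type*}

section GrassmannBundle

variable [TopologicalSpace M] [ChartedSpace (EuclideanSpace ℝ (Fin n)) M]

instance instFiniteDimensionalTangentSpace (x : M) :
    FiniteDimensional ℝ (TangentSpace (𝓡 n) x) :=
  inferInstanceAs (FiniteDimensional ℝ (EuclideanSpace ℝ (Fin n)))

/-- The Grassmannian bundle `Gr_m(M)`: pairs `(x, S)` of a point `x` of `M` and an `m`-dimensional
subspace `S` of `T_x M`. -/
def GrBundle (n m : ℕ) (M : Type*) [TopologicalSpace M]
    [ChartedSpace (EuclideanSpace ℝ (Fin n)) M] : Type _ :=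
  Σ x : M, Gr m (TangentSpace (𝓡 n) x)

/-- The bundle projection `π : Gr_m(M) → M`. -/
def GrBundle.proj {m : ℕ} (p : GrBundle n m M) : M := p.1

variable [IsManifold (𝓡 n) 1 M]

/-- The inverse of the bundle chart of `Gr_m(M)` induced by the chart `φ` of `M` at `c`:
`(x, S) ↦ (x, (dφ_x)⁻¹ S)` for `x` in the domain of `φ` and `S ∈ Gr(m, ℝⁿ)`. -/
def GrBundle.ofChart {m : ℕ} (c : M)
    (q : (chartAt (EuclideanSpace ℝ (Fin n)) c).source × Gr m (EuclideanSpace ℝ (Fin n))) :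
    GrBundle n m M :=
  ⟨q.1.1, q.2.map
    ((trivializationAt (EuclideanSpace ℝ (Fin n)) (TangentSpace (𝓡 n)) c).continuousLinearEquivAt
      ℝ q.1.1 q.1.2).symm.toLinearEquiv⟩

/-- The bundle topology of `Gr_m(M)`: a set is open when it is open in each bundle chart. -/
instance instTopologicalSpaceGrBundle (m : ℕ) : TopologicalSpace (GrBundle n m M) :=
  ⨆ c : M, TopologicalSpace.coinduced (GrBundle.ofChart (m := m) c) inferInstance

/-- `Gr_m(M)` carries its Borel `σ`-algebra. -/
instance instMeasurableSpaceGrBundle (m : ℕ) : MeasurableSpace (GrBundle n m M) := borel _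

instance instBorelSpaceGrBundle (m : ℕ) : BorelSpace (GrBundle n m M) := ⟨rfl⟩

theorem GrBundle.continuous_proj {m : ℕ} :
    Continuous (GrBundle.proj : GrBundle n m M → M) := by
  rw [continuous_iSup_dom]
  intro c
  rw [continuous_coinduced_dom]
  exact continuous_subtype_val.comp continuous_fst

/-- The weight `‖V‖ = π_# V` of a Borel measure `V` on `Gr_m(M)`. -/
def weight [MeasurableSpace M] {m : ℕ} (V : Measure (GrBundle n m M)) : Measure M :=
  V.map GrBundle.proj

end GrassmannBundle

section LeviCivita

variable [TopologicalSpace M] [ChartedSpace (EuclideanSpace ℝ (Fin n)) M]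
  [IsManifold (𝓡 n) 1 M]

/-- The partial derivative `∂_i f (y)` of a function on `ℝⁿ`. -/
def partialDeriv (i : Fin n) (f : EuclideanSpace ℝ (Fin n) → ℝ) (y : EuclideanSpace ℝ (Fin n)) :
    ℝ :=
  fderiv ℝ f y (EuclideanSpace.single i 1)

/-- The components of the vector field `X` in the chart of `M` at `c`, as functions of the
coordinates. -/
def coordField (c : M) (X : ∀ x : M, TangentSpace (𝓡 n) x) (k : Fin n)
    (y : EuclideanSpace ℝ (Fin n)) : ℝ :=
  ((trivializationAt (EuclideanSpace ℝ (Fin n)) (TangentSpace (𝓡 n)) c).continuousLinearMapAt ℝ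
    ((chartAt (EuclideanSpace ℝ (Fin n)) c).symm y)
    (X ((chartAt (EuclideanSpace ℝ (Fin n)) c).symm y)) : EuclideanSpace ℝ (Fin n)) k

variable [RiemannianBundle (fun x : M => TangentSpace (𝓡 n) x)]

/-- The components `g_ij` of the Riemannian metric in the chart of `M` at `c`, as functions of the
coordinates. -/
def coordMetric (c : M) (i j : Fin n) (y : EuclideanSpace ℝ (Fin n)) : ℝ :=
  let x : M := (chartAt (EuclideanSpace ℝ (Fin n)) c).symm y
  let τ := (trivializationAt (EuclideanSpace ℝ (Fin n)) (TangentSpace (𝓡 n)) c).symmL ℝ x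
  inner ℝ (τ (EuclideanSpace.single i 1)) (τ (EuclideanSpace.single j 1))

/-- The Christoffel symbols
`Γᵏ_ij = ½ ∑_l gᵏˡ (∂_i g_jl + ∂_j g_il - ∂_l g_ij)` in the chart of `M` at `c`. -/
def christoffel (c : M) (k i j : Fin n) (y : EuclideanSpace ℝ (Fin n)) : ℝ :=
  (1 / 2) * ∑ l, (Matrix.of fun a b => coordMetric c a b y)⁻¹ k l *
    (partialDeriv i (coordMetric c j l) y + partialDeriv j (coordMetric c i l) y
      - partialDeriv l (coordMetric c i j) y)

/-- The Levi-Civita covariant derivative `∇_v X ∈ T_x M`, computed in the chart of `M` at `x`: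
`(∇_v X)ᵏ = ∑_i vⁱ (∂_i Xᵏ + ∑_j Γᵏ_ij Xʲ)`. -/
def covDeriv (X : ∀ x : M, TangentSpace (𝓡 n) x) (x : M) (v : TangentSpace (𝓡 n) x) :
    TangentSpace (𝓡 n) x :=
  let y := chartAt (EuclideanSpace ℝ (Fin n)) x x
  let τ := trivializationAt (EuclideanSpace ℝ (Fin n)) (TangentSpace (𝓡 n)) x
  let v' : EuclideanSpace ℝ (Fin n) := τ.continuousLinearMapAt ℝ x v
  τ.symmL ℝ x (WithLp.toLp 2 fun k =>
    ∑ i, v' i * (partialDeriv i (coordField x X k) y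
      + ∑ j, christoffel x k i j y * coordField x X j y))

/-- The partial divergence `div_S X (x) = ∑ ⟨∇_{e_i} X, e_i⟩`, where `(e_i)` is an orthonormal
basis of the plane `S ⊆ T_x M`; the sum does not depend on the basis. -/
def partialDiv (X : ∀ x : M, TangentSpace (𝓡 n) x) {m : ℕ} (p : GrBundle n m M) : ℝ :=
  ∑ i, inner ℝ (covDeriv X p.1 (stdOrthonormalBasis ℝ p.2.1 i : TangentSpace (𝓡 n) p.1))
    (stdOrthonormalBasis ℝ p.2.1 i : TangentSpace (𝓡 n) p.1)

/-- The first variation `δ_g V (X) = ∫ div_S X (x) dV(x, S)`. -/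
def firstVariation {m : ℕ} (V : Measure (GrBundle n m M)) (X : ∀ x : M, TangentSpace (𝓡 n) x) :
    ℝ :=
  ∫ p, partialDiv X p ∂V

/-- `V` is stationary: its first variation vanishes on all compactly supported `C¹` vector
fields. -/
def IsStationary {m : ℕ} (V : Measure (GrBundle n m M)) : Prop :=
  ∀ X : ∀ x : M, TangentSpace (𝓡 n) x,
    ContMDiff (𝓡 n) (𝓡 n).tangent 1 (fun x => (⟨x, X x⟩ : TangentBundle (𝓡 n) M)) →
    IsCompact (closure {x | X x ≠ 0}) → firstVariation V X = 0

end LeviCivita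

section Submanifold

variable [TopologicalSpace M] [ChartedSpace (EuclideanSpace ℝ (Fin n)) M]

/-- `Γ ⊆ M` is an `m`-dimensional `C²` embedded submanifold: around each of its points there is a
`C²` chart of `M` in which `Γ` is the slice `{y_m = ⋯ = y_{n-1} = 0}` (coordinates are numbered
from `0`). -/
def IsEmbeddedC2Submanifold (n m : ℕ) {M : Type*} [TopologicalSpace M]
    [ChartedSpace (EuclideanSpace ℝ (Fin n)) M] (Γ : Set M) : Prop :=
  ∀ x ∈ Γ, ∃ φ ∈ IsManifold.maximalAtlas (𝓡 n) 2 M, x ∈ φ.source ∧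
    ∀ y ∈ φ.source, (y ∈ Γ ↔ ∀ i : Fin n, m ≤ (i : ℕ) → φ y i = 0)

/-- The tangent space `T_x Γ ⊆ T_x M`, spanned by the velocities at `x` of curves in `Γ` (for an
embedded submanifold these velocities already form a linear subspace). -/
def tangentPlane (Γ : Set M) (x : M) : Submodule ℝ (TangentSpace (𝓡 n) x) :=
  Submodule.span ℝ {v | ∃ γ : ℝ → M, (∀ᶠ t in 𝓝 (0 : ℝ), γ t ∈ Γ) ∧
    ContMDiffAt 𝓘(ℝ, ℝ) (𝓡 n) 1 γ 0 ∧
    (⟨γ 0, mfderiv 𝓘(ℝ, ℝ) (𝓡 n) γ 0 (1 : ℝ)⟩ : TangentBundle (𝓡 n) M) = ⟨x, v⟩}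

end Submanifold

/-- The `m`-dimensional Hausdorff measure with its usual normalization, for which it is Lebesgue
measure on `ℝᵐ`: a set of diameter `d` is counted with the volume of an `m`-ball of diameter `d`,
whereas `μH[m]` counts it with `dᵐ`. -/
def hausdorff (m : ℕ) (M : Type*) [MetricSpace M] [MeasurableSpace M] [BorelSpace M] :
    Measure M :=
  volume (Metric.ball (0 : EuclideanSpace ℝ (Fin m)) (1 / 2)) • Measure.hausdorffMeasure (m : ℝ)

/-- The set function `V(Γ, θ, g)` on subsets of `Gr_m(M)`:
`B ↦ ∫_{x ∈ Γ : (x, T_x Γ) ∈ B} θ d𝓗^m`. -/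
def ofSubmanifold [MetricSpace M] [MeasurableSpace M] [BorelSpace M]
    [ChartedSpace (EuclideanSpace ℝ (Fin n)) M] {m : ℕ} (Γ : Set M) (θ : M → ℝ≥0∞)
    (B : Set (GrBundle n m M)) : ℝ≥0∞ :=
  ∫⁻ x in {x ∈ Γ | ∃ S : Gr m (TangentSpace (𝓡 n) x),
    S.1 = tangentPlane Γ x ∧ (⟨x, S⟩ : GrBundle n m M) ∈ B}, θ x ∂(hausdorff m M)

end Manifold

end Varifold

end

/-! Stationarity is used twice, each time with a test field built in a C² chart that flattens `Γ` to
the slice y_m = ⋯ = y_{n-1} = 0.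

Tangency. For i ≥ m test with χ y_i ∇y_i, where χ is a cutoff. On `Γ` the factor y_i vanishes, so
only its derivative survives and the divergence over a plane S is χ |dy_i restricted to S|² ≥ 0. Its
integral is zero, hence dy_i = 0 on almost every S near the point. For all i ≥ m together this puts
S inside the tangent plane, and the dimensions agree (`ae_eq_tangentPlane`). The varifold is then
determined by its weight (`measure_eq_weight`).

Constancy. Let J be the area density of the slice, the square root of its Gram determinant. For a
constant direction e tangent to the slice, the tangential divergence of ζe is J⁻¹ ∂_e(Jζ)
(`partialDiv_slice`). Taking ζ = J⁻¹f shows that the weight μ in slice coordinates satisfies ∫ J⁻¹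
∂_e f dμ = 0, so J⁻¹μ has zero distributional derivative. On a ball it is therefore a multiple of
Lebesgue measure (`exists_measure_eq_smul_of_integral_fderiv_eq_zero`), and the area formula
(`hausdorffMeasure_image_sliceParam`) identifies the measure with density J as Hausdorff measure on
`Γ`. The local factors agree on overlaps, which have positive finite measure, so connectedness makes
the factor constant (`exists_weight_eq`).

Both computations need the divergence in a flattening chart, while `covDeriv` is defined through the
preferred chart at each point. The divergence only involves ⟨∇_v X, v⟩, which is half the Lie
derivative of g along X evaluated at (v, v). In coordinates this is half the derivative of (y, w) ↦
g_y(w, w) in the direction (X, DX w), and that expression does not depend on the chart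
(`inner_covDeriv_self`). No transformation law for Christoffel symbols is needed. -/

noncomputable section

namespace Varifold

/-- Euclidean space of dimension `n`. -/
notation "𝔼[" n "]" => EuclideanSpace ℝ (Fin n)

/-! ### Tangent vectors in an arbitrary C² chart -/

section Frame

variable {n : ℕ} {M : Type*} [TopologicalSpace M] [ChartedSpace (EuclideanSpace ℝ (Fin n)) M]

/-- The coordinate frame of a chart `φ` at the point with coordinates `y`: the derivative of the
inverse chart. -/
def frame (φ : OpenPartialHomeomorph M 𝔼[n]) (y : 𝔼[n]) : 𝔼[n] →L[ℝ] TangentSpace (𝓡 n) (φ.symm y) :=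
  (mfderiv (𝓡 n) (𝓡 n) φ.symm y).comp
    (NormedSpace.fromTangentSpace (𝕜 := ℝ) y).symm.toContinuousLinearMap

/-- The derivative of a chart, with values in the model space. -/
def coframe (φ : OpenPartialHomeomorph M 𝔼[n]) (x : M) : TangentSpace (𝓡 n) x →L[ℝ] 𝔼[n] :=
  (NormedSpace.fromTangentSpace (𝕜 := ℝ) (φ x)).toContinuousLinearMap.comp
    (mfderiv (𝓡 n) (𝓡 n) φ x)

variable {φ : OpenPartialHomeomorph M 𝔼[n]}

theorem mdifferentiable_of_mem_maximalAtlas_two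
    (hφ : φ ∈ IsManifold.maximalAtlas (𝓡 n) 2 M) : φ.MDifferentiable (𝓡 n) (𝓡 n) :=
  ⟨(contMDiffOn_of_mem_maximalAtlas hφ).mdifferentiableOn (by norm_num),
    (contMDiffOn_symm_of_mem_maximalAtlas hφ).mdifferentiableOn (by norm_num)⟩

theorem coframe_frame (hφ : φ ∈ IsManifold.maximalAtlas (𝓡 n) 2 M) {y : 𝔼[n]} (hy : y ∈ φ.target)
    (u : 𝔼[n]) : coframe φ (φ.symm y) (frame φ y u) = u := by
  have h := (mdifferentiable_of_mem_maximalAtlas_two hφ).comp_symm_deriv hy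
  exact congrArg (fun L : 𝔼[n] →L[ℝ] 𝔼[n] => L u) h

theorem frame_injective (hφ : φ ∈ IsManifold.maximalAtlas (𝓡 n) 2 M) {y : 𝔼[n]} (hy : y ∈ φ.target) :
    Function.Injective (frame φ y) :=
  Function.LeftInverse.injective (coframe_frame hφ hy)

theorem frame_coframe (hφ : φ ∈ IsManifold.maximalAtlas (𝓡 n) 2 M) {y : 𝔼[n]} (hy : y ∈ φ.target)
    (v : TangentSpace (𝓡 n) (φ.symm y)) : frame φ y (coframe φ (φ.symm y) v) = v := by
  have hs : Function.Surjective (frame φ y : 𝔼[n] →ₗ[ℝ] TangentSpace (𝓡 n) (φ.symm y)) :=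
    (LinearMap.injective_iff_surjective_of_finrank_eq_finrank rfl).1 (frame_injective hφ hy)
  obtain ⟨u, rfl⟩ := hs v
  exact congrArg (frame φ y) (coframe_frame hφ hy u)

/-- The point of the tangent bundle with coordinates `p` in the chart `φ`. -/
def tangentOfCoord (φ : OpenPartialHomeomorph M 𝔼[n]) (p : 𝔼[n] × 𝔼[n]) : TangentBundle (𝓡 n) M :=
  ⟨φ.symm p.1, frame φ p.1 p.2⟩

/-- The coordinates of a tangent vector in the chart `φ`. -/
def coordOfTangent (φ : OpenPartialHomeomorph M 𝔼[n]) (p : TangentBundle (𝓡 n) M) : 𝔼[n] × 𝔼[n] :=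
  (φ p.1, coframe φ p.1 p.2)

theorem tangentOfCoord_coordOfTangent (hφ : φ ∈ IsManifold.maximalAtlas (𝓡 n) 2 M)
    {p : TangentBundle (𝓡 n) M} (hp : p.1 ∈ φ.source) :
    tangentOfCoord φ (coordOfTangent φ p) = p := by
  obtain ⟨x, v⟩ := p
  obtain ⟨y, hy, rfl⟩ : ∃ y ∈ φ.target, φ.symm y = x := ⟨φ x, φ.map_source hp, φ.left_inv hp⟩
  -- The fibres over φ.symm (φ x) and over x are different types; generalising the first coordinate
  -- lets the transport be done by `rfl`.
  have key : ∀ z, z = y → tangentOfCoord φ (z, coframe φ (φ.symm y) v) = ⟨φ.symm y, v⟩ := by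
    rintro z rfl
    exact congrArg (TotalSpace.mk _) (frame_coframe hφ hy v)
  exact key _ (φ.right_inv hy)

variable [IsManifold (𝓡 n) 2 M]

/-- This map is the tangent map of φ.symm, so one derivative of the C² chart is lost. -/
theorem contMDiffOn_tangentOfCoord (hφ : φ ∈ IsManifold.maximalAtlas (𝓡 n) 2 M) :
    ContMDiffOn 𝓘(ℝ, 𝔼[n] × 𝔼[n]) (𝓡 n).tangent 1 (tangentOfCoord φ) (φ.target ×ˢ univ) := by
  have h1 := (contMDiffOn_symm_of_mem_maximalAtlas hφ).contMDiffOn_tangentMapWithin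
    (m := 1) (by norm_num) φ.open_target.uniqueMDiffOn
  have h2 : ContMDiff 𝓘(ℝ, 𝔼[n] × 𝔼[n]) (𝓡 n).tangent 1
      (fun p : 𝔼[n] × 𝔼[n] => (⟨p.1, (NormedSpace.fromTangentSpace (𝕜 := ℝ) p.1).symm p.2⟩ :
        TangentBundle (𝓡 n) 𝔼[n])) := by
    intro p
    apply Bundle.contMDiffAt_totalSpace.2
    refine ⟨contDiff_fst.contMDiff.contMDiffAt, ?_⟩
    have : ContMDiffAt 𝓘(ℝ, 𝔼[n] × 𝔼[n]) 𝓘(ℝ, 𝔼[n]) 1 (fun q : 𝔼[n] × 𝔼[n] => q.2) p :=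
      contDiff_snd.contMDiff.contMDiffAt
    convert! this using 2 with q
    simp
    rfl
  refine (h1.comp h2.contMDiffOn (fun p hp => hp.1)).congr fun p hp => ?_
  simp only [tangentOfCoord, frame, Function.comp, tangentMapWithin]
  rw [mfderivWithin_of_isOpen φ.open_target hp.1]
  rfl

theorem contMDiffOn_coordOfTangent (hφ : φ ∈ IsManifold.maximalAtlas (𝓡 n) 2 M) :
    ContMDiffOn (𝓡 n).tangent 𝓘(ℝ, 𝔼[n] × 𝔼[n]) 1 (coordOfTangent φ)
      (TotalSpace.proj ⁻¹' φ.source) := by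
  have h1 := (contMDiffOn_of_mem_maximalAtlas hφ).contMDiffOn_tangentMapWithin
    (m := 1) (by norm_num) φ.open_source.uniqueMDiffOn
  have h2 : ContMDiffOn (𝓡 n).tangent 𝓘(ℝ, 𝔼[n]) 1 (fun p : TangentBundle (𝓡 n) M =>
      coframe φ p.1 p.2) (TotalSpace.proj ⁻¹' φ.source) := by
    refine ((contMDiff_snd_tangentBundle_modelSpace 𝔼[n] (𝓡 n)).comp_contMDiffOn h1).congr
      fun p hp => ?_
    simp only [coframe, Function.comp, tangentMapWithin]
    rw [mfderivWithin_of_isOpen φ.open_source hp]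
    rfl
  have h3 : ContMDiffOn (𝓡 n).tangent 𝓘(ℝ, 𝔼[n]) 1 (fun p : TangentBundle (𝓡 n) M =>
      φ p.1) (TotalSpace.proj ⁻¹' φ.source) :=
    ((contMDiffOn_of_mem_maximalAtlas hφ).of_le (by norm_num)).comp
      (Bundle.contMDiff_proj _).contMDiffOn (fun p hp => hp)
  exact h3.prodMk_space h2

end Frame

/-! ### The metric in a C² chart and its derivative along a vector field -/

section CoordMetric

variable {n : ℕ} {M : Type*} [TopologicalSpace M] [ChartedSpace 𝔼[n] M]
  {φ ψ : OpenPartialHomeomorph M 𝔼[n]}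

/-- The vector field `X` in the chart `φ`, as a map of the coordinates. -/
def fieldCoord (φ : OpenPartialHomeomorph M 𝔼[n]) (X : ∀ x : M, TangentSpace (𝓡 n) x)
    (y : 𝔼[n]) : 𝔼[n] :=
  coframe φ (φ.symm y) (X (φ.symm y))

theorem fieldCoord_apply (X : ∀ x : M, TangentSpace (𝓡 n) x) {x : M} (hx : x ∈ φ.source) :
    fieldCoord φ X (φ x) = coframe φ x (X x) := by
  have key : ∀ z, z = x → coframe φ z (X z) = coframe φ x (X x) := by rintro z rfl; rfl
  exact key _ (φ.left_inv hx)

theorem contDiffOn_fieldCoord [IsManifold (𝓡 n) 2 M]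
    (hφ : φ ∈ IsManifold.maximalAtlas (𝓡 n) 2 M) {X : ∀ x : M, TangentSpace (𝓡 n) x}
    (hX : ContMDiff (𝓡 n) (𝓡 n).tangent 1 (fun x => (⟨x, X x⟩ : TangentBundle (𝓡 n) M))) :
    ContDiffOn ℝ 1 (fieldCoord φ X) φ.target := by
  have h1 : ContMDiffOn (𝓡 n) (𝓡 n).tangent 1
      (fun y : 𝔼[n] => (⟨φ.symm y, X (φ.symm y)⟩ : TangentBundle (𝓡 n) M)) φ.target :=
    hX.comp_contMDiffOn ((contMDiffOn_symm_of_mem_maximalAtlas hφ).of_le (by norm_num))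
  have h2 := (contMDiffOn_coordOfTangent hφ).comp h1 (fun y hy => φ.map_target hy)
  exact contDiff_snd.comp_contDiffOn h2.contDiffOn

theorem hasFDerivAt_transition (hφ : φ ∈ IsManifold.maximalAtlas (𝓡 n) 2 M)
    (hψ : ψ ∈ IsManifold.maximalAtlas (𝓡 n) 2 M) {y : 𝔼[n]} (hy : y ∈ ψ.target)
    (hy' : ψ.symm y ∈ φ.source) :
    HasFDerivAt (fun z => φ (ψ.symm z)) ((coframe φ (ψ.symm y)).comp (frame ψ y)) y := by
  have h1 := ((mdifferentiable_of_mem_maximalAtlas_two hφ).mdifferentiableAt hy').hasMFDerivAt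
  have h2 :=
    ((mdifferentiable_of_mem_maximalAtlas_two hψ).mdifferentiableAt_symm hy).hasMFDerivAt
  exact (h1.comp y h2).hasFDerivAt

theorem contDiffAt_transition (hφ : φ ∈ IsManifold.maximalAtlas (𝓡 n) 2 M)
    (hψ : ψ ∈ IsManifold.maximalAtlas (𝓡 n) 2 M) {y : 𝔼[n]} (hy : y ∈ ψ.target)
    (hy' : ψ.symm y ∈ φ.source) : ContDiffAt ℝ 2 (fun z => φ (ψ.symm z)) y :=
  ((contMDiffAt_of_mem_maximalAtlas hφ hy').comp y
    (contMDiffAt_symm_of_mem_maximalAtlas hψ hy)).contDiffAt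

theorem eventually_mem_transition {y : 𝔼[n]} (hy : y ∈ ψ.target) (hy' : ψ.symm y ∈ φ.source) :
    ∀ᶠ z in 𝓝 y, z ∈ ψ.target ∧ ψ.symm z ∈ φ.source :=
  Filter.Eventually.and (ψ.open_target.mem_nhds hy) ((ψ.continuousAt_symm hy).preimage_mem_nhds
    (φ.open_source.mem_nhds hy'))

variable [RiemannianBundle (fun x : M => TangentSpace (𝓡 n) x)]

/-- The Riemannian metric in the chart `φ`. -/
def chartMetric (φ : OpenPartialHomeomorph M 𝔼[n]) (y u v : 𝔼[n]) : ℝ :=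
  inner ℝ (frame φ y u) (frame φ y v)

/-- The squared Riemannian length of the tangent vector with coordinates `p` in the chart `φ`. -/
def coordNormSq (φ : OpenPartialHomeomorph M 𝔼[n]) (p : 𝔼[n] × 𝔼[n]) : ℝ :=
  chartMetric φ p.1 p.2 p.2

/-- The squared Riemannian length of a tangent vector. -/
def normSq (p : TangentBundle (𝓡 n) M) : ℝ := inner ℝ p.2 p.2

theorem chartMetric_comm (y u v : 𝔼[n]) : chartMetric φ y u v = chartMetric φ y v u :=
  real_inner_comm _ _

theorem chartMetric_add_left (y u v w : 𝔼[n]) :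
    chartMetric φ y (u + v) w = chartMetric φ y u w + chartMetric φ y v w := by
  simp [chartMetric, inner_add_left]

theorem chartMetric_smul_left (y u w : 𝔼[n]) (c : ℝ) :
    chartMetric φ y (c • u) w = c * chartMetric φ y u w := by
  simp [chartMetric, inner_smul_left]

theorem chartMetric_add_right (y u v w : 𝔼[n]) :
    chartMetric φ y u (v + w) = chartMetric φ y u v + chartMetric φ y u w := by
  simp [chartMetric, inner_add_right]

theorem chartMetric_self_pos (hφ : φ ∈ IsManifold.maximalAtlas (𝓡 n) 2 M) {y : 𝔼[n]}
    (hy : y ∈ φ.target) {u : 𝔼[n]} (hu : u ≠ 0) : 0 < chartMetric φ y u u :=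
  real_inner_self_pos.2 fun h => hu (frame_injective hφ hy (h.trans (map_zero _).symm))

theorem inner_eq_chartMetric (hφ : φ ∈ IsManifold.maximalAtlas (𝓡 n) 2 M) {x : M}
    (hx : x ∈ φ.source) (v w : TangentSpace (𝓡 n) x) :
    inner ℝ v w = chartMetric φ (φ x) (coframe φ x v) (coframe φ x w) := by
  obtain ⟨y, hy, rfl⟩ : ∃ y ∈ φ.target, φ.symm y = x := ⟨φ x, φ.map_source hx, φ.left_inv hx⟩
  rw [φ.right_inv hy, chartMetric, frame_coframe hφ hy, frame_coframe hφ hy]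

theorem chartMetric_eq_coordNormSq (y u v : 𝔼[n]) :
    chartMetric φ y u v = (coordNormSq φ (y, u + v) - coordNormSq φ (y, u)
      - coordNormSq φ (y, v)) / 2 := by
  simp only [coordNormSq, chartMetric_add_left, chartMetric_add_right, chartMetric_comm y v u]
  ring

theorem chartMetric_eq_sum (y u v : 𝔼[n]) : chartMetric φ y u v =
    ∑ i, ∑ j, u i * v j * chartMetric φ y (EuclideanSpace.single i 1)
      (EuclideanSpace.single j 1) := by
  have h : ∀ w : 𝔼[n], w = ∑ i, w i • EuclideanSpace.single i (1 : ℝ) := fun w => by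
    ext j; simp [Finset.sum_apply, Pi.single_apply]
  conv_lhs => rw [h u, h v]
  simp only [chartMetric, map_sum, map_smul, sum_inner]
  refine Finset.sum_congr rfl fun i _ => ?_
  rw [inner_sum]
  refine Finset.sum_congr rfl fun j _ => ?_
  rw [inner_smul_left, inner_smul_right, mul_assoc]
  rfl

variable [IsManifold (𝓡 n) 2 M]
  [IsContMDiffRiemannianBundle (𝓡 n) 1 𝔼[n] (fun x : M => TangentSpace (𝓡 n) x)]

theorem contMDiff_normSq :
    ContMDiff (𝓡 n).tangent 𝓘(ℝ, ℝ) 1 (normSq : TangentBundle (𝓡 n) M → ℝ) := by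
  have h : ContMDiff (𝓡 n).tangent (𝓡 n).tangent 1
      (fun p : TangentBundle (𝓡 n) M => (⟨p.1, p.2⟩ : TangentBundle (𝓡 n) M)) := contMDiff_id
  exact ContMDiff.inner_bundle (b := fun p : TangentBundle (𝓡 n) M => p.1) h h

/-- In a C² chart the metric coefficients are only C¹, and one derivative is all that the first
variation needs. Position and direction are kept as joint variables so that the chain rule can be
applied to changes of chart. -/
theorem contDiffOn_coordNormSq (hφ : φ ∈ IsManifold.maximalAtlas (𝓡 n) 2 M) :
    ContDiffOn ℝ 1 (coordNormSq φ) (φ.target ×ˢ univ) :=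
  (contMDiff_normSq.comp_contMDiffOn (contMDiffOn_tangentOfCoord hφ)).contDiffOn

theorem contDiffAt_coordNormSq (hφ : φ ∈ IsManifold.maximalAtlas (𝓡 n) 2 M) {p : 𝔼[n] × 𝔼[n]}
    (hp : p.1 ∈ φ.target) : ContDiffAt ℝ 1 (coordNormSq φ) p :=
  (contDiffOn_coordNormSq hφ).contDiffAt ((φ.open_target.prod isOpen_univ).mem_nhds ⟨hp, trivial⟩)

theorem contDiffOn_chartMetric (hφ : φ ∈ IsManifold.maximalAtlas (𝓡 n) 2 M) (u v : 𝔼[n]) :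
    ContDiffOn ℝ 1 (fun y => chartMetric φ y u v) φ.target := by
  have h : ∀ w : 𝔼[n], ContDiffOn ℝ 1 (fun y => coordNormSq φ (y, w)) φ.target := fun w =>
    (contDiffOn_coordNormSq hφ).comp (contDiffOn_id.prodMk contDiffOn_const)
      fun y hy => ⟨hy, trivial⟩
  simp only [chartMetric_eq_coordNormSq]
  exact (((h _).sub (h _)).sub (h _)).div_const 2

/-- Split the direction into (a, 0), which differentiates the metric coefficients, and (0, b), which
differentiates a fixed quadratic form. -/
theorem fderiv_coordNormSq (hφ : φ ∈ IsManifold.maximalAtlas (𝓡 n) 2 M) {y : 𝔼[n]}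
    (hy : y ∈ φ.target) (w a b : 𝔼[n]) :
    fderiv ℝ (coordNormSq φ) (y, w) (a, b) =
      fderiv ℝ (fun z => chartMetric φ z w w) y a + 2 * chartMetric φ y b w := by
  have hd := (contDiffAt_coordNormSq hφ (p := (y, w)) hy).differentiableAt one_ne_zero
  have h1 : fderiv ℝ (coordNormSq φ) (y, w) (a, 0) =
      fderiv ℝ (fun z => chartMetric φ z w w) y a := by
    have := hd.hasFDerivAt.comp y (hasFDerivAt_prodMk_left (𝕜 := ℝ) y w)
    exact (congrArg (fun L : 𝔼[n] →L[ℝ] ℝ => L a) this.fderiv).symm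
  have h2 : fderiv ℝ (coordNormSq φ) (y, w) (0, b) = 2 * chartMetric φ y b w := by
    have e1 := (hd.hasFDerivAt.comp w (hasFDerivAt_prodMk_right (𝕜 := ℝ) y w)).fderiv
    let L := frame φ y
    have hL : HasFDerivAt L L w := L.hasFDerivAt
    have e2 := (HasFDerivAt.inner ℝ hL hL).fderiv
    have e3 := congrArg (fun L : 𝔼[n] →L[ℝ] ℝ => L b) (e1.symm.trans e2)
    simp only [ContinuousLinearMap.comp_apply, fderivInnerCLM_apply,
      ContinuousLinearMap.prod_apply, ContinuousLinearMap.inr_apply] at e3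
    rw [e3]
    change inner ℝ (frame φ y w) (frame φ y b) + inner ℝ (frame φ y b) (frame φ y w) = _
    rw [chartMetric, real_inner_comm (frame φ y b)]
    ring
  rw [← h1, ← h2, ← map_add]
  simp

/-- The derivative of the squared length along the flow of a vector field does not depend on the
chart. -/
theorem fderiv_coordNormSq_fieldCoord (hφ : φ ∈ IsManifold.maximalAtlas (𝓡 n) 2 M)
    (hψ : ψ ∈ IsManifold.maximalAtlas (𝓡 n) 2 M) {X : ∀ x : M, TangentSpace (𝓡 n) x}
    (hX : ContMDiff (𝓡 n) (𝓡 n).tangent 1 (fun x => (⟨x, X x⟩ : TangentBundle (𝓡 n) M)))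
    {x : M} (hxφ : x ∈ φ.source) (hxψ : x ∈ ψ.source) (v : TangentSpace (𝓡 n) x) :
    fderiv ℝ (coordNormSq ψ) (ψ x, coframe ψ x v)
        (fieldCoord ψ X (ψ x), fderiv ℝ (fieldCoord ψ X) (ψ x) (coframe ψ x v)) =
      fderiv ℝ (coordNormSq φ) (φ x, coframe φ x v)
        (fieldCoord φ X (φ x), fderiv ℝ (fieldCoord φ X) (φ x) (coframe φ x v)) := by
  obtain ⟨y, hy, rfl⟩ : ∃ y ∈ ψ.target, ψ.symm y = x := ⟨ψ x, ψ.map_source hxψ, ψ.left_inv hxψ⟩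
  obtain ⟨w, rfl⟩ : ∃ w, frame ψ y w = v := ⟨_, frame_coframe hψ hy v⟩
  rw [ψ.right_inv hy, coframe_frame hψ hy]
  set T : 𝔼[n] → 𝔼[n] := fun z => φ (ψ.symm z) with hT
  have hTz : ∀ᶠ z in 𝓝 y, fderiv ℝ T z = (coframe φ (ψ.symm z)).comp (frame ψ z) := by
    filter_upwards [eventually_mem_transition hy hxφ] with z hz
    exact (hasFDerivAt_transition hφ hψ hz.1 hz.2).fderiv
  have hT2 : ContDiffAt ℝ 2 T y := contDiffAt_transition hφ hψ hy hxφ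
  have hTd : HasFDerivAt T (fderiv ℝ T y) y := (hT2.differentiableAt two_ne_zero).hasFDerivAt
  have hT' : HasFDerivAt (fderiv ℝ T) (fderiv ℝ (fderiv ℝ T) y) y :=
    ((hT2.fderiv_right (m := 1) (by norm_num)).differentiableAt one_ne_zero).hasFDerivAt
  have hsymm : IsSymmSndFDerivAt ℝ T y := hT2.isSymmSndFDerivAt (by simp)
  have hw : coframe φ (ψ.symm y) (frame ψ y w) = fderiv ℝ T y w := by rw [hTz.self_of_nhds]; rfl
  have hXψ : HasFDerivAt (fieldCoord ψ X) (fderiv ℝ (fieldCoord ψ X) y) y :=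
    (((contDiffOn_fieldCoord hψ hX).contDiffAt (ψ.open_target.mem_nhds hy)).differentiableAt
      one_ne_zero).hasFDerivAt
  have hXφ : HasFDerivAt (fieldCoord φ X) (fderiv ℝ (fieldCoord φ X) (T y)) (T y) :=
    (((contDiffOn_fieldCoord hφ hX).contDiffAt
      (φ.open_target.mem_nhds (φ.map_source hxφ))).differentiableAt one_ne_zero).hasFDerivAt
  have hrel : ∀ᶠ z in 𝓝 y, fieldCoord φ X (T z) = fderiv ℝ T z (fieldCoord ψ X z) := by
    filter_upwards [eventually_mem_transition hy hxφ, hTz] with z hz hz'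
    rw [hz', hT, fieldCoord_apply X hz.2, ContinuousLinearMap.comp_apply, fieldCoord,
      frame_coframe hψ hz.1]
  -- Differentiate the transformation rule X_φ ∘ T = DT · X_ψ in the direction w; the second
  -- derivative of T appears with arguments (w, X).
  have hderiv : fderiv ℝ (fieldCoord φ X) (T y) (fderiv ℝ T y w) =
      fderiv ℝ (fderiv ℝ T) y w (fieldCoord ψ X y)
        + fderiv ℝ T y (fderiv ℝ (fieldCoord ψ X) y w) := by
    have e1 := (hXφ.comp y hTd).fderiv
    have e2 := (hT'.clm_apply hXψ).fderiv
    have e3 : fderiv ℝ (fieldCoord φ X ∘ T) y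
        = fderiv ℝ (fun z => fderiv ℝ T z (fieldCoord ψ X z)) y := Filter.EventuallyEq.fderiv_eq hrel
    rw [e1, e2] at e3
    have e4 := congrArg (fun L : 𝔼[n] →L[ℝ] 𝔼[n] => L w) e3
    simp only [ContinuousLinearMap.comp_apply, _root_.add_apply,
      ContinuousLinearMap.flip_apply] at e4
    rw [e4, add_comm]
  have hQ : ∀ᶠ p in 𝓝 (y, w), coordNormSq ψ p = coordNormSq φ (T p.1, fderiv ℝ T p.1 p.2) := by
    filter_upwards [(continuous_fst.tendsto (y, w)).eventually
      ((eventually_mem_transition hy hxφ).and hTz)] with p hp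
    rw [hp.2, ContinuousLinearMap.comp_apply, coordNormSq, chartMetric]
    exact inner_eq_chartMetric hφ hp.1.2 _ _
  have hTT : HasFDerivAt (fun p : 𝔼[n] × 𝔼[n] => (T p.1, fderiv ℝ T p.1 p.2)) _ (y, w) :=
    (HasFDerivAt.comp (y, w) (g := T) (f := Prod.fst) hTd hasFDerivAt_fst).prodMk
      ((HasFDerivAt.comp (y, w) (g := fderiv ℝ T) (f := Prod.fst) hT' hasFDerivAt_fst).clm_apply hasFDerivAt_snd)
  have hQφ : HasFDerivAt (coordNormSq φ) _ (T y, fderiv ℝ T y w) :=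
    ((contDiffAt_coordNormSq hφ (p := (T y, fderiv ℝ T y w))
      (φ.map_source hxφ)).differentiableAt one_ne_zero).hasFDerivAt
  rw [hw, Filter.EventuallyEq.fderiv_eq hQ]
  have e5 := (HasFDerivAt.comp (y, w) (g := coordNormSq φ)
    (f := fun p : 𝔼[n] × 𝔼[n] => (T p.1, fderiv ℝ T p.1 p.2)) hQφ hTT).fderiv
  rw [show (fun p : 𝔼[n] × 𝔼[n] => coordNormSq φ (T p.1, fderiv ℝ T p.1 p.2)) =
    coordNormSq φ ∘ fun p => (T p.1, fderiv ℝ T p.1 p.2) from rfl, e5]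
  change _ = fderiv ℝ (coordNormSq φ) (T y, fderiv ℝ T y w) (fieldCoord φ X (T y),
    fderiv ℝ (fieldCoord φ X) (T y) (fderiv ℝ T y w))
  -- The chain rule for (z, w) ↦ (T z, DT_z w) gives the second derivative of T at (X, w) instead;
  -- its symmetry, valid because T is C², makes the two sides equal.
  rw [hderiv, hrel.self_of_nhds, hsymm.eq w]
  simp [add_comm]

end CoordMetric

/-! ### The Levi-Civita derivative on the diagonal, in any C² chart -/

section CovDeriv

variable {n : ℕ}

/-- Here `d i j l` plays the role of ∂_i g_jl. Lowering the index with G cancels G⁻¹. Against w^i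
w^p the terms ∂_i g_jp and -∂_p g_ij cancel under the exchange of i and p, which leaves half of X^j
∂_j g_ip w^i w^p. -/
theorem christoffel_contraction (G : Matrix (Fin n) (Fin n) ℝ) (hG : IsUnit G.det)
    (hsymm : G.IsSymm) (d : Fin n → Fin n → Fin n → ℝ) (hd : ∀ i j l, d i j l = d i l j)
    (w X : Fin n → ℝ) :
    ∑ k, ∑ l, (∑ i, w i * ∑ j, (1 / 2 * ∑ p, G⁻¹ k p * (d i j p + d j i p - d p i j)) * X j)
      * w l * G k l = 1 / 2 * ∑ j, X j * ∑ i, ∑ l, w i * w l * d j i l := by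
  set a : Fin n → ℝ := fun p => 1 / 2 * ∑ i, ∑ j, w i * X j * (d i j p + d j i p - d p i j)
    with ha
  have hr : ∀ k, (∑ i, w i * ∑ j, (1 / 2 * ∑ p, G⁻¹ k p * (d i j p + d j i p - d p i j)) * X j)
      = (G⁻¹.mulVec a) k := by
    intro k
    simp only [Matrix.mulVec, dotProduct, ha, Finset.mul_sum, Finset.sum_mul]
    rw [Finset.sum_comm_cycle]
    refine Finset.sum_congr rfl fun i _ => Finset.sum_congr rfl fun j _ =>
      Finset.sum_congr rfl fun p _ => ?_
    ring
  have h1 : ∑ k, ∑ l, (G⁻¹.mulVec a) k * w l * G k l = dotProduct a w := by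
    have : ∑ k, ∑ l, (G⁻¹.mulVec a) k * w l * G k l
        = dotProduct (G⁻¹.mulVec a) (G.mulVec w) := by
      simp only [dotProduct, Matrix.mulVec.eq_1 G, Finset.mul_sum]
      refine Finset.sum_congr rfl fun i _ => Finset.sum_congr rfl fun j _ => ?_
      ring
    rw [this, Matrix.dotProduct_mulVec, ← Matrix.mulVec_transpose, hsymm.eq, Matrix.mulVec_mulVec,
      Matrix.mul_nonsing_inv _ hG, Matrix.one_mulVec]
  simp only [hr, h1]
  have h2 : ∑ p, ∑ i, ∑ j, w i * X j * w p * d i j p =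
      ∑ p, ∑ i, ∑ j, w i * X j * w p * d p i j := by
    rw [Finset.sum_comm]
    refine Finset.sum_congr rfl fun i _ => Finset.sum_congr rfl fun p _ =>
      Finset.sum_congr rfl fun j _ => ?_
    rw [hd]; ring
  have h3 : ∑ p, ∑ i, ∑ j, w i * X j * w p * d j i p =
      ∑ j, X j * ∑ i, ∑ l, w i * w l * d j i l := by
    simp only [Finset.mul_sum]
    rw [Finset.sum_comm_cycle]
    refine Finset.sum_congr rfl fun i _ => ?_
    rw [Finset.sum_comm]
    refine Finset.sum_congr rfl fun p _ => Finset.sum_congr rfl fun j _ => ?_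
    ring
  have h4 : dotProduct a w = 1 / 2 * (∑ p, ∑ i, ∑ j, w i * X j * w p * d i j p
      + ∑ p, ∑ i, ∑ j, w i * X j * w p * d j i p - ∑ p, ∑ i, ∑ j, w i * X j * w p * d p i j) := by
    simp only [dotProduct, ha, Finset.mul_sum, Finset.sum_mul, ← Finset.sum_add_distrib,
      ← Finset.sum_sub_distrib]
    refine Finset.sum_congr rfl fun i _ => Finset.sum_congr rfl fun p _ =>
      Finset.sum_congr rfl fun j _ => ?_
    ring
  rw [h4, h2, h3]
  ring

theorem fderiv_eq_sum_partialDeriv (f : 𝔼[n] → ℝ) (y v : 𝔼[n]) :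
    fderiv ℝ f y v = ∑ i, v i * partialDeriv i f y := by
  have h : v = ∑ i, v i • EuclideanSpace.single i (1 : ℝ) := by
    ext j; simp [Finset.sum_apply, Pi.single_apply]
  conv_lhs => rw [h]
  simp [map_sum, partialDeriv]

variable {M : Type*} [TopologicalSpace M] [ChartedSpace 𝔼[n] M] [IsManifold (𝓡 n) 2 M]

theorem chart_mem_maximalAtlas_two (c : M) :
    chartAt 𝔼[n] c ∈ IsManifold.maximalAtlas (𝓡 n) 2 M :=
  IsManifold.chart_mem_maximalAtlas c

theorem continuousLinearMapAt_eq_coframe {c x : M} (hx : x ∈ (chartAt 𝔼[n] c).source)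
    (v : TangentSpace (𝓡 n) x) :
    (trivializationAt 𝔼[n] (TangentSpace (𝓡 n)) c).continuousLinearMapAt ℝ x v =
      coframe (chartAt 𝔼[n] c) x v := by
  rw [TangentBundle.continuousLinearMapAt_trivializationAt hx]
  rfl

theorem symmL_eq_frame {c : M} {y : 𝔼[n]} (hy : y ∈ (chartAt 𝔼[n] c).target) (u : 𝔼[n]) :
    (trivializationAt 𝔼[n] (TangentSpace (𝓡 n)) c).symmL ℝ ((chartAt 𝔼[n] c).symm y) u =
      frame (chartAt 𝔼[n] c) y u := by
  have hx : (chartAt 𝔼[n] c).symm y ∈ (chartAt 𝔼[n] c).source :=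
    (chartAt 𝔼[n] c).map_target hy
  have hb : (chartAt 𝔼[n] c).symm y ∈
      (trivializationAt 𝔼[n] (TangentSpace (𝓡 n)) c).baseSet := hx
  have h := (trivializationAt 𝔼[n] (TangentSpace (𝓡 n)) c).symmL_continuousLinearMapAt (R := ℝ) hb
    (frame (chartAt 𝔼[n] c) y u)
  rwa [continuousLinearMapAt_eq_coframe hx, coframe_frame (chart_mem_maximalAtlas_two c) hy] at h

theorem coordField_eq {c : M} {y : 𝔼[n]} (hy : y ∈ (chartAt 𝔼[n] c).target)
    (X : ∀ x : M, TangentSpace (𝓡 n) x) (k : Fin n) :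
    coordField c X k y = fieldCoord (chartAt 𝔼[n] c) X y k := by
  rw [coordField, continuousLinearMapAt_eq_coframe ((chartAt 𝔼[n] c).map_target hy), fieldCoord]

variable [RiemannianBundle (fun x : M => TangentSpace (𝓡 n) x)]

theorem coordMetric_eq {c : M} {y : 𝔼[n]} (hy : y ∈ (chartAt 𝔼[n] c).target) (i j : Fin n) :
    coordMetric c i j y = chartMetric (chartAt 𝔼[n] c) y (EuclideanSpace.single i 1)
      (EuclideanSpace.single j 1) := by
  simp only [coordMetric, chartMetric]
  rw [symmL_eq_frame hy, symmL_eq_frame hy]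

theorem isUnit_det_chartMetric {φ : OpenPartialHomeomorph M 𝔼[n]}
    (hφ : φ ∈ IsManifold.maximalAtlas (𝓡 n) 2 M) {y : 𝔼[n]} (hy : y ∈ φ.target) :
    IsUnit (Matrix.of fun i j => chartMetric φ y (EuclideanSpace.single i 1)
      (EuclideanSpace.single j 1)).det := by
  rw [isUnit_iff_ne_zero]
  intro h0
  obtain ⟨v, hv, h⟩ := Matrix.exists_mulVec_eq_zero_iff.2 h0
  have h1 := chartMetric_self_pos hφ hy (u := WithLp.toLp 2 v) (by
    intro h; exact hv (congrArg WithLp.ofLp h))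
  have h2 : chartMetric φ y (WithLp.toLp 2 v) (WithLp.toLp 2 v) = dotProduct v
      ((Matrix.of fun i j => chartMetric φ y (EuclideanSpace.single i 1)
        (EuclideanSpace.single j 1)).mulVec v) := by
    rw [chartMetric_eq_sum]
    simp only [dotProduct, Matrix.mulVec, Finset.mul_sum, Matrix.of_apply]
    refine Finset.sum_congr rfl fun i _ => Finset.sum_congr rfl fun j _ => ?_
    ring
  rw [h2, h, dotProduct_zero] at h1
  exact h1.false

variable [IsContMDiffRiemannianBundle (𝓡 n) 1 𝔼[n] (fun x : M => TangentSpace (𝓡 n) x)]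

/-- The derivative on the right is ∂_X g(w, w) + 2 g(DX w, w). Half of its second term is the flat
part of the covariant derivative, and `christoffel_contraction` shows that the Christoffel part
supplies half of the first. -/
theorem inner_covDeriv_self_chartAt {X : ∀ x : M, TangentSpace (𝓡 n) x}
    (hX : ContMDiff (𝓡 n) (𝓡 n).tangent 1 (fun x => (⟨x, X x⟩ : TangentBundle (𝓡 n) M)))
    (x : M) (v : TangentSpace (𝓡 n) x) :
    inner ℝ (covDeriv X x v) v = 1 / 2 * fderiv ℝ (coordNormSq (chartAt 𝔼[n] x))
      (chartAt 𝔼[n] x x, coframe (chartAt 𝔼[n] x) x v)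
      (fieldCoord (chartAt 𝔼[n] x) X (chartAt 𝔼[n] x x),
        fderiv ℝ (fieldCoord (chartAt 𝔼[n] x) X) (chartAt 𝔼[n] x x)
          (coframe (chartAt 𝔼[n] x) x v)) := by
  set ψ := chartAt 𝔼[n] x with hψdef
  have hψ : ψ ∈ IsManifold.maximalAtlas (𝓡 n) 2 M := chart_mem_maximalAtlas_two x
  have hx : x ∈ ψ.source := mem_chart_source _ x
  set y := ψ x with hydef
  have hy : y ∈ ψ.target := ψ.map_source hx
  set w := coframe ψ x v with hw
  have hXd : DifferentiableAt ℝ (fieldCoord ψ X) y :=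
    ((contDiffOn_fieldCoord hψ hX).contDiffAt (ψ.open_target.mem_nhds hy)).differentiableAt
      one_ne_zero
  have hpX : ∀ i k, partialDeriv i (coordField x X k) y =
      fderiv ℝ (fieldCoord ψ X) y (EuclideanSpace.single i 1) k := by
    intro i k
    have h1 : coordField x X k =ᶠ[𝓝 y] fun z => fieldCoord ψ X z k := by
      filter_upwards [ψ.open_target.mem_nhds hy] with z hz using coordField_eq hz X k
    rw [partialDeriv, h1.fderiv_eq]
    have h2 := ((EuclideanSpace.proj k : 𝔼[n] →L[ℝ] ℝ).hasFDerivAt.comp y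
      hXd.hasFDerivAt).fderiv
    exact congrArg (fun L : 𝔼[n] →L[ℝ] ℝ => L (EuclideanSpace.single i 1)) h2
  set r : 𝔼[n] := WithLp.toLp 2 fun k => ∑ i, w i * ∑ j, christoffel x k i j y *
    fieldCoord ψ X y j with hr
  -- In coordinates ∇_v X is DX w + r, with r the Christoffel part.
  have hb : x ∈ (trivializationAt 𝔼[n] (TangentSpace (𝓡 n)) x).baseSet := hx
  have hco : coframe ψ x (covDeriv X x v) = fderiv ℝ (fieldCoord ψ X) y w + r := by
    rw [covDeriv, ← continuousLinearMapAt_eq_coframe hx,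
      Bundle.Trivialization.continuousLinearMapAt_symmL _ hb]
    ext k
    have h3 : w = ∑ i, w i • EuclideanSpace.single i (1 : ℝ) := by
      ext j; simp [Finset.sum_apply, Pi.single_apply]
    have h4 : (fderiv ℝ (fieldCoord ψ X) y w) k =
        ∑ i, w i * fderiv ℝ (fieldCoord ψ X) y (EuclideanSpace.single i 1) k := by
      conv_lhs => rw [h3]
      simp [map_sum, Finset.sum_apply]
    rw [PiLp.add_apply, h4, hr]
    simp only [mul_add, Finset.sum_add_distrib]
    rw [continuousLinearMapAt_eq_coframe hx]
    congr 1
    · exact Finset.sum_congr rfl fun i _ => by rw [← hpX]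
    · exact Finset.sum_congr rfl fun i _ => by
        congr 1
        exact Finset.sum_congr rfl fun j _ => by rw [coordField_eq hy]
  rw [inner_eq_chartMetric hψ hx, hco, fderiv_coordNormSq hψ hy, chartMetric_add_left, ← hydef,
    ← hw]
  have key : chartMetric ψ y r w =
      1 / 2 * fderiv ℝ (fun z => chartMetric ψ z w w) y (fieldCoord ψ X y) := by
    have hg : ∀ i j, coordMetric x i j y = chartMetric ψ y (EuclideanSpace.single i 1)
      (EuclideanSpace.single j 1) := coordMetric_eq hy
    have hgd : ∀ i j, DifferentiableAt ℝ (coordMetric x i j) y := by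
      intro i j
      have h1 : coordMetric x i j =ᶠ[𝓝 y] fun z => chartMetric ψ z (EuclideanSpace.single i 1)
          (EuclideanSpace.single j 1) := by
        filter_upwards [ψ.open_target.mem_nhds hy] with z hz using coordMetric_eq hz i j
      exact (((contDiffOn_chartMetric hψ _ _).contDiffAt
        (ψ.open_target.mem_nhds hy)).differentiableAt one_ne_zero).congr_of_eventuallyEq h1
    have hsym : ∀ i j : Fin n, coordMetric (M := M) x i j = coordMetric x j i := fun i j =>
      funext fun z => real_inner_comm _ _
    have h1 : (fun z => chartMetric ψ z w w) =ᶠ[𝓝 y]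
        fun z => ∑ i, ∑ l, w i * w l * coordMetric x i l z := by
      filter_upwards [ψ.open_target.mem_nhds hy] with z hz
      rw [chartMetric_eq_sum]
      simp only [coordMetric_eq hz]
      rfl
    have h2 : HasFDerivAt (fun z => ∑ i, ∑ l, w i * w l * coordMetric x i l z)
        (∑ i, ∑ l, (w i * w l) • fderiv ℝ (coordMetric x i l) y) y :=
      HasFDerivAt.fun_sum fun i _ => HasFDerivAt.fun_sum fun l _ =>
        (hgd i l).hasFDerivAt.const_mul _
    rw [h1.fderiv_eq, fderiv_eq_sum_partialDeriv]
    simp only [partialDeriv, h2.fderiv]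
    rw [chartMetric_eq_sum]
    have h3 := christoffel_contraction (Matrix.of fun a b => coordMetric x a b y)
      (by simpa only [hg] using isUnit_det_chartMetric hψ hy)
      (by ext i j; simp [hsym i j])
      (fun i j l => partialDeriv i (coordMetric x j l) y) (fun i j l => by rw [hsym j l])
      w (fieldCoord ψ X y)
    simp only [← hg, hr, christoffel]
    simp only [Matrix.of_apply] at h3
    refine h3.trans ?_
    simp [partialDeriv, Finset.sum_apply]
  rw [key]
  ring

/-- This frees the divergence from the preferred chart at each point: a single chart adapted to the
submanifold now serves a whole neighbourhood. -/
theorem inner_covDeriv_self {φ : OpenPartialHomeomorph M 𝔼[n]}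
    (hφ : φ ∈ IsManifold.maximalAtlas (𝓡 n) 2 M) {X : ∀ x : M, TangentSpace (𝓡 n) x}
    (hX : ContMDiff (𝓡 n) (𝓡 n).tangent 1 (fun x => (⟨x, X x⟩ : TangentBundle (𝓡 n) M)))
    {x : M} (hx : x ∈ φ.source) (v : TangentSpace (𝓡 n) x) :
    inner ℝ (covDeriv X x v) v = 1 / 2 * fderiv ℝ (coordNormSq φ) (φ x, coframe φ x v)
      (fieldCoord φ X (φ x), fderiv ℝ (fieldCoord φ X) (φ x) (coframe φ x v)) := by
  rw [inner_covDeriv_self_chartAt hX, fderiv_coordNormSq_fieldCoord hφ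
    (chart_mem_maximalAtlas_two x) hX hx (mem_chart_source _ x)]

end CovDeriv

/-! ### Test fields supported in a chart domain -/

section TestField

variable {n : ℕ} {M : Type*} [TopologicalSpace M] [ChartedSpace 𝔼[n] M]
  {φ : OpenPartialHomeomorph M 𝔼[n]} {F : 𝔼[n] → 𝔼[n]}

open scoped Classical in
/-- The vector field on `M` that is `F` in the chart `φ` and vanishes outside its domain. -/
def fieldOfCoord (φ : OpenPartialHomeomorph M 𝔼[n]) (F : 𝔼[n] → 𝔼[n]) (x : M) :
    TangentSpace (𝓡 n) x :=
  if x ∈ φ.source then (coframe φ x).inverse (F (φ x)) else 0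

/-- `frame` at φ x takes values over φ.symm (φ x), whereas the inverse of the coframe lands over x
itself. This is why test fields are defined by the latter and computed with the former. -/
theorem inverse_coframe (hφ : φ ∈ IsManifold.maximalAtlas (𝓡 n) 2 M) {y : 𝔼[n]}
    (hy : y ∈ φ.target) : (coframe φ (φ.symm y)).inverse = frame φ y :=
  ContinuousLinearMap.inverse_eq (ContinuousLinearMap.ext (coframe_frame hφ hy))
    (ContinuousLinearMap.ext (frame_coframe hφ hy))

theorem fieldOfCoord_symm (hφ : φ ∈ IsManifold.maximalAtlas (𝓡 n) 2 M) {y : 𝔼[n]}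
    (hy : y ∈ φ.target) : fieldOfCoord φ F (φ.symm y) = frame φ y (F y) := by
  rw [fieldOfCoord, if_pos (φ.map_target hy), inverse_coframe hφ hy, φ.right_inv hy]

theorem fieldCoord_fieldOfCoord (hφ : φ ∈ IsManifold.maximalAtlas (𝓡 n) 2 M) {y : 𝔼[n]}
    (hy : y ∈ φ.target) : fieldCoord φ (fieldOfCoord φ F) y = F y := by
  rw [fieldCoord, fieldOfCoord_symm hφ hy, coframe_frame hφ hy]

theorem fieldOfCoord_eq_zero {x : M} (hx : x ∉ φ.symm '' tsupport F) :
    fieldOfCoord φ F x = 0 := by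
  rw [fieldOfCoord]
  split_ifs with h
  · rw [image_eq_zero_of_notMem_tsupport (f := F) fun h' => hx ⟨_, h', φ.left_inv h⟩, map_zero]
  · rfl

theorem tangentOfCoord_fieldOfCoord (hφ : φ ∈ IsManifold.maximalAtlas (𝓡 n) 2 M) {x : M}
    (hx : x ∈ φ.source) : (⟨x, fieldOfCoord φ F x⟩ : TangentBundle (𝓡 n) M) =
      tangentOfCoord φ (φ x, F (φ x)) := by
  have h := tangentOfCoord_coordOfTangent hφ (p := ⟨x, fieldOfCoord φ F x⟩) hx
  rw [← h, coordOfTangent, ← fieldCoord_apply (fieldOfCoord φ F) hx,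
    fieldCoord_fieldOfCoord hφ (φ.map_source hx)]

theorem isCompact_symm_image_tsupport (hF : HasCompactSupport F) (hFt : tsupport F ⊆ φ.target) :
    IsCompact (φ.symm '' tsupport F) :=
  hF.isCompact.image_of_continuousOn (φ.continuousOn_symm.mono hFt)

variable [T2Space M]

theorem isCompact_closure_fieldOfCoord (hF : HasCompactSupport F) (hFt : tsupport F ⊆ φ.target) :
    IsCompact (closure {x | fieldOfCoord φ F x ≠ 0}) :=
  (isCompact_symm_image_tsupport hF hFt).closure_of_subset fun x hx => by
    by_contra h
    exact hx (fieldOfCoord_eq_zero h)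

variable [IsManifold (𝓡 n) 2 M]

/-- Outside the chart domain the field vanishes near the point, because the image of the support is
compact, hence closed. -/
theorem contMDiff_fieldOfCoord (hφ : φ ∈ IsManifold.maximalAtlas (𝓡 n) 2 M) (hF1 : ContDiff ℝ 1 F)
    (hF : HasCompactSupport F) (hFt : tsupport F ⊆ φ.target) :
    ContMDiff (𝓡 n) (𝓡 n).tangent 1
      (fun x => (⟨x, fieldOfCoord φ F x⟩ : TangentBundle (𝓡 n) M)) := by
  intro x
  by_cases hx : x ∈ φ.source
  · have h1 : ContMDiffOn (𝓡 n) 𝓘(ℝ, 𝔼[n] × 𝔼[n]) 1 (fun x => (φ x, F (φ x))) φ.source :=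
      (contDiff_id.prodMk hF1).contMDiff.comp_contMDiffOn
        ((contMDiffOn_of_mem_maximalAtlas hφ).of_le (by norm_num))
    have h2 := (contMDiffOn_tangentOfCoord hφ).comp h1 fun z hz => ⟨φ.map_source hz, trivial⟩
    refine ((h2.congr fun z hz => ?_).contMDiffAt (φ.open_source.mem_nhds hx))
    exact tangentOfCoord_fieldOfCoord hφ hz
  · have hK : x ∉ φ.symm '' tsupport F := by
      rintro ⟨y, hy, rfl⟩
      exact hx (φ.map_target (hFt hy))
    have hev := (isCompact_symm_image_tsupport hF hFt).isClosed.isOpen_compl.mem_nhds hK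
    have h0 := (Bundle.contMDiff_zeroSection ℝ (TangentSpace (𝓡 n) : M → Type _)
      (IB := 𝓡 n) (n := 1) (F := 𝔼[n])).contMDiffAt (x := x)
    refine h0.congr_of_eventuallyEq ?_
    filter_upwards [hev] with z hz
    rw [fieldOfCoord_eq_zero hz]
    rfl

variable [RiemannianBundle (fun x : M => TangentSpace (𝓡 n) x)]
  [IsContMDiffRiemannianBundle (𝓡 n) 1 𝔼[n] (fun x : M => TangentSpace (𝓡 n) x)]

/-- The coordinates in `φ` of the vectors of an orthonormal basis of the plane `p`. -/
def planeCoord (φ : OpenPartialHomeomorph M 𝔼[n]) {m : ℕ} (p : GrBundle n m M)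
    (i : Fin (Module.finrank ℝ p.2.1)) : 𝔼[n] :=
  coframe φ p.1 (stdOrthonormalBasis ℝ p.2.1 i : TangentSpace (𝓡 n) p.1)

/-- The partial divergence of a vector field given in a chart. -/
theorem partialDiv_fieldOfCoord (hφ : φ ∈ IsManifold.maximalAtlas (𝓡 n) 2 M)
    (hF1 : ContDiff ℝ 1 F) (hF : HasCompactSupport F) (hFt : tsupport F ⊆ φ.target) {m : ℕ}
    (p : GrBundle n m M) (hp : p.1 ∈ φ.source) :
    partialDiv (fieldOfCoord φ F) p = ∑ i, 1 / 2 * fderiv ℝ (coordNormSq φ)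
      (φ p.1, planeCoord φ p i) (F (φ p.1), fderiv ℝ F (φ p.1) (planeCoord φ p i)) := by
  have hy := φ.map_source hp
  have h1 : fieldCoord φ (fieldOfCoord φ F) =ᶠ[𝓝 (φ p.1)] F := by
    filter_upwards [φ.open_target.mem_nhds hy] with z hz using fieldCoord_fieldOfCoord hφ hz
  refine Finset.sum_congr rfl fun i _ => ?_
  rw [inner_covDeriv_self hφ (contMDiff_fieldOfCoord hφ hF1 hF hFt) hp, h1.fderiv_eq,
    h1.self_of_nhds, planeCoord]

/-- The base point may lie outside the domain of φ, so the preferred chart at that point is used, in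
which the field vanishes near the point. -/
theorem partialDiv_fieldOfCoord_eq_zero (hφ : φ ∈ IsManifold.maximalAtlas (𝓡 n) 2 M)
    (hF1 : ContDiff ℝ 1 F) (hF : HasCompactSupport F) (hFt : tsupport F ⊆ φ.target) {m : ℕ}
    (p : GrBundle n m M) (hp : p.1 ∉ φ.symm '' tsupport F) :
    partialDiv (fieldOfCoord φ F) p = 0 := by
  have hψ := chart_mem_maximalAtlas_two (n := n) p.1
  have hev := (isCompact_symm_image_tsupport hF hFt).isClosed.isOpen_compl.mem_nhds hp
  have hx := mem_chart_source 𝔼[n] p.1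
  have hx' : (chartAt 𝔼[n] p.1).symm (chartAt 𝔼[n] p.1 p.1) = p.1 :=
    (chartAt 𝔼[n] p.1).left_inv hx
  have h1 : fieldCoord (chartAt 𝔼[n] p.1) (fieldOfCoord φ F) =ᶠ[𝓝 (chartAt 𝔼[n] p.1 p.1)]
      fun _ => 0 := by
    have := ((chartAt 𝔼[n] p.1).continuousAt_symm ((chartAt 𝔼[n] p.1).map_source hx))
    rw [ContinuousAt, hx'] at this
    filter_upwards [this hev] with z hz
    rw [fieldCoord, fieldOfCoord_eq_zero hz, map_zero]
  refine Finset.sum_eq_zero fun i _ => ?_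
  rw [inner_covDeriv_self hψ (contMDiff_fieldOfCoord hφ hF1 hF hFt) hx, h1.fderiv_eq,
    h1.self_of_nhds]
  simp only [fderiv_fun_const, Pi.zero_apply, zero_apply]
  exact mul_eq_zero_of_right _ (map_zero _)

end TestField

/-! ### Riemannian distance compared with a frozen metric -/

section Distance

variable {n : ℕ} {M : Type*} [MetricSpace M] [ChartedSpace 𝔼[n] M] [IsManifold (𝓡 n) 2 M]
  [RiemannianBundle (fun x : M => TangentSpace (𝓡 n) x)]
  [IsContMDiffRiemannianBundle (𝓡 n) 1 𝔼[n] (fun x : M => TangentSpace (𝓡 n) x)]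
  {φ : OpenPartialHomeomorph M 𝔼[n]}

theorem norm_frame_eq_sqrt (y u : 𝔼[n]) : ‖frame φ y u‖ = √(chartMetric φ y u u) :=
  norm_eq_sqrt_real_inner _

theorem norm_tangent_eq_sqrt (hφ : φ ∈ IsManifold.maximalAtlas (𝓡 n) 2 M) {x : M}
    (hx : x ∈ φ.source) (v : TangentSpace (𝓡 n) x) :
    ‖v‖ = √(chartMetric φ (φ x) (coframe φ x v) (coframe φ x v)) := by
  rw [norm_eq_sqrt_real_inner, inner_eq_chartMetric hφ hx]

/-- The metric near a point is close to the metric at that point. -/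
theorem eventually_norm_frame_le (hφ : φ ∈ IsManifold.maximalAtlas (𝓡 n) 2 M) {y₀ : 𝔼[n]}
    (hy₀ : y₀ ∈ φ.target) {ε : ℝ} (hε : 0 < ε) :
    ∀ᶠ y in 𝓝 y₀, ∀ u, ‖frame φ y u‖ ≤ (1 + ε) * ‖frame φ y₀ u‖ ∧
      ‖frame φ y₀ u‖ ≤ (1 + ε) * ‖frame φ y u‖ := by
  have hcont : ∀ u, ContinuousAt (fun p : 𝔼[n] × 𝔼[n] => ‖frame φ p.1 p.2‖) (y₀, u) := fun u => by
    simp only [norm_frame_eq_sqrt]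
    exact (contDiffAt_coordNormSq hφ (p := (y₀, u)) hy₀).continuousAt.sqrt
  -- Compactness of the unit sphere makes the estimate uniform in the direction; homogeneity then
  -- extends it to all vectors.
  have hsphere : ∀ᶠ y in 𝓝 y₀, ∀ u ∈ Metric.sphere (0 : 𝔼[n]) 1,
      ‖frame φ y u‖ < (1 + ε) * ‖frame φ y₀ u‖ ∧ ‖frame φ y₀ u‖ < (1 + ε) * ‖frame φ y u‖ := by
    refine (isCompact_sphere (0 : 𝔼[n]) 1).eventually_forall_of_forall_eventually fun u hu => ?_
    have hu0 : u ≠ 0 := by rintro rfl; simp at hu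
    have hpos : 0 < ‖frame φ y₀ u‖ := by
      rw [norm_frame_eq_sqrt]; exact Real.sqrt_pos.2 (chartMetric_self_pos hφ hy₀ hu0)
    have h2 : ContinuousAt (fun p : 𝔼[n] × 𝔼[n] => ‖frame φ y₀ p.2‖) (y₀, u) :=
      ((frame φ y₀).continuous.norm.comp continuous_snd).continuousAt
    have h3 : ‖frame φ y₀ u‖ < (1 + ε) * ‖frame φ y₀ u‖ := by nlinarith
    exact ((hcont u).eventually_lt (h2.const_mul (1 + ε)) h3).and
      (h2.eventually_lt ((hcont u).const_mul (1 + ε)) h3)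
  filter_upwards [hsphere] with y hy u
  rcases eq_or_ne u 0 with rfl | hu
  · simp
  have hn : 0 < ‖u‖ := norm_pos_iff.2 hu
  have hs : (‖u‖⁻¹ • u) ∈ Metric.sphere (0 : 𝔼[n]) 1 := by simp [norm_smul, hu]
  have h := hy _ hs
  simp only [map_smul, norm_smul, norm_inv, norm_norm] at h
  have hinv : 0 < ‖u‖⁻¹ := inv_pos.2 hn
  constructor
  · have := h.1; rw [mul_left_comm] at this
    exact ((mul_lt_mul_iff_right₀ hinv).1 this).le
  · have := h.2; rw [mul_left_comm] at this
    exact ((mul_lt_mul_iff_right₀ hinv).1 this).le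

theorem enorm_le_mul_of_norm_le {G G' : Type*} [SeminormedAddGroup G] [SeminormedAddGroup G']
    {a : G} {b : G'} {C : ℝ} (hC : 0 ≤ C) (h : ‖a‖ ≤ C * ‖b‖) :
    ‖a‖ₑ ≤ ENNReal.ofReal C * ‖b‖ₑ := by
  rw [← ofReal_norm, ← ofReal_norm, ← ENNReal.ofReal_mul hC]
  exact ENNReal.ofReal_le_ofReal h

/-- The length of a curve in the domain of a chart bounds the length of its image. -/
theorem enorm_sub_le_pathELength (hφ : φ ∈ IsManifold.maximalAtlas (𝓡 n) 2 M)
    (L : 𝔼[n] →L[ℝ] 𝔼[n]) {C : ℝ} (hC : 0 ≤ C) {W : Set 𝔼[n]}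
    (hLW : ∀ y ∈ W, ∀ u, ‖L u‖ ≤ C * ‖frame φ y u‖) {γ : ℝ → M}
    (hγ : ContMDiffOn 𝓘(ℝ, ℝ) (𝓡 n) 1 γ (Icc 0 1))
    (hγW : ∀ t ∈ Icc (0 : ℝ) 1, γ t ∈ φ.source ∧ φ (γ t) ∈ W) :
    ‖L (φ (γ 1)) - L (φ (γ 0))‖ₑ ≤ ENNReal.ofReal C * Manifold.pathELength (𝓡 n) γ 0 1 := by
  have hφγ : ContDiffOn ℝ 1 (fun t => L (φ (γ t))) (Icc 0 1) := by
    refine L.contDiff.comp_contDiffOn ?_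
    exact (((contMDiffOn_of_mem_maximalAtlas hφ).of_le (by norm_num)).comp hγ
      fun t ht => (hγW t ht).1).contDiffOn
  refine (enorm_sub_le_lintegral_derivWithin_Icc_of_contDiffOn_Icc hφγ zero_le_one).trans ?_
  rw [Manifold.pathELength_eq_lintegral_mfderivWithin_Icc,
    ← lintegral_const_mul' _ _ ENNReal.ofReal_ne_top]
  refine setLIntegral_mono' measurableSet_Icc fun t ht => ?_
  have hx := (hγW t ht).1
  have h1 := ((mdifferentiable_of_mem_maximalAtlas_two hφ).mdifferentiableAt hx).hasMFDerivAt
  have h2 := ((hγ t ht).mdifferentiableWithinAt one_ne_zero).hasMFDerivWithinAt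
  have h3 : HasFDerivWithinAt (fun t => φ (γ t)) ((coframe φ (γ t)).comp
      (mfderivWithin 𝓘(ℝ, ℝ) (𝓡 n) γ (Icc 0 1) t)) (Icc 0 1) t :=
    (h1.comp_hasMFDerivWithinAt t h2).hasFDerivWithinAt
  have h4 : HasFDerivWithinAt (fun t => L (φ (γ t))) (L.comp ((coframe φ (γ t)).comp
      (mfderivWithin 𝓘(ℝ, ℝ) (𝓡 n) γ (Icc 0 1) t))) (Icc 0 1) t :=
    L.hasFDerivAt.comp_hasFDerivWithinAt t h3
  rw [h4.hasDerivWithinAt.derivWithin (uniqueDiffOn_Icc zero_lt_one t ht)]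
  refine enorm_le_mul_of_norm_le hC ((hLW _ (hγW t ht).2 _).trans_eq ?_)
  rw [norm_frame_eq_sqrt]
  exact congrArg (C * ·) (norm_tangent_eq_sqrt hφ hx _).symm

/-- The coordinate segment from y to z stays in the convex set W and is a competitor for the
distance. -/
theorem riemannianEDist_symm_le (hφ : φ ∈ IsManifold.maximalAtlas (𝓡 n) 2 M)
    {G : Type*} [NormedAddCommGroup G] [NormedSpace ℝ G]
    (L : 𝔼[n] →L[ℝ] G) {C : ℝ} (hC : 0 ≤ C) {W : Set 𝔼[n]} (hW : Convex ℝ W)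
    (hWt : W ⊆ φ.target) (hLW : ∀ y ∈ W, ∀ u, ‖frame φ y u‖ ≤ C * ‖L u‖) {y z : 𝔼[n]}
    (hy : y ∈ W) (hz : z ∈ W) :
    Manifold.riemannianEDist (𝓡 n) (φ.symm y) (φ.symm z) ≤ ENNReal.ofReal C * ‖L (z - y)‖ₑ := by
  set η : ℝ → 𝔼[n] := fun t => y + t • (z - y) with hη
  have hηW : ∀ t ∈ Icc (0 : ℝ) 1, η t ∈ W := fun t ht => hW.add_smul_sub_mem hy hz ht
  have hηd : ∀ t, HasDerivAt η (z - y) t := fun t => by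
    simpa [hη] using ((hasDerivAt_id t).smul_const (z - y)).const_add y
  have hηs : ContDiff ℝ 1 η := by fun_prop
  have hγ : ContMDiffOn 𝓘(ℝ, ℝ) (𝓡 n) 1 (fun t => φ.symm (η t)) (Icc 0 1) :=
    ((contMDiffOn_symm_of_mem_maximalAtlas hφ).of_le (by norm_num)).comp
      hηs.contMDiff.contMDiffOn fun t ht => hWt (hηW t ht)
  refine (Manifold.riemannianEDist_le_pathELength hγ (by simp [hη]) (by simp [hη])
    zero_le_one).trans ?_
  rw [Manifold.pathELength_eq_lintegral_mfderiv_Icc]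
  calc _ ≤ ∫⁻ t in Icc (0 : ℝ) 1, ENNReal.ofReal C * ‖L (z - y)‖ₑ := by
        refine setLIntegral_mono' measurableSet_Icc fun t ht => ?_
        have h1 := ((mdifferentiable_of_mem_maximalAtlas_two hφ).mdifferentiableAt_symm
          (hWt (hηW t ht))).hasMFDerivAt
        have h2 : HasMFDerivAt 𝓘(ℝ, ℝ) (𝓡 n) η t _ := (hηd t).hasFDerivAt.hasMFDerivAt
        have h3 := (h1.comp t h2).mfderiv
        have h4 : (mfderiv 𝓘(ℝ, ℝ) (𝓡 n) (fun t => φ.symm (η t)) t) (1 : ℝ) =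
            frame φ (η t) (z - y) := by
          have h5 := congrArg (fun T : ℝ →L[ℝ] 𝔼[n] => T (1 : ℝ)) h3
          refine h5.trans ?_
          change frame φ (η t) ((1 : ℝ) • (z - y)) = _
          rw [one_smul]
        have h6 := enorm_le_mul_of_norm_le hC (hLW _ (hηW t ht) (z - y))
        rw [← h4] at h6
        exact h6
    _ = _ := by simp

variable [IsRiemannianManifold (𝓡 n) M]

/-- Near a point the Riemannian distance is close to the distance given by the metric at that
point. -/
theorem exists_dist_symm_bounds (hφ : φ ∈ IsManifold.maximalAtlas (𝓡 n) 2 M) {y₀ : 𝔼[n]}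
    (hy₀ : y₀ ∈ φ.target) (L : 𝔼[n] →L[ℝ] 𝔼[n]) (hL : ∀ u, ‖L u‖ = ‖frame φ y₀ u‖)
    {ε : ℝ} (hε : 0 < ε) :
    ∃ δ > 0, ∀ y ∈ Metric.ball y₀ δ, ∀ z ∈ Metric.ball y₀ δ,
      dist (φ.symm y) (φ.symm z) ≤ (1 + ε) * dist (L y) (L z) ∧
        dist (L y) (L z) ≤ (1 + ε) * dist (φ.symm y) (φ.symm z) := by
  have hC : 0 ≤ 1 + ε := by positivity
  obtain ⟨W, hW, hWo, hyW⟩ := eventually_nhds_iff.1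
    ((eventually_norm_frame_le hφ hy₀ hε).and (φ.open_target.mem_nhds hy₀))
  have hΩ : φ.source ∩ φ ⁻¹' W ∈ 𝓝 (φ.symm y₀) :=
    (φ.isOpen_inter_preimage hWo).mem_nhds ⟨φ.map_target hy₀, by
      rwa [mem_preimage, φ.right_inv hy₀]⟩
  obtain ⟨r, hr, hrΩ⟩ := Metric.mem_nhds_iff.1 hΩ
  -- With r / 3, two such points are less than 2r/3 apart, and a path from one of them of length
  -- below 2r/3 stays in the ball of radius r. Almost minimising paths therefore do not leave the
  -- region where the metric is nearly constant.
  have hnear : ∀ᶠ y in 𝓝 y₀, φ.symm y ∈ Metric.ball (φ.symm y₀) (r / 3) ∧ y ∈ W :=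
    Filter.Eventually.and ((φ.continuousAt_symm hy₀) (Metric.ball_mem_nhds _ (by positivity)))
      (hWo.mem_nhds hyW)
  obtain ⟨δ, hδ, hδW⟩ := Metric.eventually_nhds_iff_ball.1 hnear
  refine ⟨δ, hδ, fun y hy z hz => ⟨?_, ?_⟩⟩
  · have h := riemannianEDist_symm_le hφ L hC (convex_ball y₀ δ)
      (fun u hu => (hW u (hδW u hu).2).2) (fun u hu v => by
        rw [hL]; exact ((hW u (hδW u hu).2).1 v).1) hy hz
    rw [← IsRiemannianManifold.out (I := 𝓡 n), edist_dist, ← ofReal_norm,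
      ← ENNReal.ofReal_mul hC] at h
    have h' := (ENNReal.ofReal_le_ofReal_iff (by positivity)).1 h
    rwa [map_sub, ← dist_eq_norm, dist_comm (L z)] at h'
  · have hyz : dist (φ.symm y) (φ.symm z) < 2 * r / 3 := by
      have h1 := (hδW y hy).1
      have h2 := (hδW z hz).1
      rw [Metric.mem_ball] at h1 h2
      linarith [dist_triangle_right (φ.symm y) (φ.symm z) (φ.symm y₀)]
    have key : ∀ s : ℝ, dist (φ.symm y) (φ.symm z) < s → s ≤ 2 * r / 3 →
        dist (L y) (L z) ≤ (1 + ε) * s := by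
      intro s hs hsr
      have hs0 : 0 < s := dist_nonneg.trans_lt hs
      have hlt : Manifold.riemannianEDist (𝓡 n) (φ.symm y) (φ.symm z) < ENNReal.ofReal s := by
        rw [← IsRiemannianManifold.out (I := 𝓡 n), edist_dist]
        exact (ENNReal.ofReal_lt_ofReal_iff hs0).2 hs
      obtain ⟨γ, hγ0, hγ1, hγ, hlen⟩ := Manifold.exists_lt_of_riemannianEDist_lt hlt
      have hstay : ∀ t ∈ Icc (0 : ℝ) 1, γ t ∈ φ.source ∩ φ ⁻¹' W := by
        intro t ht
        refine hrΩ ?_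
        have h1 : edist (φ.symm y) (γ t) < ENNReal.ofReal s := by
          rw [IsRiemannianManifold.out (I := 𝓡 n)]
          exact (Manifold.riemannianEDist_le_pathELength
            (hγ.mono (Icc_subset_Icc_right ht.2)) hγ0 rfl ht.1).trans_lt
            ((Manifold.pathELength_mono le_rfl ht.2).trans_lt hlen)
        rw [edist_dist, ENNReal.ofReal_lt_ofReal_iff hs0] at h1
        have h2 := (hδW y hy).1
        rw [Metric.mem_ball] at h2 ⊢
        linarith [dist_triangle_left (γ t) (φ.symm y₀) (φ.symm y)]
      have h := enorm_sub_le_pathELength hφ L hC (W := W)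
        (fun u hu v => by rw [hL]; exact ((hW u hu).1 v).2) hγ hstay
      have h' := h.trans (mul_le_mul_right hlen.le _)
      have hyt : y ∈ φ.target := (hW y (hδW y hy).2).2
      have hzt : z ∈ φ.target := (hW z (hδW z hz).2).2
      rw [hγ0, hγ1, φ.right_inv hyt, φ.right_inv hzt, ← ofReal_norm, ← ENNReal.ofReal_mul hC,
        ENNReal.ofReal_le_ofReal_iff (by positivity), ← dist_eq_norm, dist_comm] at h'
      exact h'
    -- For b above (1 + ε) times the distance, `key` applies with s = min (b / (1 + ε)) (2r/3),
    -- which still exceeds the distance.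
    refine le_of_forall_gt_imp_ge_of_dense fun b hb => ?_
    have hb' : dist (φ.symm y) (φ.symm z) < b / (1 + ε) := by
      rw [lt_div_iff₀ (by positivity)]; linarith
    have := key _ (lt_min hb' hyz) (min_le_right _ _)
    refine this.trans ?_
    calc (1 + ε) * min (b / (1 + ε)) (2 * r / 3) ≤ (1 + ε) * (b / (1 + ε)) :=
          mul_le_mul_of_nonneg_left (min_le_left _ _) hC
      _ = b := by field_simp

end Distance

/-! ### Derivative of the square root of a determinant -/

section Determinant

variable {m : ℕ}

theorem contDiff_det : ContDiff ℝ ∞ (fun N : Fin m → Fin m → ℝ => (Matrix.of N).det) := by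
  simp only [Matrix.det_apply, Matrix.of_apply]
  refine ContDiff.sum fun σ _ => ContDiff.const_smul _ ?_
  exact contDiff_prod fun i _ => (contDiff_apply_apply ℝ ℝ (σ i) i)

/-- Read off from the polynomial expansion det(1 + tB) = 1 + t tr B + O(t²). -/
theorem fderiv_det_one (B : Fin m → Fin m → ℝ) :
    fderiv ℝ (fun N : Fin m → Fin m → ℝ => (Matrix.of N).det)
      (fun i j => (1 : Matrix (Fin m) (Fin m) ℝ) i j) B =
      ∑ i, B i i := by
  have hd : DifferentiableAt ℝ (fun N : Fin m → Fin m → ℝ => (Matrix.of N).det)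
      (fun i j => (1 : Matrix (Fin m) (Fin m) ℝ) i j) :=
    contDiff_det.differentiable (by simp) _
  have h1 : HasDerivAt (fun t : ℝ => (1 + t • Matrix.of B).det) (∑ i, B i i) 0 := by
    rw [funext fun t : ℝ => Matrix.det_one_add_smul t (Matrix.of B)]
    have := (((hasDerivAt_id (0 : ℝ)).const_mul (Matrix.of B).trace).const_add 1).add
      ((Polynomial.hasDerivAt (Matrix.det
        (1 + (Polynomial.X : Polynomial ℝ) • (Matrix.of B).map Polynomial.C)).divX.divX 0).mul
        ((hasDerivAt_id (0 : ℝ)).pow 2))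
    refine this.congr_deriv ?_
    simp [Matrix.trace]
  have h2 : HasDerivAt (fun t : ℝ => (fun i j => (1 : Matrix (Fin m) (Fin m) ℝ) i j) + t • B) B 0 := by
    have := ((hasDerivAt_id (0 : ℝ)).smul_const B).const_add
      (fun i j => (1 : Matrix (Fin m) (Fin m) ℝ) i j)
    simpa using this
  have h3 := HasFDerivAt.comp_hasDerivAt_of_eq (0 : ℝ) hd.hasFDerivAt h2 (by simp)
  exact h3.unique h1

/-- The columns of U are orthonormal for h(y). Since det(Uᵀ h U) = (det U)² det h and Uᵀ h U is the
identity at y, the derivative of the determinant at the identity suffices, and the logarithmic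
derivative of √det is half the trace of Uᵀ (Dh) U. -/
theorem fderiv_sqrt_det {F : Type*} [NormedAddCommGroup F] [NormedSpace ℝ F]
    (h : F → Matrix (Fin m) (Fin m) ℝ) (y a : F)
    (hd : ∀ i j, DifferentiableAt ℝ (fun z => h z i j) y) (U : Matrix (Fin m) (Fin m) ℝ)
    (hU : U.transpose * h y * U = 1) :
    fderiv ℝ (fun z => √(h z).det) y a = √(h y).det *
      (1 / 2 * ∑ k, ∑ i, ∑ j, U i k * U j k * fderiv ℝ (fun z => h z i j) y a) := by
  set N : F → Fin m → Fin m → ℝ := fun z k l => (U.transpose * h z * U) k l with hN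
  set N' : F →L[ℝ] Fin m → Fin m → ℝ := ContinuousLinearMap.pi fun k => ContinuousLinearMap.pi
    fun l => ∑ j, ∑ i, (U i k * U j l) • fderiv ℝ (fun z => h z i j) y with hN'
  have hNd : HasFDerivAt N N' y := by
    rw [hasFDerivAt_pi]
    intro k
    rw [hasFDerivAt_pi]
    intro l
    have : ∀ z, N z k l = ∑ j, ∑ i, (U i k * U j l) * h z i j := fun z => by
      have h0 : N z k l = ∑ j, (∑ i, U i k * h z i j) * U j l := rfl
      simp only [h0, Finset.sum_mul]
      refine Finset.sum_congr rfl fun j _ => Finset.sum_congr rfl fun i _ => ?_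
      ring
    refine HasFDerivAt.congr_of_eventuallyEq ?_ (Filter.Eventually.of_forall this)
    exact HasFDerivAt.fun_sum fun j _ => HasFDerivAt.fun_sum fun i _ =>
      (hd i j).hasFDerivAt.const_mul _
  have hNy : N y = fun i j => (1 : Matrix (Fin m) (Fin m) ℝ) i j :=
    funext fun i => funext fun j => congrArg (fun A : Matrix (Fin m) (Fin m) ℝ => A i j) hU
  have hdet : ∀ z, (Matrix.of (N z)).det = U.det ^ 2 * (h z).det := fun z => by
    change (U.transpose * h z * U).det = _
    rw [Matrix.det_mul, Matrix.det_mul, Matrix.det_transpose]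
    ring
  have h1 : U.det ^ 2 * (h y).det = 1 := by
    rw [← hdet, hNy]; exact Matrix.det_one
  have hU0 : U.det ^ 2 ≠ 0 := fun h0 => by simp [h0] at h1
  have hdd : DifferentiableAt ℝ (fun N : Fin m → Fin m → ℝ => (Matrix.of N).det) (N y) :=
    contDiff_det.differentiable (by simp) _
  have hD : HasFDerivAt (fun z => (Matrix.of (N z)).det) _ y :=
    HasFDerivAt.comp y (g := fun N : Fin m → Fin m → ℝ => (Matrix.of N).det) hdd.hasFDerivAt hNd
  have hpos : 0 < (h y).det := by
    have : 0 < U.det ^ 2 := lt_of_le_of_ne (sq_nonneg _) hU0.symm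
    by_contra hc
    nlinarith [mul_nonneg this.le (neg_nonneg.2 (not_lt.1 hc))]
  have hh := hD.const_mul (U.det ^ 2)⁻¹
  simp only [hdet, inv_mul_cancel_left₀ hU0] at hh
  rw [(hh.sqrt hpos.ne').fderiv]
  have e : fderiv ℝ (fun N : Fin m → Fin m → ℝ => (Matrix.of N).det) (N y) (N' a)
      = ∑ k, ∑ i, ∑ j, U i k * U j k * fderiv ℝ (fun z => h z i j) y a := by
    rw [hNy, fderiv_det_one]
    refine Finset.sum_congr rfl fun k _ => ?_
    rw [Finset.sum_comm]
    simp [hN']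
  simp only [_root_.smul_apply, ContinuousLinearMap.comp_apply, smul_eq_mul]
  rw [e]
  have h2 : (U.det ^ 2)⁻¹ = √(h y).det * √(h y).det := by
    rw [Real.mul_self_sqrt hpos.le]
    exact inv_eq_of_mul_eq_one_right h1
  rw [h2]
  have h3 : √(h y).det ≠ 0 := (Real.sqrt_pos.2 hpos).ne'
  field_simp

end Determinant

/-! ### Measures with vanishing distributional derivative -/

section Constancy

variable {F : Type*} [NormedAddCommGroup F] [NormedSpace ℝ F] [MeasurableSpace F]
  [BorelSpace F] [FiniteDimensional ℝ F]

/-- A finite measure whose distributional derivative vanishes does not see translations. -/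
theorem integral_comp_sub_eq {μ : Measure F} [IsFiniteMeasure μ] {B : Set F}
    (hμ : ∀ f : F → ℝ, ContDiff ℝ 1 f → HasCompactSupport f → tsupport f ⊆ B → ∀ v,
      ∫ x, fderiv ℝ f x v ∂μ = 0)
    {g : F → ℝ} (hg : ContDiff ℝ 1 g) (hgc : HasCompactSupport g) {v : F}
    (hB : ∀ t ∈ Icc (0 : ℝ) 1, tsupport (fun x => g (x - t • v)) ⊆ B) :
    ∫ x, g (x - v) ∂μ = ∫ x, g x ∂μ := by
  have hsm : ∀ t : ℝ, ContDiff ℝ 1 fun x => g (x - t • v) := fun t =>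
    hg.comp (contDiff_id.sub contDiff_const)
  have hcs : ∀ t : ℝ, HasCompactSupport fun x => g (x - t • v) := fun t =>
    hgc.comp_homeomorph (Homeomorph.subRight (t • v))
  have hfd : ∀ t : ℝ, ∀ x, fderiv ℝ (fun x => g (x - t • v)) x = fderiv ℝ g (x - t • v) := by
    intro t x
    exact fderiv_comp_sub (t • v)
  have hcont : Continuous fun x => fderiv ℝ g x := hg.continuous_fderiv one_ne_zero
  obtain ⟨C, hC⟩ := (hgc.fderiv (𝕜 := ℝ)).exists_bound_of_continuous hcont
  have hderiv : ∀ t : ℝ, HasDerivAt (fun t : ℝ => ∫ x, g (x - t • v) ∂μ)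
      (∫ x, -(fderiv ℝ g (x - t • v) v) ∂μ) t := by
    -- Differentiation under the integral sign, dominated by a constant, which is integrable for a
    -- finite measure.
    intro t
    refine (hasDerivAt_integral_of_dominated_loc_of_deriv_le (s := univ)
      (F' := fun t x => -(fderiv ℝ g (x - t • v) v)) (bound := fun _ => C * ‖v‖)
      Filter.univ_mem (Filter.Eventually.of_forall fun s => ?_) ?_ ?_ ?_ ?_ ?_).2
    · exact (hsm s).continuous.aestronglyMeasurable
    · exact (hsm t).continuous.integrable_of_hasCompactSupport (hcs t)
    · have hc : Continuous fun x => -(fderiv ℝ g (x - t • v) v) :=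
        ((hcont.comp (continuous_id.sub continuous_const)).clm_apply continuous_const).neg
      exact hc.aestronglyMeasurable
    · refine Filter.Eventually.of_forall fun x s _ => ?_
      rw [norm_neg]
      exact ((fderiv ℝ g (x - s • v)).le_opNorm v).trans
        (mul_le_mul_of_nonneg_right (hC _) (norm_nonneg _))
    · exact integrable_const _
    · refine Filter.Eventually.of_forall fun x s _ => ?_
      have h1 : HasDerivAt (fun s : ℝ => x - s • v) (-v) s := by
        simpa using ((hasDerivAt_id s).smul_const v).const_sub x
      have h2 := ((hg.differentiable one_ne_zero (x - s • v)).hasFDerivAt.comp_hasDerivAt s h1)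
      rwa [map_neg] at h2
  have hzero : ∀ t ∈ Icc (0 : ℝ) 1, ∫ x, -(fderiv ℝ g (x - t • v) v) ∂μ = 0 := by
    intro t ht
    have := hμ _ (hsm t) (hcs t) (hB t ht) v
    simp only [hfd] at this
    rw [integral_neg, this, neg_zero]
  have := constant_of_has_deriv_right_zero (f := fun t : ℝ => ∫ x, g (x - t • v) ∂μ) (a := 0)
    (b := 1) (fun t _ => (hderiv t).continuousAt.continuousWithinAt) (fun t ht => by
      have h := (hderiv t).hasDerivWithinAt (s := Ici t)
      rwa [hzero t ⟨ht.1, ht.2.le⟩] at h) 1 (by simp)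
  simpa using this

/-- Write the left side as the double integral of f(x) g(x + y). For fixed y the product may be
translated by y under μ, giving f(x - y) g(x), and integrating in y first separates the factors
again. Convexity of B makes the translation legitimate for every y. -/
theorem integral_mul_integral_eq {μ lam : Measure F} [IsFiniteMeasure μ] [lam.IsAddHaarMeasure]
    {B : Set F} (hBc : Convex ℝ B)
    (hμ : ∀ f : F → ℝ, ContDiff ℝ 1 f → HasCompactSupport f → tsupport f ⊆ B → ∀ v,
      ∫ x, fderiv ℝ f x v ∂μ = 0)
    {f g : F → ℝ} (hf : ContDiff ℝ 1 f) (hfc : HasCompactSupport f) (hfB : tsupport f ⊆ B)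
    (hg : ContDiff ℝ 1 g) (hgc : HasCompactSupport g) (hgB : tsupport g ⊆ B) :
    (∫ x, f x ∂μ) * ∫ y, g y ∂lam = (∫ x, g x ∂μ) * ∫ y, f y ∂lam := by
  have htr : ∀ y, ∫ x, f x * g (x + y) ∂μ = ∫ x, f (x - y) * g x ∂μ := by
    intro y
    have hs : ∀ t ∈ Icc (0 : ℝ) 1,
        tsupport (fun x => f (x - t • y) * g (x - t • y + y)) ⊆ B := by
      intro t ht
      have hcl : IsClosed {x | x - t • y ∈ tsupport f ∧ x - t • y + y ∈ tsupport g} :=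
        ((isClosed_tsupport f).preimage (by fun_prop)).inter
          ((isClosed_tsupport g).preimage (by fun_prop))
      refine (closure_minimal (fun x hx => ?_) hcl).trans fun x hx => ?_
      · rw [Function.mem_support] at hx
        exact ⟨subset_tsupport f (left_ne_zero_of_mul hx),
          subset_tsupport g (right_ne_zero_of_mul hx)⟩
      -- The point x is the convex combination of x - ty, in the support of f, and x - ty + y, in
      -- the support of g, with weights 1 - t and t.
      · have := hBc (hfB hx.1) (hgB hx.2) (sub_nonneg.2 ht.2) ht.1 (by ring)
        convert this using 1
        simp only [smul_add, smul_sub, sub_smul, one_smul]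
        abel
    have h := integral_comp_sub_eq hμ (g := fun x => f x * g (x + y)) (v := y)
      (hf.mul (hg.comp (contDiff_id.add contDiff_const))) (hfc.mul_right) hs
    simpa using h.symm
  have hK : ∀ {f g : F → ℝ} (_ : ContDiff ℝ 1 f) (_ : HasCompactSupport f) (_ : ContDiff ℝ 1 g)
      (_ : HasCompactSupport g), ∫ x, ∫ y, f x * g (x + y) ∂lam ∂μ
        = ∫ y, ∫ x, f x * g (x + y) ∂μ ∂lam := by
    intro f g hf hfc hg hgc
    refine integral_integral_swap_of_hasCompactSupport
      (f := fun x y => f x * g (x + y)) ?_ ?_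
    · exact (hf.continuous.comp continuous_fst).mul
        (hg.continuous.comp (continuous_fst.add continuous_snd))
    · refine HasCompactSupport.intro ((hfc.isCompact.prod hgc.isCompact).image
        (f := fun p : F × F => (p.1, p.2 - p.1)) (by fun_prop)) fun p hp => ?_
      by_contra h
      have h' : f p.1 * g (p.1 + p.2) ≠ 0 := h
      exact hp ⟨(p.1, p.1 + p.2), ⟨subset_tsupport f (left_ne_zero_of_mul h'),
        subset_tsupport g (right_ne_zero_of_mul h')⟩, by simp⟩
  have hK' : ∫ x, ∫ y, f (x - y) * g x ∂lam ∂μ = ∫ y, ∫ x, f (x - y) * g x ∂μ ∂lam := by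
    refine integral_integral_swap_of_hasCompactSupport
      (f := fun x y => f (x - y) * g x) ?_ ?_
    · exact (hf.continuous.comp (continuous_fst.sub continuous_snd)).mul
        (hg.continuous.comp continuous_fst)
    · refine HasCompactSupport.intro ((hgc.isCompact.prod hfc.isCompact).image
        (f := fun p : F × F => (p.1, p.1 - p.2)) (by fun_prop)) fun p hp => ?_
      by_contra h
      have h' : f (p.1 - p.2) * g p.1 ≠ 0 := h
      exact hp ⟨(p.1, p.1 - p.2), ⟨subset_tsupport g (right_ne_zero_of_mul h'),
        subset_tsupport f (left_ne_zero_of_mul h')⟩, by simp⟩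
  calc (∫ x, f x ∂μ) * ∫ y, g y ∂lam = ∫ x, ∫ y, f x * g (x + y) ∂lam ∂μ := by
        simp only [integral_const_mul, integral_add_left_eq_self g, integral_mul_const]
    _ = ∫ y, ∫ x, f (x - y) * g x ∂μ ∂lam := by
        rw [hK hf hfc hg hgc]
        simp only [htr]
    _ = (∫ x, g x ∂μ) * ∫ y, f y ∂lam := by
        rw [← hK']
        simp only [integral_mul_const, integral_sub_left_eq_self f lam, integral_const_mul]
        exact mul_comm _ _

/-- For each open U containing K, a smooth bump equal to 1 on K and supported in U ∩ B gives μ K ≤ ν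
U; outer regularity concludes. -/
theorem measure_le_of_integral_le {μ ν : Measure F} [IsFiniteMeasureOnCompacts μ]
    [IsFiniteMeasureOnCompacts ν] [ν.OuterRegular] {B : Set F} (hB : IsOpen B)
    (h : ∀ f : F → ℝ, ContDiff ℝ 1 f → HasCompactSupport f → tsupport f ⊆ B → (∀ x, 0 ≤ f x) →
      ∫ x, f x ∂μ ≤ ∫ x, f x ∂ν) {K : Set F} (hK : IsCompact K) (hKB : K ⊆ B) : μ K ≤ ν K := by
  rw [K.measure_eq_iInf_isOpen ν]
  refine le_iInf₂ fun U hKU => le_iInf fun hU => ?_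
  obtain ⟨K', hK', hKK', hK'U⟩ := exists_compact_between hK (hU.inter hB)
    (subset_inter hKU hKB)
  obtain ⟨f, hf0, hf1, hf⟩ := exists_contMDiffMap_zero_one_of_isClosed 𝓘(ℝ, F) (n := 1)
    isOpen_interior.isClosed_compl hK.isClosed
    (disjoint_left.2 fun x hx hx' => hx (hKK' hx'))
  have hsupp : tsupport f ⊆ K' := by
    refine closure_minimal (fun x hx => ?_) hK'.isClosed
    by_contra hc
    exact hx (hf0 fun h => hc (interior_subset h))
  have hfc : HasCompactSupport f := HasCompactSupport.of_support_subset_isCompact hK'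
    ((subset_tsupport f).trans hsupp)
  have hfs : ContDiff ℝ 1 f := f.contMDiff.contDiff
  have hint := h f hfs hfc (hsupp.trans (hK'U.trans inter_subset_right)) fun x => (hf x).1
  have hi1 : Integrable f μ := hfs.continuous.integrable_of_hasCompactSupport hfc
  have hi2 : Integrable f ν := hfs.continuous.integrable_of_hasCompactSupport hfc
  calc μ K = ∫⁻ x, K.indicator 1 x ∂μ := (lintegral_indicator_one hK.measurableSet).symm
    _ ≤ ∫⁻ x, ENNReal.ofReal (f x) ∂μ := by
        refine lintegral_mono fun x => ?_
        by_cases hx : x ∈ K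
        · simp [hx, hf1 hx]
        · simp [hx]
    _ = ENNReal.ofReal (∫ x, f x ∂μ) :=
        (ofReal_integral_eq_lintegral_ofReal hi1 (Filter.Eventually.of_forall fun x => (hf x).1)).symm
    _ ≤ ENNReal.ofReal (∫ x, f x ∂ν) := ENNReal.ofReal_le_ofReal hint
    _ = ∫⁻ x, ENNReal.ofReal (f x) ∂ν :=
        ofReal_integral_eq_lintegral_ofReal hi2 (Filter.Eventually.of_forall fun x => (hf x).1)
    _ ≤ ∫⁻ x, U.indicator 1 x ∂ν := by
        refine lintegral_mono fun x => ?_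
        by_cases hx : x ∈ U
        · simpa [hx] using (hf x).2
        · have : f x = 0 := by
            by_contra hc
            exact hx (hK'U (hsupp (subset_tsupport f hc))).1
          simp [hx, this]
    _ = ν U := lintegral_indicator_one hU.measurableSet

/-- A measure on a convex open set whose distributional derivative vanishes is a multiple of
Lebesgue measure. -/
theorem exists_measure_eq_smul_of_integral_fderiv_eq_zero {μ lam : Measure F} [IsFiniteMeasure μ]
    [lam.IsAddHaarMeasure] {B : Set F} (hBo : IsOpen B) (hBc : Convex ℝ B)
    (hμ : ∀ f : F → ℝ, ContDiff ℝ 1 f → HasCompactSupport f → tsupport f ⊆ B → ∀ v,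
      ∫ x, fderiv ℝ f x v ∂μ = 0) :
    ∃ c : ℝ≥0, ∀ A ⊆ B, MeasurableSet A → μ A = c * lam A := by
  rcases B.eq_empty_or_nonempty with rfl | ⟨x₀, hx₀⟩
  · exact ⟨0, fun A hA _ => by simp [subset_empty_iff.1 hA]⟩
  obtain ⟨r, hr, hrB⟩ := Metric.isOpen_iff.1 hBo x₀ hx₀
  let ρ : ContDiffBump x₀ := ⟨r / 4, r / 2, by positivity, by linarith⟩
  have hρB : tsupport ρ ⊆ B := by
    rw [ρ.tsupport_eq]
    exact (Metric.closedBall_subset_ball (by change r / 2 < r; linarith)).trans hrB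
  have hρ := ρ.contDiff (n := 1)
  have hpos : 0 < ∫ x, ρ x ∂lam := ρ.integral_pos
  -- The constant is read off from one reference bump ρ; the symmetric identity
  -- `integral_mul_integral_eq` makes it valid for every test function.
  set c : ℝ≥0 := ⟨(∫ x, ρ x ∂μ) / ∫ x, ρ x ∂lam,
    div_nonneg (integral_nonneg fun x => ρ.nonneg) hpos.le⟩ with hc
  have heq : ∀ f : F → ℝ, ContDiff ℝ 1 f → HasCompactSupport f → tsupport f ⊆ B →
      ∫ x, f x ∂μ = ∫ x, f x ∂(c • lam) := by
    intro f hf hfc hfB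
    have h1 := integral_mul_integral_eq (lam := lam) hBc hμ hf hfc hfB hρ ρ.hasCompactSupport hρB
    rw [integral_smul_nnreal_measure]
    change _ = ((∫ x, ρ x ∂μ) / ∫ x, ρ x ∂lam) * _
    field_simp
    linarith
  refine ⟨c, fun A hA hAm => ?_⟩
  have hcomp : ∀ K ⊆ B, IsCompact K → μ K = (c • lam) K := fun K hKB hK =>
    le_antisymm
      (measure_le_of_integral_le hBo (fun f hf hfc hfB _ => (heq f hf hfc hfB).le) hK hKB)
      (measure_le_of_integral_le hBo (fun f hf hfc hfB _ => (heq f hf hfc hfB).ge) hK hKB)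
  have : (c : ℝ≥0∞) * lam A = (c • lam) A := rfl
  rw [this, hAm.measure_eq_iSup_isCompact, hAm.measure_eq_iSup_isCompact]
  exact iSup_congr fun K => iSup_congr fun hK => iSup_congr fun hKc => hcomp K (hK.trans hA) hKc

end Constancy

/-! ### From local comparison of measures to densities -/

section LocalMeasure

/-- By the Lindelöf property countably many of the neighbourhoods cover s; making them disjoint
allows the local inequalities to be summed. -/
theorem measure_le_of_locally_le {α : Type*} [TopologicalSpace α] [SecondCountableTopology α]
    [MeasurableSpace α] [OpensMeasurableSpace α] {μ ν : Measure α} {s : Set α}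
    (h : ∀ x ∈ s, ∃ U, IsOpen U ∧ x ∈ U ∧ ∀ A ⊆ U ∩ s, MeasurableSet A → μ A ≤ ν A)
    {A : Set α} (hA : A ⊆ s) (hAm : MeasurableSet A) : μ A ≤ ν A := by
  choose! U hUo hxU hU using h
  obtain ⟨t, hts, htc, ht⟩ := TopologicalSpace.countable_cover_nhdsWithin (f := U) (s := s)
    fun x hx => mem_nhdsWithin_of_mem_nhds ((hUo x hx).mem_nhds (hxU x hx))
  rcases t.eq_empty_or_nonempty with rfl | hne
  · have : A = ∅ := by simpa using hA.trans ht
    simp [this]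
  obtain ⟨f, hf⟩ := htc.exists_eq_range hne
  have hfs : ∀ i, f i ∈ s := fun i => hts (hf ▸ mem_range_self i)
  have hcov : A = ⋃ i, A ∩ disjointed (fun i => U (f i)) i := by
    rw [← inter_iUnion, iUnion_disjointed]
    refine (inter_eq_left.2 fun x hx => ?_).symm
    have := ht (hA hx)
    rw [hf] at this
    simpa using this
  have hm : ∀ i, MeasurableSet (A ∩ disjointed (fun i => U (f i)) i) := fun i =>
    hAm.inter (MeasurableSet.disjointed (fun i => (hUo _ (hfs i)).measurableSet) i)
  have hd : Pairwise (Function.onFun Disjoint fun i => A ∩ disjointed (fun i => U (f i)) i) :=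
    fun i j hij => (disjoint_disjointed _ hij).mono inter_subset_right inter_subset_right
  rw [hcov, measure_iUnion hd hm, measure_iUnion hd hm]
  exact ENNReal.tsum_le_tsum fun i => hU _ (hfs i) _
    (subset_inter (inter_subset_right.trans (disjointed_subset _ i)) (inter_subset_left.trans hA))
    (hm i)

/-- The square leaves room for two errors in the next lemma: comparison of the measures and
variation of the density. -/
theorem le_of_forall_one_add_sq_mul {a b : ℝ≥0∞}
    (h : ∀ ε : ℝ, 0 < ε → a ≤ ENNReal.ofReal ((1 + ε) ^ 2) * b) : a ≤ b := by
  have h1 : Filter.Tendsto (fun ε : ℝ => ENNReal.ofReal ((1 + ε) ^ 2) * b) (𝓝[>] 0) (𝓝 (1 * b)) := by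
    refine ENNReal.Tendsto.mul_const ?_ (Or.inl one_ne_zero)
    have h2 : Continuous fun ε : ℝ => ENNReal.ofReal ((1 + ε) ^ 2) :=
      ENNReal.continuous_ofReal.comp (by fun_prop)
    have h3 := (h2.tendsto 0).mono_left (nhdsWithin_le_nhds (s := Ioi (0 : ℝ)))
    simpa using h3
  rw [one_mul] at h1
  exact ge_of_tendsto h1 (by filter_upwards [self_mem_nhdsWithin] with ε hε using h ε hε)

/-- Near x both ν and the measure with density J are within a factor 1 + ε of the constant multiple
J(x) of `lam`. Globalising the inequalities and letting ε tend to 0 gives equality. This proves the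
area formula below. -/
theorem measure_eq_lintegral_of_locally {α : Type*} [TopologicalSpace α]
    [SecondCountableTopology α] [MeasurableSpace α] [BorelSpace α] {ν lam : Measure α}
    {s : Set α} {J : α → ℝ} (hs : IsOpen s) (hJ : ContinuousOn J s) (hJ0 : ∀ x ∈ s, 0 < J x)
    (h : ∀ x ∈ s, ∀ ε : ℝ, 0 < ε → ∃ U, IsOpen U ∧ x ∈ U ∧ ∀ A ⊆ U ∩ s, MeasurableSet A →
      ν A ≤ ENNReal.ofReal ((1 + ε) * J x) * lam A ∧
        ENNReal.ofReal (J x) * lam A ≤ ENNReal.ofReal (1 + ε) * ν A)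
    {A : Set α} (hA : A ⊆ s) (hAm : MeasurableSet A) :
    ν A = ∫⁻ y in A, ENNReal.ofReal (J y) ∂lam := by
  have hnear : ∀ x ∈ s, ∀ ε : ℝ, 0 < ε → ∃ U, IsOpen U ∧ x ∈ U ∧ ∀ y ∈ U ∩ s,
      J x ≤ (1 + ε) * J y ∧ J y ≤ (1 + ε) * J x := by
    intro x hx ε hε
    have hc := hJ.continuousAt (hs.mem_nhds hx)
    have h1 : ∀ᶠ y in 𝓝 x, J x < (1 + ε) * J y :=
      (continuousAt_const.mul hc).eventually_const_lt
        (show J x < (1 + ε) * J x by nlinarith [hJ0 x hx])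
    have h2 : ∀ᶠ y in 𝓝 x, J y < (1 + ε) * J x :=
      hc.eventually_lt_const (by nlinarith [hJ0 x hx])
    obtain ⟨U, hU, hUo, hxU⟩ := eventually_nhds_iff.1 (h1.and h2)
    exact ⟨U, hUo, hxU, fun y hy => ⟨(hU y hy.1).1.le, (hU y hy.1).2.le⟩⟩
  rw [← withDensity_apply _ hAm]
  refine le_antisymm (le_of_forall_one_add_sq_mul fun ε hε => ?_)
    (le_of_forall_one_add_sq_mul fun ε hε => ?_)
  · have hloc := measure_le_of_locally_le (μ := ν)
      (ν := ENNReal.ofReal ((1 + ε) ^ 2) • lam.withDensity fun y => ENNReal.ofReal (J y))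
      (s := s) (fun x hx => ?_) hA hAm
    · simpa using hloc
    · obtain ⟨U, hUo, hxU, hU⟩ := h x hx ε hε
      obtain ⟨U', hUo', hxU', hU'⟩ := hnear x hx ε hε
      refine ⟨U ∩ U', hUo.inter hUo', ⟨hxU, hxU'⟩, fun A hAU hAm => ?_⟩
      refine (hU A (fun y hy => ⟨(hAU hy).1.1, (hAU hy).2⟩) hAm).1.trans ?_
      rw [Measure.smul_apply, withDensity_apply _ hAm, smul_eq_mul, ← lintegral_const_mul' _ _
        ENNReal.ofReal_ne_top, ← setLIntegral_const]
      refine setLIntegral_mono' hAm fun y hy => ?_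
      rw [← ENNReal.ofReal_mul (by positivity)]
      refine ENNReal.ofReal_le_ofReal ?_
      have := (hU' y ⟨(hAU hy).1.2, (hAU hy).2⟩).1
      nlinarith
  · have hloc := measure_le_of_locally_le (ν := ENNReal.ofReal ((1 + ε) ^ 2) • ν)
      (μ := lam.withDensity fun y => ENNReal.ofReal (J y))
      (s := s) (fun x hx => ?_) hA hAm
    · simpa using hloc
    · obtain ⟨U, hUo, hxU, hU⟩ := h x hx ε hε
      obtain ⟨U', hUo', hxU', hU'⟩ := hnear x hx ε hε
      refine ⟨U ∩ U', hUo.inter hUo', ⟨hxU, hxU'⟩, fun A hAU hAm => ?_⟩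
      have h2 := (hU A (fun y hy => ⟨(hAU hy).1.1, (hAU hy).2⟩) hAm).2
      rw [Measure.smul_apply, withDensity_apply _ hAm, smul_eq_mul, pow_two,
        ENNReal.ofReal_mul (by positivity), mul_assoc]
      refine le_trans ?_ (mul_le_mul_right h2 _)
      rw [← mul_assoc, ← ENNReal.ofReal_mul (by positivity), ← setLIntegral_const]
      refine setLIntegral_mono' hAm fun y hy => ?_
      exact ENNReal.ofReal_le_ofReal (hU' y ⟨(hAU hy).1.2, (hAU hy).2⟩).2

/-- A map that distorts a linear Euclidean metric by a factor at most `C` distorts Hausdorff measure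
by a factor at most `C ^ m`. -/
theorem hausdorffMeasure_image_bounds {m : ℕ} {M : Type*} [MetricSpace M] [MeasurableSpace M]
    [BorelSpace M] {ψ : 𝔼[m] → M} (L : 𝔼[m] ≃ₗ[ℝ] 𝔼[m]) {C : ℝ} (hC : 0 ≤ C) {A : Set 𝔼[m]}
    (h1 : ∀ y ∈ A, ∀ z ∈ A, dist (ψ y) (ψ z) ≤ C * dist (L y) (L z))
    (h2 : ∀ y ∈ A, ∀ z ∈ A, dist (L y) (L z) ≤ C * dist (ψ y) (ψ z)) :
    μH[m] (ψ '' A) ≤ ENNReal.ofReal (C ^ m * |LinearMap.det (L : 𝔼[m] →ₗ[ℝ] 𝔼[m])|)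
        * (μH[m] : Measure 𝔼[m]) A ∧
      ENNReal.ofReal |LinearMap.det (L : 𝔼[m] →ₗ[ℝ] 𝔼[m])| * (μH[m] : Measure 𝔼[m]) A ≤
        ENNReal.ofReal (C ^ m) * μH[m] (ψ '' A) := by
  have hhaar : (μH[m] : Measure 𝔼[m]).IsAddHaarMeasure := by
    have := isAddHaarMeasure_hausdorffMeasure (E := 𝔼[m])
    simpa using this
  lift C to ℝ≥0 using hC
  have hdet : (μH[m] : Measure 𝔼[m]) (L '' A) =
      ENNReal.ofReal |LinearMap.det (L : 𝔼[m] →ₗ[ℝ] 𝔼[m])| * (μH[m] : Measure 𝔼[m]) A :=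
    Measure.addHaar_image_linearMap _ (L : 𝔼[m] →ₗ[ℝ] 𝔼[m]) A
  have hCm : ENNReal.ofReal ((C : ℝ) ^ m) = (C : ℝ≥0∞) ^ (m : ℝ) := by
    rw [ENNReal.ofReal_pow C.coe_nonneg, ENNReal.ofReal_coe_nnreal, ENNReal.rpow_natCast]
  -- Both ψ ∘ L⁻¹ on L(A) and L ∘ ψ⁻¹ on ψ(A) are C-Lipschitz, and L itself scales the Haar measure
  -- `μH[m]` by |det L|.
  have hL1 : LipschitzOnWith C (fun z => ψ (L.symm z)) (L '' A) := by
    refine LipschitzOnWith.of_dist_le_mul ?_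
    rintro _ ⟨y, hy, rfl⟩ _ ⟨z, hz, rfl⟩
    simpa using h1 y hy z hz
  have hL2 : LipschitzOnWith C (fun x => L (Function.invFunOn ψ A x)) (ψ '' A) := by
    refine LipschitzOnWith.of_dist_le_mul ?_
    rintro _ hx _ hx'
    have := h2 _ (Function.invFunOn_mem hx) _ (Function.invFunOn_mem hx')
    rwa [Function.invFunOn_eq hx, Function.invFunOn_eq hx'] at this
  have e1 : (fun z => ψ (L.symm z)) '' (L '' A) = ψ '' A := by
    rw [image_image]; simp
  have e2 : (fun x => L (Function.invFunOn ψ A x)) '' (ψ '' A) = L '' A := by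
    rw [image_image]
    refine image_congr fun y hy => ?_
    have hy' : ψ y ∈ ψ '' A := mem_image_of_mem _ hy
    have := h2 _ (Function.invFunOn_mem hy') y hy
    rw [Function.invFunOn_eq hy', dist_self, mul_zero] at this
    exact dist_le_zero.1 this
  have b1 := hL1.hausdorffMeasure_image_le (d := m) (Nat.cast_nonneg m)
  have b2 := hL2.hausdorffMeasure_image_le (d := m) (Nat.cast_nonneg m)
  rw [e1, hdet, ← hCm, ← mul_assoc, ← ENNReal.ofReal_mul (by positivity)] at b1
  rw [e2, hdet, ← hCm] at b2
  exact ⟨b1, b2⟩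

end LocalMeasure

/-! ### Gram determinants -/

section Gram

variable {k : ℕ} {H : Type*} [NormedAddCommGroup H] [InnerProductSpace ℝ H]

/-- Compose f with coordinates in an orthonormal basis of its range. The point is to trade f, whose
codomain is a different space, for an endomorphism, which has a determinant. -/
theorem exists_linearEquiv_inner_eq (f : 𝔼[k] →ₗ[ℝ] H) (hf : Function.Injective f) :
    ∃ L : 𝔼[k] ≃ₗ[ℝ] 𝔼[k], ∀ u v, inner ℝ (L u) (L v) = inner ℝ (f u) (f v) := by
  have hr : Module.finrank ℝ (LinearMap.range f) = k := by
    rw [LinearMap.finrank_range_of_inj hf, finrank_euclideanSpace_fin]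
  let b := (stdOrthonormalBasis ℝ (LinearMap.range f)).reindex (finCongr hr)
  refine ⟨(LinearEquiv.ofInjective f hf).trans b.repr.toLinearEquiv, fun u v => ?_⟩
  simp only [LinearEquiv.trans_apply, LinearIsometryEquiv.coe_toLinearEquiv,
    LinearIsometryEquiv.inner_map_map]
  rfl

/-- With A the matrix of L in the standard basis, the Gram matrix is AᵀA. -/
theorem det_sq_eq_det_gram (f : 𝔼[k] →ₗ[ℝ] H) (L : 𝔼[k] ≃ₗ[ℝ] 𝔼[k])
    (hL : ∀ u v, inner ℝ (L u) (L v) = inner ℝ (f u) (f v)) :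
    LinearMap.det (L : 𝔼[k] →ₗ[ℝ] 𝔼[k]) ^ 2 = (Matrix.of fun i j : Fin k =>
      inner ℝ (f (EuclideanSpace.single i 1)) (f (EuclideanSpace.single j 1))).det := by
  set b := (EuclideanSpace.basisFun (Fin k) ℝ).toBasis
  set A := LinearMap.toMatrix b b (L : 𝔼[k] →ₗ[ℝ] 𝔼[k]) with hA
  have hAe : ∀ i j, A i j = (L (EuclideanSpace.single j 1)) i := fun i j => by
    rw [hA, LinearMap.toMatrix_apply]
    simp [b]
  rw [← LinearMap.det_toMatrix b, ← hA, pow_two]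
  nth_rw 1 [← Matrix.det_transpose]
  rw [← Matrix.det_mul]
  congr 1
  ext i j
  rw [Matrix.mul_apply, Matrix.of_apply, ← hL, PiLp.inner_apply]
  refine Finset.sum_congr rfl fun l _ => ?_
  rw [Matrix.transpose_apply, hAe, hAe]
  simp [mul_comm]

end Gram

/-! ### Coordinate slices, their area density and the area formula -/

section Slice

variable {m n : ℕ}

/-- The inclusion of `ℝᵐ` in `ℝⁿ` as the first `m` coordinates. -/
def sliceIncl (m n : ℕ) : 𝔼[m] →L[ℝ] 𝔼[n] :=
  LinearMap.toContinuousLinearMap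
    { toFun := fun u => WithLp.toLp 2 fun i => if h : (i : ℕ) < m then u ⟨i, h⟩ else 0
      map_add' := fun u v => by
        ext i; by_cases h : (i : ℕ) < m <;> simp [h]
      map_smul' := fun c u => by
        ext i; by_cases h : (i : ℕ) < m <;> simp [h] }

/-- The projection of `ℝⁿ` to the first `m` coordinates. -/
def sliceProj (h : m ≤ n) : 𝔼[n] →L[ℝ] 𝔼[m] :=
  LinearMap.toContinuousLinearMap
    { toFun := fun u => WithLp.toLp 2 fun i => u (Fin.castLE h i)
      map_add' := fun u v => by ext i; simp
      map_smul' := fun c u => by ext i; simp }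

theorem sliceIncl_apply (u : 𝔼[m]) (i : Fin n) :
    sliceIncl m n u i = if h : (i : ℕ) < m then u ⟨i, h⟩ else 0 := rfl

theorem sliceProj_apply (h : m ≤ n) (y : 𝔼[n]) (i : Fin m) :
    sliceProj h y i = y (Fin.castLE h i) := rfl

theorem sliceProj_sliceIncl (h : m ≤ n) (u : 𝔼[m]) : sliceProj h (sliceIncl m n u) = u := by
  ext i
  simp [sliceProj_apply, sliceIncl_apply]

theorem sliceIncl_injective (h : m ≤ n) : Function.Injective (sliceIncl m n) :=
  Function.LeftInverse.injective (sliceProj_sliceIncl h)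

theorem sliceIncl_sliceProj (h : m ≤ n) {y : 𝔼[n]} (hy : ∀ i : Fin n, m ≤ (i : ℕ) → y i = 0) :
    sliceIncl m n (sliceProj h y) = y := by
  ext i
  rw [sliceIncl_apply]
  split_ifs with hi
  · rfl
  · exact (hy i (not_lt.1 hi)).symm

theorem sliceIncl_eq_zero (u : 𝔼[m]) {i : Fin n} (hi : m ≤ (i : ℕ)) : sliceIncl m n u i = 0 := by
  rw [sliceIncl_apply, dif_neg (not_lt.2 hi)]

variable {M : Type*} [TopologicalSpace M] [ChartedSpace 𝔼[n] M]

/-- The points of a chart domain whose last coordinates vanish. -/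
def slice (m : ℕ) (φ : OpenPartialHomeomorph M 𝔼[n]) : Set M :=
  {x ∈ φ.source | ∀ i : Fin n, m ≤ (i : ℕ) → φ x i = 0}

/-- The coordinates of the points of the slice. -/
def sliceDomain (m : ℕ) (φ : OpenPartialHomeomorph M 𝔼[n]) : Set 𝔼[m] :=
  sliceIncl m n ⁻¹' φ.target

/-- The parametrization of the slice. -/
def sliceParam (m : ℕ) (φ : OpenPartialHomeomorph M 𝔼[n]) (y : 𝔼[m]) : M :=
  φ.symm (sliceIncl m n y)

variable {φ : OpenPartialHomeomorph M 𝔼[n]}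

theorem isOpen_sliceDomain : IsOpen (sliceDomain m φ) :=
  φ.open_target.preimage (sliceIncl m n).continuous

theorem continuousOn_sliceParam : ContinuousOn (sliceParam m φ) (sliceDomain m φ) :=
  φ.continuousOn_symm.comp (sliceIncl m n).continuous.continuousOn fun _ hy => hy

theorem measurableSet_slice [MeasurableSpace M] [BorelSpace M] : MeasurableSet (slice m φ) := by
  have hc : IsClosed {y : 𝔼[n] | ∀ i : Fin n, m ≤ (i : ℕ) → y i = 0} := by
    simp only [ofPred_forall]
    exact isClosed_iInter fun i => isClosed_iInter fun _ =>
      isClosed_eq (EuclideanSpace.proj i : 𝔼[n] →L[ℝ] ℝ).continuous continuous_const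
  -- The slice is relatively closed in an open set.
  have : slice m φ = φ.source \
      (φ.source ∩ φ ⁻¹' {y : 𝔼[n] | ∀ i : Fin n, m ≤ (i : ℕ) → y i = 0}ᶜ) := by
    ext x
    simp only [slice, mem_ofPred_eq, mem_sdiff, mem_inter_iff, mem_preimage, mem_compl_iff]
    tauto
  rw [this]
  exact φ.open_source.measurableSet.diff (φ.isOpen_inter_preimage hc.isOpen_compl).measurableSet

theorem sliceParam_mem_slice {y : 𝔼[m]} (hy : y ∈ sliceDomain m φ) :
    sliceParam m φ y ∈ slice m φ := by
  refine ⟨φ.map_target hy, fun i hi => ?_⟩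
  rw [sliceParam, φ.right_inv hy, sliceIncl_eq_zero y hi]

theorem sliceProj_sliceParam (h : m ≤ n) {y : 𝔼[m]} (hy : y ∈ sliceDomain m φ) :
    sliceProj h (φ (sliceParam m φ y)) = y := by
  rw [sliceParam, φ.right_inv hy, sliceProj_sliceIncl]

theorem sliceProj_mem_sliceDomain (h : m ≤ n) {x : M} (hx : x ∈ slice m φ) :
    sliceProj h (φ x) ∈ sliceDomain m φ := by
  rw [sliceDomain, mem_preimage, sliceIncl_sliceProj h hx.2]
  exact φ.map_source hx.1

theorem sliceParam_sliceProj (h : m ≤ n) {x : M} (hx : x ∈ slice m φ) :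
    sliceParam m φ (sliceProj h (φ x)) = x := by
  rw [sliceParam, sliceIncl_sliceProj h hx.2, φ.left_inv hx.1]

/-- An image rewritten as a preimage, so that the pushforward defining `sliceMeasure` can be
evaluated on it. -/
theorem image_sliceParam (h : m ≤ n) {A : Set 𝔼[m]} (hA : A ⊆ sliceDomain m φ) :
    sliceParam m φ '' A = (fun x => sliceProj h (φ x)) ⁻¹' A ∩ slice m φ := by
  ext x
  constructor
  · rintro ⟨y, hy, rfl⟩
    refine ⟨?_, sliceParam_mem_slice (hA hy)⟩
    rw [mem_preimage, sliceProj_sliceParam h (hA hy)]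
    exact hy
  · rintro ⟨hxA, hx⟩
    exact ⟨_, hxA, sliceParam_sliceProj h hx⟩

variable [MeasurableSpace M] [BorelSpace M]

theorem aemeasurable_sliceProj (h : m ≤ n) (μ : Measure M) :
    AEMeasurable (fun x => sliceProj h (φ x)) (μ.restrict (slice m φ)) :=
  ContinuousOn.aemeasurable ((sliceProj h).continuous.comp_continuousOn
    (φ.continuousOn.mono fun _ hx => hx.1)) measurableSet_slice

/-- A measure on `M` restricted to the slice, in the coordinates of the slice. -/
def sliceMeasure (h : m ≤ n) (φ : OpenPartialHomeomorph M 𝔼[n]) (μ : Measure M) : Measure 𝔼[m] :=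
  (μ.restrict (slice m φ)).map fun x => sliceProj h (φ x)

theorem sliceMeasure_apply (h : m ≤ n) (μ : Measure M) {A : Set 𝔼[m]}
    (hA : A ⊆ sliceDomain m φ) (hAm : MeasurableSet A) :
    sliceMeasure h φ μ A = μ (sliceParam m φ '' A) := by
  rw [sliceMeasure, Measure.map_apply_of_aemeasurable (aemeasurable_sliceProj h μ) hAm,
    Measure.restrict_apply' measurableSet_slice, image_sliceParam h hA]

end Slice

section SliceArea

variable {m n : ℕ} {M : Type*} [TopologicalSpace M] [ChartedSpace 𝔼[n] M]
  [RiemannianBundle (fun x : M => TangentSpace (𝓡 n) x)] {φ : OpenPartialHomeomorph M 𝔼[n]}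

/-- The Gram matrix of the coordinate vector fields of a slice. -/
def sliceGram (m : ℕ) (φ : OpenPartialHomeomorph M 𝔼[n]) (y : 𝔼[m]) : Matrix (Fin m) (Fin m) ℝ :=
  Matrix.of fun i j => chartMetric φ (sliceIncl m n y)
    (sliceIncl m n (EuclideanSpace.single i 1)) (sliceIncl m n (EuclideanSpace.single j 1))

/-- The area density of a slice. -/
def sliceDensity (m : ℕ) (φ : OpenPartialHomeomorph M 𝔼[n]) (y : 𝔼[m]) : ℝ :=
  √(sliceGram m φ y).det

theorem exists_linearEquiv_slice (h : m ≤ n) (hφ : φ ∈ IsManifold.maximalAtlas (𝓡 n) 2 M)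
    {y : 𝔼[m]} (hy : y ∈ sliceDomain m φ) : ∃ L : 𝔼[m] ≃ₗ[ℝ] 𝔼[m],
      (∀ u, ‖L u‖ = ‖frame φ (sliceIncl m n y) (sliceIncl m n u)‖) ∧
      sliceDensity m φ y = |LinearMap.det (L : 𝔼[m] →ₗ[ℝ] 𝔼[m])| := by
  obtain ⟨L, hL⟩ := exists_linearEquiv_inner_eq
    ((frame φ (sliceIncl m n y)).toLinearMap ∘ₗ (sliceIncl m n).toLinearMap)
    ((frame_injective hφ hy).comp (sliceIncl_injective h))
  refine ⟨L, fun u => ?_, ?_⟩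
  · rw [norm_eq_sqrt_real_inner, hL, norm_eq_sqrt_real_inner]
    rfl
  · rw [sliceDensity, ← Real.sqrt_sq_eq_abs, det_sq_eq_det_gram _ L hL]
    rfl

theorem sliceDensity_pos (h : m ≤ n) (hφ : φ ∈ IsManifold.maximalAtlas (𝓡 n) 2 M)
    {y : 𝔼[m]} (hy : y ∈ sliceDomain m φ) : 0 < sliceDensity m φ y := by
  obtain ⟨L, -, hL⟩ := exists_linearEquiv_slice h hφ hy
  rw [hL, abs_pos]
  exact (LinearEquiv.isUnit_det' L).ne_zero

variable [IsManifold (𝓡 n) 2 M]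
  [IsContMDiffRiemannianBundle (𝓡 n) 1 𝔼[n] (fun x : M => TangentSpace (𝓡 n) x)]

theorem contDiffOn_sliceGram (hφ : φ ∈ IsManifold.maximalAtlas (𝓡 n) 2 M) (i j : Fin m) :
    ContDiffOn ℝ 1 (fun y => sliceGram m φ y i j) (sliceDomain m φ) :=
  (contDiffOn_chartMetric hφ _ _).comp (sliceIncl m n).contDiff.contDiffOn fun _ hy => hy

theorem contDiffOn_sliceDensity (h : m ≤ n) (hφ : φ ∈ IsManifold.maximalAtlas (𝓡 n) 2 M) :
    ContDiffOn ℝ 1 (sliceDensity m φ) (sliceDomain m φ) := by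
  refine ContDiffOn.sqrt ?_ fun y hy => (Real.sqrt_pos.1 (sliceDensity_pos h hφ hy)).ne'
  exact (contDiff_det.of_le (by simp)).comp_contDiffOn
    (contDiffOn_pi.2 fun i => contDiffOn_pi.2 fun j => contDiffOn_sliceGram hφ i j)

end SliceArea

section HausdorffSlice

variable {m n : ℕ} {M : Type*} [MetricSpace M] [ChartedSpace 𝔼[n] M] [IsManifold (𝓡 n) 2 M]
  [RiemannianBundle (fun x : M => TangentSpace (𝓡 n) x)]
  [IsContMDiffRiemannianBundle (𝓡 n) 1 𝔼[n] (fun x : M => TangentSpace (𝓡 n) x)]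
  [IsRiemannianManifold (𝓡 n) M] [MeasurableSpace M] [BorelSpace M]
  {φ : OpenPartialHomeomorph M 𝔼[n]}

/-- The area formula for a slice of a chart. -/
theorem hausdorffMeasure_image_sliceParam (h : m ≤ n)
    (hφ : φ ∈ IsManifold.maximalAtlas (𝓡 n) 2 M) {A : Set 𝔼[m]} (hA : A ⊆ sliceDomain m φ)
    (hAm : MeasurableSet A) : (μH[m] : Measure M) (sliceParam m φ '' A) =
      ∫⁻ y in A, ENNReal.ofReal (sliceDensity m φ y) ∂(μH[m] : Measure 𝔼[m]) := by
  rw [← sliceMeasure_apply h _ hA hAm]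
  refine measure_eq_lintegral_of_locally isOpen_sliceDomain
    (contDiffOn_sliceDensity h hφ).continuousOn (fun x hx => sliceDensity_pos h hφ hx)
    (fun y hy ε hε => ?_) hA hAm
  obtain ⟨L, hL, hLd⟩ := exists_linearEquiv_slice h hφ hy
  -- Two linear models of the frozen metric: L' on ℝⁿ enters the distance estimate, L on ℝᵐ has the
  -- area density as its determinant, and `hLL'` shows that they measure distances in the slice
  -- equally.
  obtain ⟨L', hL'⟩ := exists_linearEquiv_inner_eq (frame φ (sliceIncl m n y)).toLinearMap
    (frame_injective hφ hy)
  -- A distortion 1 + ε' of distances costs a factor (1 + ε')ᵐ in m-dimensional measure.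
  obtain ⟨ε', hε', hε'ε⟩ : ∃ ε' : ℝ, 0 < ε' ∧ (1 + ε') ^ m < 1 + ε := by
    have hc : Filter.Tendsto (fun t : ℝ => (1 + t) ^ m) (𝓝[>] 0) (𝓝 1) := by
      have h2 : Continuous fun t : ℝ => (1 + t) ^ m := by fun_prop
      simpa using (h2.tendsto 0).mono_left (nhdsWithin_le_nhds (s := Ioi (0 : ℝ)))
    have := (hc.eventually (gt_mem_nhds (show (1 : ℝ) < 1 + ε by linarith))).and
      self_mem_nhdsWithin
    obtain ⟨t, ht1, ht2⟩ := this.exists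
    exact ⟨t, ht2, ht1⟩
  obtain ⟨δ, hδ, hδd⟩ := exists_dist_symm_bounds hφ (y₀ := sliceIncl m n y) hy
    L'.toContinuousLinearEquiv.toContinuousLinearMap (fun u => by
      rw [norm_eq_sqrt_real_inner (frame φ _ u)]
      have := hL' u u
      rw [norm_eq_sqrt_real_inner]
      exact congrArg _ this) hε'
  have hLL' : ∀ u v : 𝔼[m], dist (L' (sliceIncl m n u)) (L' (sliceIncl m n v)) =
      dist (L u) (L v) := fun u v => by
    rw [dist_eq_norm, dist_eq_norm, ← map_sub, ← map_sub, ← map_sub, hL, norm_eq_sqrt_real_inner,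
      norm_eq_sqrt_real_inner, hL']
    rfl
  refine ⟨sliceIncl m n ⁻¹' Metric.ball (sliceIncl m n y) δ,
    Metric.isOpen_ball.preimage (sliceIncl m n).continuous, Metric.mem_ball_self hδ,
    fun A hAU hAm => ?_⟩
  have hAs : A ⊆ sliceDomain m φ := fun z hz => (hAU hz).2
  have hb := hausdorffMeasure_image_bounds (ψ := sliceParam m φ) L (C := 1 + ε') (by positivity)
    (A := A) (fun u hu v hv => by
      rw [← hLL']; exact (hδd _ (hAU hu).1 _ (hAU hv).1).1) (fun u hu v hv => by
      rw [← hLL']; exact (hδd _ (hAU hu).1 _ (hAU hv).1).2)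
  rw [← hLd] at hb
  rw [sliceMeasure_apply h _ hAs hAm]
  have hJ := (sliceDensity_pos h hφ hy).le
  refine ⟨hb.1.trans (mul_le_mul_left (ENNReal.ofReal_le_ofReal ?_) _),
    hb.2.trans (mul_le_mul_left (ENNReal.ofReal_le_ofReal hε'ε.le) _)⟩
  exact mul_le_mul_of_nonneg_right hε'ε.le hJ

end HausdorffSlice

/-! ### Topology of the Grassmannian and of its bundle -/

section Grassmannian

variable {m n : ℕ}

theorem isEmbedding_starProjection :
    IsEmbedding fun S : Gr m 𝔼[n] => S.1.starProjection :=
  ⟨⟨rfl⟩, fun S T h => Subtype.ext <| by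
    have h' := congrArg (fun L : 𝔼[n] →L[ℝ] 𝔼[n] => L.range) h
    simpa only [Submodule.range_starProjection] using h'⟩

/-- Expressing the rank of a projection as its trace turns the Grassmannian into a set cut out by
closed conditions; with the bound 1 on the norm this gives compactness. -/
theorem range_starProjection_gr :
    range (fun S : Gr m 𝔼[n] => S.1.starProjection) =
      {P : 𝔼[n] →L[ℝ] 𝔼[n] | IsStarProjection P ∧
        LinearMap.trace ℝ 𝔼[n] (P : 𝔼[n] →ₗ[ℝ] 𝔼[n]) = m} := by
  have htr : ∀ K : Submodule ℝ 𝔼[n], LinearMap.trace ℝ 𝔼[n]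
      (K.starProjection : 𝔼[n] →ₗ[ℝ] 𝔼[n]) = Module.finrank ℝ K := fun K =>
    LinearMap.IsProj.trace (p := K) ⟨fun x => K.starProjection_apply_mem x,
      fun x hx => Submodule.starProjection_eq_self_iff.2 hx⟩
  ext P
  constructor
  · rintro ⟨S, rfl⟩
    exact ⟨isStarProjection_starProjection, by rw [htr, S.2]⟩
  · rintro ⟨h1, h2⟩
    obtain ⟨K, _, rfl⟩ := isStarProjection_iff_eq_starProjection.1 h1
    rw [htr] at h2
    exact ⟨⟨K, by exact_mod_cast h2⟩, rfl⟩

instance instCompactSpaceGr : CompactSpace (Gr m 𝔼[n]) := by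
  rw [← isCompact_univ_iff, isEmbedding_starProjection.isCompact_iff, image_univ]
  refine Metric.isCompact_of_isClosed_isBounded ?_ ?_
  · rw [range_starProjection_gr]
    have htr : Continuous fun P : 𝔼[n] →L[ℝ] 𝔼[n] =>
        LinearMap.trace ℝ 𝔼[n] (P : 𝔼[n] →ₗ[ℝ] 𝔼[n]) :=
      LinearMap.continuous_of_finiteDimensional
        ((LinearMap.trace ℝ 𝔼[n]).comp (ContinuousLinearMap.coeLM ℝ))
    have hst : Continuous fun P : 𝔼[n] →L[ℝ] 𝔼[n] => P.adjoint :=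
      (ContinuousLinearMap.adjoint (𝕜 := ℝ) (E := 𝔼[n]) (F := 𝔼[n])).continuous
    have h : {P : 𝔼[n] →L[ℝ] 𝔼[n] | IsStarProjection P ∧
        LinearMap.trace ℝ 𝔼[n] (P : 𝔼[n] →ₗ[ℝ] 𝔼[n]) = m} =
        {P : 𝔼[n] →L[ℝ] 𝔼[n] | P * P = P} ∩ {P : 𝔼[n] →L[ℝ] 𝔼[n] | P.adjoint = P} ∩
          {P : 𝔼[n] →L[ℝ] 𝔼[n] | LinearMap.trace ℝ 𝔼[n] (P : 𝔼[n] →ₗ[ℝ] 𝔼[n]) = m} := by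
      ext P
      exact and_congr_left fun _ => ⟨fun h => ⟨h.1, h.2⟩, fun h => ⟨h.1, h.2⟩⟩
    rw [h]
    exact ((isClosed_eq (continuous_id.mul continuous_id) continuous_id).inter
      (isClosed_eq hst continuous_id)).inter (isClosed_eq htr continuous_const)
  · refine (Metric.isBounded_closedBall (x := (0 : 𝔼[n] →L[ℝ] 𝔼[n])) (r := 1)).subset ?_
    rintro _ ⟨S, rfl⟩
    simpa using Submodule.starProjection_norm_le S.1

theorem isInvertible_adjoint_comp_self {B : 𝔼[m] →L[ℝ] 𝔼[n]} (hB : Function.Injective B) :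
    (B.adjoint ∘L B).IsInvertible := by
  have hinj : Function.Injective ((B.adjoint ∘L B : 𝔼[m] →L[ℝ] 𝔼[m]) : 𝔼[m] →ₗ[ℝ] 𝔼[m]) := by
    refine (injective_iff_map_eq_zero _).2 fun u hu => ?_
    have h : inner ℝ (B u) (B u) = (0 : ℝ) := by
      rw [← ContinuousLinearMap.adjoint_inner_left]
      exact (congrArg (fun w => inner ℝ w u) hu).trans (inner_zero_left _)
    exact hB ((inner_self_eq_zero.1 h).trans (map_zero _).symm)
  exact ⟨(LinearEquiv.ofInjectiveEndo _ hinj).toContinuousLinearEquiv, by ext1; rfl⟩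

/-- The normal equations. The formula makes the projection visibly continuous in B wherever B is
injective. -/
theorem starProjection_range_eq {B : 𝔼[m] →L[ℝ] 𝔼[n]} (hB : Function.Injective B) :
    B.range.starProjection = B ∘L (B.adjoint ∘L B).inverse ∘L B.adjoint := by
  ext1 v
  refine Submodule.eq_starProjection_of_mem_of_inner_eq_zero
    (LinearMap.mem_range_self (B : 𝔼[m] →ₗ[ℝ] 𝔼[n]) _) ?_
  rintro _ ⟨u, rfl⟩
  have h := (isInvertible_adjoint_comp_self hB).self_apply_inverse (B.adjoint v)
  change B.adjoint (B _) = _ at h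
  change inner ℝ (v - B ((B.adjoint ∘L B).inverse (B.adjoint v))) (B u) = 0
  rw [inner_sub_left, ← ContinuousLinearMap.adjoint_inner_left,
    ← ContinuousLinearMap.adjoint_inner_left B u, h, sub_self]

/-- The orthogonal projection onto the range of an injective map depends continuously on it. -/
theorem continuousAt_starProjection_range {B : 𝔼[m] →L[ℝ] 𝔼[n]} (hB : Function.Injective B) :
    ContinuousAt (fun B : 𝔼[m] →L[ℝ] 𝔼[n] => B ∘L (B.adjoint ∘L B).inverse ∘L B.adjoint) B := by
  have h1 : Continuous fun B : 𝔼[m] →L[ℝ] 𝔼[n] => B.adjoint :=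
    (ContinuousLinearMap.adjoint (𝕜 := ℝ) (E := 𝔼[m]) (F := 𝔼[n])).continuous
  have h2 : ContinuousAt (fun B : 𝔼[m] →L[ℝ] 𝔼[n] => (B.adjoint ∘L B).inverse) B :=
    ContinuousAt.comp (f := fun B : 𝔼[m] →L[ℝ] 𝔼[n] => B.adjoint ∘L B)
      ((isInvertible_adjoint_comp_self hB).contDiffAt_map_inverse (n := 0)).continuousAt
      (h1.clm_comp continuous_id).continuousAt
  exact continuousAt_id.clm_comp (h2.clm_comp h1.continuousAt)

end Grassmannian

section GrassmannBundle

variable {m n : ℕ} {M : Type*} [TopologicalSpace M] [ChartedSpace 𝔼[n] M] [IsManifold (𝓡 n) 2 M]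

theorem continuous_ofChart (c : M) : Continuous (GrBundle.ofChart (n := n) (m := m) c) :=
  continuous_iff_coinduced_le.2 (le_iSup (fun c : M =>
    TopologicalSpace.coinduced (GrBundle.ofChart (n := n) (m := m) c) inferInstance) c)

theorem isOpen_grBundle_iff {s : Set (GrBundle n m M)} :
    IsOpen s ↔ ∀ c : M, IsOpen (GrBundle.ofChart (n := n) (m := m) c ⁻¹' s) := by
  rw [isOpen_iSup_iff]
  exact forall_congr' fun c => isOpen_coinduced

theorem continuousLinearEquivAt_eq_coframe {c x : M} (hx : x ∈ (chartAt 𝔼[n] c).source)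
    (v : TangentSpace (𝓡 n) x) :
    (trivializationAt 𝔼[n] (TangentSpace (𝓡 n)) c).continuousLinearEquivAt ℝ x hx v =
      coframe (chartAt 𝔼[n] c) x v := by
  have h := congrFun (Bundle.Trivialization.coe_continuousLinearEquivAt_eq (R := ℝ)
    (trivializationAt 𝔼[n] (TangentSpace (𝓡 n)) c) hx) v
  exact h.trans (continuousLinearMapAt_eq_coframe hx v)

theorem mem_ofChart_plane_iff (c : M) (q : (chartAt 𝔼[n] c).source × Gr m 𝔼[n])
    (v : TangentSpace (𝓡 n) q.1.1) :
    v ∈ (GrBundle.ofChart c q).2.1 ↔ coframe (chartAt 𝔼[n] c) q.1 v ∈ q.2.1 := by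
  rw [← continuousLinearEquivAt_eq_coframe q.1.2]
  exact Submodule.mem_map_equiv _ (e := ((trivializationAt 𝔼[n] (TangentSpace (𝓡 n))
    c).continuousLinearEquivAt ℝ q.1.1 q.1.2).symm.toLinearEquiv)

theorem ofChart_eq {c : M} {q : (chartAt 𝔼[n] c).source × Gr m 𝔼[n]} {S : Gr m (TangentSpace (𝓡 n) q.1.1)}
    (h : ∀ v, v ∈ S.1 ↔ coframe (chartAt 𝔼[n] c) q.1 v ∈ q.2.1) :
    GrBundle.ofChart c q = ⟨q.1, S⟩ :=
  Sigma.ext rfl (heq_of_eq (Subtype.ext (Submodule.ext fun v =>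
    (mem_ofChart_plane_iff c q v).trans (h v).symm)))

theorem exists_ofChart_eq {c : M} {p : GrBundle n m M} (hp : p.1 ∈ (chartAt 𝔼[n] c).source) :
    ∃ S : Gr m 𝔼[n], GrBundle.ofChart c (⟨p.1, hp⟩, S) = p := by
  set A := (trivializationAt 𝔼[n] (TangentSpace (𝓡 n)) c).continuousLinearEquivAt ℝ p.1 hp
  refine ⟨Gr.map A.toLinearEquiv p.2, ofChart_eq (S := p.2) fun v => ?_⟩
  rw [← continuousLinearEquivAt_eq_coframe hp]
  refine Iff.trans ?_ (Submodule.mem_map_equiv _ (e := A.toLinearEquiv)).symm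
  exact (congrArg (· ∈ p.2.1) (A.symm_apply_apply v)).symm.to_iff

theorem exists_tangentOfCoord_eq {c : M} {x : M} (hx : x ∈ (chartAt 𝔼[n] c).source) (u : 𝔼[n]) :
    ∃ v : TangentSpace (𝓡 n) x, coframe (chartAt 𝔼[n] c) x v = u ∧
      tangentOfCoord (chartAt 𝔼[n] c) (chartAt 𝔼[n] c x, u) = ⟨x, v⟩ := by
  obtain ⟨v, rfl⟩ : ∃ v : TangentSpace (𝓡 n) x, coframe (chartAt 𝔼[n] c) x v = u := by
    obtain ⟨y, hy, rfl⟩ : ∃ y ∈ (chartAt 𝔼[n] c).target, (chartAt 𝔼[n] c).symm y = x :=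
      ⟨_, (chartAt 𝔼[n] c).map_source hx, (chartAt 𝔼[n] c).left_inv hx⟩
    exact ⟨_, coframe_frame (chart_mem_maximalAtlas_two c) hy u⟩
  exact ⟨v, rfl, tangentOfCoord_coordOfTangent (chart_mem_maximalAtlas_two c) (p := ⟨x, v⟩) hx⟩

/-- The planes which contain a vector of a given open set form an open set. -/
theorem isOpen_exists_mem_plane {W : Set (TangentBundle (𝓡 n) M)} (hW : IsOpen W) :
    IsOpen {p : GrBundle n m M | ∃ v ∈ p.2.1, (⟨p.1, v⟩ : TangentBundle (𝓡 n) M) ∈ W} := by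
  refine isOpen_grBundle_iff.2 fun c => ?_
  -- The vectors of a plane S are the projections P_S u, so the set is a union over fixed u of
  -- conditions continuous in the plane.
  have h : GrBundle.ofChart c ⁻¹' {p : GrBundle n m M | ∃ v ∈ p.2.1,
      (⟨p.1, v⟩ : TangentBundle (𝓡 n) M) ∈ W} = ⋃ u : 𝔼[n],
        (fun q : (chartAt 𝔼[n] c).source × Gr m 𝔼[n] => tangentOfCoord (chartAt 𝔼[n] c)
          (chartAt 𝔼[n] c q.1, q.2.1.starProjection u)) ⁻¹' W := by
    ext q
    simp only [mem_preimage, mem_iUnion]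
    constructor
    · rintro ⟨v, hv, hvW⟩
      replace hv := (mem_ofChart_plane_iff c q v).1 hv
      refine ⟨coframe (chartAt 𝔼[n] c) q.1 v, ?_⟩
      rw [Submodule.starProjection_eq_self_iff.2 hv]
      exact (congrArg (· ∈ W) (tangentOfCoord_coordOfTangent (chart_mem_maximalAtlas_two c)
        (p := ⟨q.1, v⟩) q.1.2)).mpr hvW
    · rintro ⟨u, hu⟩
      obtain ⟨v, hv, h⟩ := exists_tangentOfCoord_eq q.1.2 (q.2.1.starProjection u)
      rw [h] at hu
      refine ⟨v, (mem_ofChart_plane_iff c q v).2 ?_, hu⟩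
      rw [hv]
      exact q.2.1.starProjection_apply_mem u
  rw [h]
  refine isOpen_iUnion fun u => hW.preimage ?_
  have h1 : Continuous fun q : (chartAt 𝔼[n] c).source × Gr m 𝔼[n] =>
      (chartAt 𝔼[n] c q.1, q.2.1.starProjection u) :=
    ((chartAt 𝔼[n] c).continuousOn.comp_continuous (continuous_subtype_val.comp continuous_fst)
      fun q => q.1.2).prodMk
        ((isEmbedding_starProjection.continuous.comp continuous_snd).clm_apply continuous_const)
  exact (contMDiffOn_tangentOfCoord (chart_mem_maximalAtlas_two c)).continuousOn.comp_continuous h1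
    fun q => ⟨(chartAt 𝔼[n] c).map_source q.1.2, trivial⟩

/-- In one bundle chart the preimage is the image of K × Gr(m, ℝⁿ), and the Grassmannian is compact.
Hence the weight of a Radon measure is locally finite. -/
theorem isCompact_preimage_proj {c : M} {K : Set M} (hK : IsCompact K)
    (hc : K ⊆ (chartAt 𝔼[n] c).source) :
    IsCompact (GrBundle.proj (m := m) (n := n) ⁻¹' K) := by
  have h : GrBundle.proj ⁻¹' K = GrBundle.ofChart (n := n) (m := m) c ''
      ((Subtype.val ⁻¹' K) ×ˢ univ) := by
    ext p
    constructor
    · intro hp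
      obtain ⟨S, hS⟩ := exists_ofChart_eq (p := p) (hc hp)
      exact ⟨(⟨p.1, hc hp⟩, S), ⟨hp, trivial⟩, hS⟩
    · rintro ⟨q, ⟨hq, -⟩, rfl⟩
      exact hq
  rw [h]
  refine IsCompact.image (IsCompact.prod ?_ isCompact_univ) (continuous_ofChart c)
  exact (Topology.IsInducing.subtypeVal.isCompact_preimage_iff (by simpa using hc)).2 hK

instance instIsLocallyFiniteMeasureWeight [MeasurableSpace M] [BorelSpace M]
    (V : Measure (GrBundle n m M)) [IsFiniteMeasureOnCompacts V] :
    IsLocallyFiniteMeasure (weight V) := by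
  have : LocallyCompactSpace M := ChartedSpace.locallyCompactSpace 𝔼[n] M
  refine ⟨fun x => ?_⟩
  obtain ⟨K, hK, hKs, hKc⟩ := local_compact_nhds
    ((chartAt 𝔼[n] x).open_source.mem_nhds (mem_chart_source 𝔼[n] x))
  refine ⟨interior K, interior_mem_nhds.2 hK, ?_⟩
  rw [weight, Measure.map_apply GrBundle.continuous_proj.measurable isOpen_interior.measurableSet]
  exact (measure_mono (preimage_mono interior_subset)).trans_lt
    (isCompact_preimage_proj hKc hKs).measure_lt_top

end GrassmannBundle

section RangeGr

variable {m n : ℕ}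

/-- The plane spanned by an injective map. -/
def Gr.range (B : 𝔼[m] →L[ℝ] 𝔼[n]) (hB : Function.Injective B) : Gr m 𝔼[n] :=
  ⟨B.range, (LinearMap.finrank_range_of_inj hB).trans finrank_euclideanSpace_fin⟩

theorem continuous_gr_range {X : Type*} [TopologicalSpace X] {D : X → 𝔼[m] →L[ℝ] 𝔼[n]}
    (hD : Continuous D) (hDi : ∀ x, Function.Injective (D x)) :
    Continuous fun x => Gr.range (D x) (hDi x) := by
  refine isEmbedding_starProjection.continuous_iff.2 ?_
  refine continuous_iff_continuousAt.2 fun y => ?_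
  refine (ContinuousAt.comp (f := D) (continuousAt_starProjection_range (hDi y))
    hD.continuousAt).congr (Filter.Eventually.of_forall fun z => ?_)
  exact (starProjection_range_eq (hDi z)).symm

end RangeGr

/-! ### Tangent planes of a submanifold -/

section TangentPlane

variable {m n : ℕ} {M : Type*} [TopologicalSpace M] [ChartedSpace 𝔼[n] M]
  {φ : OpenPartialHomeomorph M 𝔼[n]} {Γ : Set M}

theorem coframe_injective (hφ : φ ∈ IsManifold.maximalAtlas (𝓡 n) 2 M) {x : M}
    (hx : x ∈ φ.source) : Function.Injective (coframe φ x) := by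
  obtain ⟨y, hy, rfl⟩ : ∃ y ∈ φ.target, φ.symm y = x := ⟨φ x, φ.map_source hx, φ.left_inv hx⟩
  exact Function.LeftInverse.injective (frame_coframe hφ hy)

theorem coframe_surjective (hφ : φ ∈ IsManifold.maximalAtlas (𝓡 n) 2 M) {x : M}
    (hx : x ∈ φ.source) : Function.Surjective (coframe φ x) := by
  obtain ⟨y, hy, rfl⟩ : ∃ y ∈ φ.target, φ.symm y = x := ⟨φ x, φ.map_source hx, φ.left_inv hx⟩
  exact Function.RightInverse.surjective (coframe_frame hφ hy)

/-- The straight line through φ x with direction dφ(v) stays in the slice for small times, so its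
preimage is a curve in `Γ` with velocity v. -/
theorem mem_tangentPlane_of_coframe (hφ : φ ∈ IsManifold.maximalAtlas (𝓡 n) 2 M)
    (hΓ : ∀ y ∈ φ.source, (y ∈ Γ ↔ ∀ i : Fin n, m ≤ (i : ℕ) → φ y i = 0)) {x : M}
    (hx : x ∈ φ.source) (hxΓ : x ∈ Γ) {v : TangentSpace (𝓡 n) x}
    (hv : ∀ i : Fin n, m ≤ (i : ℕ) → coframe φ x v i = 0) : v ∈ tangentPlane Γ x := by
  set u := coframe φ x v with hu
  have hy := φ.map_source hx
  set l : ℝ → 𝔼[n] := fun t => φ x + t • u with hl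
  have hl0 : l 0 = φ x := by simp [hl]
  have hld : HasFDerivAt l (ContinuousLinearMap.toSpanSingleton ℝ u) 0 :=
    (ContinuousLinearMap.toSpanSingleton ℝ u).hasFDerivAt.const_add (φ x)
  have hlc : ContDiff ℝ 1 l := contDiff_const.add (contDiff_id.smul contDiff_const)
  have hs : MDifferentiableAt (𝓡 n) (𝓡 n) φ.symm (l 0) := by
    rw [hl0]; exact (mdifferentiable_of_mem_maximalAtlas_two hφ).mdifferentiableAt_symm hy
  refine Submodule.subset_span ⟨fun t => φ.symm (l t), ?_, ?_, ?_⟩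
  · have h1 : ∀ᶠ t in 𝓝 (0 : ℝ), l t ∈ φ.target :=
      hlc.continuous.continuousAt.preimage_mem_nhds (by
        rw [hl0]; exact φ.open_target.mem_nhds hy)
    filter_upwards [h1] with t ht
    refine (hΓ _ (φ.map_target ht)).2 fun i hi => ?_
    rw [φ.right_inv ht]
    simp [hl, (hΓ x hx).1 hxΓ i hi, hv i hi]
  · refine ContMDiffAt.comp (I' := 𝓡 n) (0 : ℝ) ?_ hlc.contMDiff.contMDiffAt
    rw [hl0]
    exact (contMDiffAt_symm_of_mem_maximalAtlas hφ hy).of_le (by norm_num)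
  · have h1 : mfderiv 𝓘(ℝ, ℝ) (𝓡 n) (fun t => φ.symm (l t)) 0 =
        (mfderiv (𝓡 n) (𝓡 n) φ.symm (l 0)).comp (mfderiv 𝓘(ℝ, ℝ) (𝓡 n) l 0) :=
      mfderiv_comp (I' := 𝓡 n) 0 hs hld.hasMFDerivAt.mdifferentiableAt
    have h2 : (⟨φ.symm (l 0), mfderiv 𝓘(ℝ, ℝ) (𝓡 n) (fun t => φ.symm (l t)) 0 (1 : ℝ)⟩ :
        TangentBundle (𝓡 n) M) = tangentOfCoord φ (l 0, u) := by
      rw [h1, hld.hasMFDerivAt.mfderiv]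
      have : ContinuousLinearMap.toSpanSingleton ℝ u (1 : ℝ) = u := by
        rw [ContinuousLinearMap.toSpanSingleton_apply, one_smul]
      conv_rhs => rw [← this]
      rfl
    rw [h2, hl0]
    exact tangentOfCoord_coordOfTangent hφ (p := ⟨x, v⟩) hx

/-- Along a curve in `Γ` the last coordinates vanish identically near time 0, hence so do their
derivatives; the kernel is a subspace and contains the span. -/
theorem coframe_eq_zero_of_mem_tangentPlane (hφ : φ ∈ IsManifold.maximalAtlas (𝓡 n) 2 M)
    (hΓ : ∀ y ∈ φ.source, (y ∈ Γ ↔ ∀ i : Fin n, m ≤ (i : ℕ) → φ y i = 0)) {x : M}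
    (hx : x ∈ φ.source) {v : TangentSpace (𝓡 n) x} (hv : v ∈ tangentPlane Γ x) (i : Fin n)
    (hi : m ≤ (i : ℕ)) : coframe φ x v i = 0 := by
  have hle : tangentPlane Γ x ≤ LinearMap.ker
      ((EuclideanSpace.proj i).comp (coframe φ x) : TangentSpace (𝓡 n) x →L[ℝ] ℝ).toLinearMap := by
    refine Submodule.span_le.2 ?_
    rintro w ⟨γ, hγ, hγd, hw⟩
    obtain rfl : γ 0 = x := congrArg TotalSpace.proj hw
    obtain rfl : mfderiv 𝓘(ℝ, ℝ) (𝓡 n) γ 0 (1 : ℝ) = w := by simpa using hw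
    have h1 := ((mdifferentiable_of_mem_maximalAtlas_two hφ).mdifferentiableAt hx).hasMFDerivAt
    have h2 := (hγd.mdifferentiableAt (by norm_num)).hasMFDerivAt
    have h3 : HasFDerivAt (fun t => φ (γ t)) ((mfderiv (𝓡 n) (𝓡 n) φ (γ 0)).comp
      (mfderiv 𝓘(ℝ, ℝ) (𝓡 n) γ 0) : ℝ →L[ℝ] 𝔼[n]) 0 := (h1.comp (0 : ℝ) h2).hasFDerivAt
    have h4 := (EuclideanSpace.proj (𝕜 := ℝ) i).hasFDerivAt.comp (0 : ℝ) h3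
    have h5 : (EuclideanSpace.proj (𝕜 := ℝ) i ∘ fun t => φ (γ t)) =ᶠ[𝓝 0] fun _ => (0 : ℝ) := by
      have hs : ∀ᶠ t in 𝓝 (0 : ℝ), γ t ∈ φ.source :=
        hγd.continuousAt.preimage_mem_nhds (φ.open_source.mem_nhds hx)
      filter_upwards [hγ, hs] with t ht hts
      exact (hΓ _ hts).1 ht i hi
    have h6 := h4.unique ((hasFDerivAt_const (0 : ℝ) (0 : ℝ)).congr_of_eventuallyEq h5)
    exact congrArg (fun L : ℝ →L[ℝ] ℝ => L 1) h6
  exact hle hv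

theorem mem_tangentPlane_iff (hφ : φ ∈ IsManifold.maximalAtlas (𝓡 n) 2 M)
    (hΓ : ∀ y ∈ φ.source, (y ∈ Γ ↔ ∀ i : Fin n, m ≤ (i : ℕ) → φ y i = 0)) {x : M}
    (hx : x ∈ φ.source) (hxΓ : x ∈ Γ) {v : TangentSpace (𝓡 n) x} :
    v ∈ tangentPlane Γ x ↔ ∀ i : Fin n, m ≤ (i : ℕ) → coframe φ x v i = 0 :=
  ⟨coframe_eq_zero_of_mem_tangentPlane hφ hΓ hx, mem_tangentPlane_of_coframe hφ hΓ hx hxΓ⟩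

theorem map_coframe_tangentPlane (hmn : m ≤ n) (hφ : φ ∈ IsManifold.maximalAtlas (𝓡 n) 2 M)
    (hΓ : ∀ y ∈ φ.source, (y ∈ Γ ↔ ∀ i : Fin n, m ≤ (i : ℕ) → φ y i = 0)) {x : M}
    (hx : x ∈ φ.source) (hxΓ : x ∈ Γ) :
    (tangentPlane Γ x).map (coframe φ x).toLinearMap = (sliceIncl m n).range := by
  ext u
  constructor
  · rintro ⟨v, hv, rfl⟩
    exact ⟨sliceProj hmn (coframe φ x v), sliceIncl_sliceProj hmn
      (coframe_eq_zero_of_mem_tangentPlane hφ hΓ hx hv)⟩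
  · rintro ⟨w, rfl⟩
    obtain ⟨v, hv⟩ := coframe_surjective hφ hx (sliceIncl m n w)
    refine ⟨v, mem_tangentPlane_of_coframe hφ hΓ hx hxΓ fun i hi => ?_, hv⟩
    rw [hv]
    exact sliceIncl_eq_zero w hi

theorem finrank_tangentPlane (hmn : m ≤ n) (hφ : φ ∈ IsManifold.maximalAtlas (𝓡 n) 2 M)
    (hΓ : ∀ y ∈ φ.source, (y ∈ Γ ↔ ∀ i : Fin n, m ≤ (i : ℕ) → φ y i = 0)) {x : M}
    (hx : x ∈ φ.source) (hxΓ : x ∈ Γ) : Module.finrank ℝ (tangentPlane (n := n) Γ x) = m := by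
  rw [(Submodule.equivMapOfInjective (coframe φ x).toLinearMap (coframe_injective hφ hx)
    (tangentPlane Γ x)).finrank_eq, map_coframe_tangentPlane hmn hφ hΓ hx hxΓ]
  exact (LinearMap.finrank_range_of_inj (sliceIncl_injective hmn)).trans (by simp)

theorem coframe_eq_fderiv_transition {ψ : OpenPartialHomeomorph M 𝔼[n]}
    (hφ : φ ∈ IsManifold.maximalAtlas (𝓡 n) 2 M) (hψ : ψ ∈ IsManifold.maximalAtlas (𝓡 n) 2 M)
    {x : M} (hx : x ∈ φ.source) (hx' : x ∈ ψ.source) (v : TangentSpace (𝓡 n) x) :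
    coframe ψ x v = fderiv ℝ (fun z => ψ (φ.symm z)) (φ x) (coframe φ x v) := by
  obtain ⟨y, hy, rfl⟩ : ∃ y ∈ φ.target, φ.symm y = x := ⟨φ x, φ.map_source hx, φ.left_inv hx⟩
  rw [φ.right_inv hy, (hasFDerivAt_transition hψ hφ hy hx').fderiv, ContinuousLinearMap.comp_apply,
    frame_coframe hφ hy]

theorem fderiv_transition_injective {ψ : OpenPartialHomeomorph M 𝔼[n]}
    (hφ : φ ∈ IsManifold.maximalAtlas (𝓡 n) 2 M) (hψ : ψ ∈ IsManifold.maximalAtlas (𝓡 n) 2 M)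
    {x : M} (hx : x ∈ φ.source) (hx' : x ∈ ψ.source) :
    Function.Injective (fderiv ℝ (fun z => ψ (φ.symm z)) (φ x)) := by
  intro u w h
  obtain ⟨u, rfl⟩ := coframe_surjective hφ hx u
  obtain ⟨w, rfl⟩ := coframe_surjective hφ hx w
  rw [← coframe_eq_fderiv_transition hφ hψ hx hx', ← coframe_eq_fderiv_transition hφ hψ hx hx'] at h
  rw [coframe_injective hψ hx' h]

theorem mem_tangentPlane_iff_mem_range {ψ : OpenPartialHomeomorph M 𝔼[n]} (hmn : m ≤ n)
    (hφ : φ ∈ IsManifold.maximalAtlas (𝓡 n) 2 M) (hψ : ψ ∈ IsManifold.maximalAtlas (𝓡 n) 2 M)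
    (hΓ : ∀ y ∈ φ.source, (y ∈ Γ ↔ ∀ i : Fin n, m ≤ (i : ℕ) → φ y i = 0)) {x : M}
    (hx : x ∈ φ.source) (hx' : x ∈ ψ.source) (hxΓ : x ∈ Γ) (v : TangentSpace (𝓡 n) x) :
    v ∈ tangentPlane Γ x ↔ coframe ψ x v ∈
      ((fderiv ℝ (fun z => ψ (φ.symm z)) (φ x)) ∘L sliceIncl m n).range := by
  rw [mem_tangentPlane_iff hφ hΓ hx hxΓ, coframe_eq_fderiv_transition hφ hψ hx hx']
  constructor
  · intro h
    exact ⟨sliceProj hmn (coframe φ x v), congrArg _ (sliceIncl_sliceProj hmn h)⟩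
  · rintro ⟨u, hu⟩ i hi
    rw [← fderiv_transition_injective hφ hψ hx hx' hu]
    exact sliceIncl_eq_zero u hi

theorem finrank_tangentPlane_of_mem (hmn : m ≤ n) (hΓ : IsEmbeddedC2Submanifold n m Γ) {x : M}
    (hx : x ∈ Γ) : Module.finrank ℝ (tangentPlane (n := n) Γ x) = m := by
  obtain ⟨φ, hφ, hxφ, h⟩ := hΓ x hx
  exact finrank_tangentPlane hmn hφ h hxφ hx

/-- The section of the Grassmannian bundle given by the tangent planes of a submanifold. -/
def tangentSection (hmn : m ≤ n) (hΓ : IsEmbeddedC2Submanifold n m Γ) (x : Γ) : GrBundle n m M :=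
  ⟨x, ⟨tangentPlane Γ x, finrank_tangentPlane_of_mem hmn hΓ x.2⟩⟩

theorem continuous_tangentSection [IsManifold (𝓡 n) 2 M] (hmn : m ≤ n)
    (hΓ : IsEmbeddedC2Submanifold n m Γ) : Continuous (tangentSection hmn hΓ) := by
  refine continuous_iff_continuousAt.2 fun x => ?_
  obtain ⟨φ, hφ, hxφ, h⟩ := hΓ x x.2
  set ψ := chartAt 𝔼[n] x.1 with hψ'
  have hψ : ψ ∈ IsManifold.maximalAtlas (𝓡 n) 2 M := chart_mem_maximalAtlas_two x.1
  have hU : IsOpen {y : Γ | y.1 ∈ φ.source ∧ y.1 ∈ ψ.source} :=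
    (φ.open_source.inter ψ.open_source).preimage continuous_subtype_val
  set U := {y : Γ | y.1 ∈ φ.source ∧ y.1 ∈ ψ.source} with hUdef
  -- The bundle topology knows only the charts `chartAt`, while flattening charts are arbitrary. In
  -- the bundle chart the tangent plane is the range of D(ψ ∘ φ⁻¹) restricted to ℝᵐ, continuous
  -- because the transition map is C².
  set D : U → 𝔼[m] →L[ℝ] 𝔼[n] := fun y =>
    (fderiv ℝ (fun z => ψ (φ.symm z)) (φ y.1.1)) ∘L sliceIncl m n with hD
  have hDc : Continuous D := by
    refine continuous_iff_continuousAt.2 fun y => ContinuousAt.clm_comp ?_ continuousAt_const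
    refine ContinuousAt.comp (f := fun y : U => φ y.1.1)
      (g := fderiv ℝ (fun z => ψ (φ.symm z))) ?_ ?_
    · refine ((contDiffAt_transition hψ hφ (φ.map_source y.2.1) ?_).fderiv_right
        (m := 1) (by norm_num)).continuousAt
      rw [φ.left_inv y.2.1]
      exact y.2.2
    · exact ContinuousAt.comp (f := fun y : U => y.1.1) (φ.continuousAt y.2.1)
        (continuous_subtype_val.comp continuous_subtype_val).continuousAt
  have hDi : ∀ y : U, Function.Injective (D y) := fun y =>
    (fderiv_transition_injective hφ hψ y.2.1 y.2.2).comp (sliceIncl_injective hmn)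
  refine (hU.isOpenEmbedding_subtypeVal.continuousAt_iff (x := ⟨x, hxφ, mem_chart_source _ _⟩)).1 ?_
  have hc' : Continuous fun y : U => GrBundle.ofChart (n := n) (m := m) x.1
      (⟨y.1.1, y.2.2⟩, Gr.range (D y) (hDi y)) :=
    (continuous_ofChart x.1).comp (((continuous_subtype_val.comp
      continuous_subtype_val).subtype_mk _).prodMk (continuous_gr_range hDc hDi))
  refine hc'.continuousAt.congr (Filter.Eventually.of_forall fun y => ?_)
  exact ofChart_eq (c := x.1) (q := (⟨y.1.1, y.2.2⟩, Gr.range (D y) (hDi y)))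
    (S := (tangentSection hmn hΓ y.1).2)
    (mem_tangentPlane_iff_mem_range hmn hφ hψ h y.2.1 y.2.2 y.1.2)

end TangentPlane

/-! ### Gradients of the coordinates -/

section MetricOperator

variable {n : ℕ} {M : Type*} [TopologicalSpace M] [ChartedSpace 𝔼[n] M]
  [RiemannianBundle (fun x : M => TangentSpace (𝓡 n) x)]
  {φ : OpenPartialHomeomorph M 𝔼[n]}

/-- The operator which represents the metric in a chart. -/
def metricOp (φ : OpenPartialHomeomorph M 𝔼[n]) (y : 𝔼[n]) : 𝔼[n] →L[ℝ] 𝔼[n] :=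
  ∑ a, ∑ b, chartMetric φ y (EuclideanSpace.single a 1) (EuclideanSpace.single b 1) •
    (EuclideanSpace.proj a : 𝔼[n] →L[ℝ] ℝ).smulRight (EuclideanSpace.single b (1 : ℝ))

theorem inner_metricOp (y u v : 𝔼[n]) : inner ℝ (metricOp φ y u) v = chartMetric φ y u v := by
  rw [chartMetric_eq_sum, metricOp]
  simp only [_root_.sum_apply, _root_.smul_apply, ContinuousLinearMap.smulRight_apply,
    sum_inner, inner_smul_left]
  refine Finset.sum_congr rfl fun a _ => Finset.sum_congr rfl fun b _ => ?_
  simp [EuclideanSpace.inner_single_left]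
  ring

theorem isInvertible_metricOp (hφ : φ ∈ IsManifold.maximalAtlas (𝓡 n) 2 M) {y : 𝔼[n]}
    (hy : y ∈ φ.target) : (metricOp φ y).IsInvertible := by
  have hinj : Function.Injective (metricOp φ y : 𝔼[n] →ₗ[ℝ] 𝔼[n]) := by
    refine (injective_iff_map_eq_zero _).2 fun u hu => ?_
    by_contra h
    have h1 := chartMetric_self_pos hφ hy h
    rw [← inner_metricOp, show metricOp φ y u = 0 from hu, inner_zero_left] at h1
    exact h1.false
  exact ⟨(LinearEquiv.ofInjectiveEndo _ hinj).toContinuousLinearEquiv, by ext1; rfl⟩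

/-- The gradient of the `i`-th coordinate, in the chart. -/
def coordGradient (φ : OpenPartialHomeomorph M 𝔼[n]) (i : Fin n) (y : 𝔼[n]) : 𝔼[n] :=
  (metricOp φ y).inverse (EuclideanSpace.single i 1)

theorem chartMetric_coordGradient (hφ : φ ∈ IsManifold.maximalAtlas (𝓡 n) 2 M) {y : 𝔼[n]}
    (hy : y ∈ φ.target) (i : Fin n) (u : 𝔼[n]) :
    chartMetric φ y (coordGradient φ i y) u = u i := by
  rw [← inner_metricOp, coordGradient, (isInvertible_metricOp hφ hy).self_apply_inverse]
  simp [EuclideanSpace.inner_single_left]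

variable [IsManifold (𝓡 n) 2 M]
  [IsContMDiffRiemannianBundle (𝓡 n) 1 𝔼[n] (fun x : M => TangentSpace (𝓡 n) x)]

/-- The gradient is the inverse of the C¹ metric operator applied to a fixed vector. Being C¹, it is
admissible in a test field. -/
theorem contDiffOn_coordGradient (hφ : φ ∈ IsManifold.maximalAtlas (𝓡 n) 2 M) (i : Fin n) :
    ContDiffOn ℝ 1 (coordGradient φ i) φ.target := by
  have h1 : ContDiffOn ℝ 1 (metricOp φ) φ.target := by
    have : metricOp φ = fun y => ∑ a, ∑ b,
        chartMetric φ y (EuclideanSpace.single a 1) (EuclideanSpace.single b 1) •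
        (EuclideanSpace.proj a : 𝔼[n] →L[ℝ] ℝ).smulRight (EuclideanSpace.single b (1 : ℝ)) := rfl
    rw [this]
    exact ContDiffOn.sum fun a _ => ContDiffOn.sum fun b _ =>
      (contDiffOn_chartMetric hφ _ _).smul contDiffOn_const
  intro y hy
  have h2 : ContDiffAt ℝ 1 (metricOp φ) y := h1.contDiffAt (φ.open_target.mem_nhds hy)
  have h3 : ContDiffAt ℝ 1 (fun z => (metricOp φ z).inverse) y :=
    ContDiffAt.comp (f := metricOp φ) y (isInvertible_metricOp hφ hy).contDiffAt_map_inverse h2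
  exact (h3.clm_apply contDiffAt_const).contDiffWithinAt

end MetricOperator

/-! ### Cutoffs of locally defined fields -/

section Cutoff

variable {E F : Type*} [NormedAddCommGroup E] [NormedSpace ℝ E] [HasContDiffBump E]
  [FiniteDimensional ℝ E] [NormedAddCommGroup F] [NormedSpace ℝ F] {c : E} {g : E → F} {O : Set E}

theorem tsupport_cutoff_subset (χ : ContDiffBump c) :
    tsupport (fun y => χ y • g y) ⊆ Metric.closedBall c χ.rOut :=
  (tsupport_smul_subset_left χ g).trans χ.tsupport_eq.subset

theorem contDiff_cutoff (hO : IsOpen O) (χ : ContDiffBump c) (h : Metric.closedBall c χ.rOut ⊆ O)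
    (hg : ContDiffOn ℝ 1 g O) : ContDiff ℝ 1 (fun y => χ y • g y) := by
  refine contDiff_iff_contDiffAt.2 fun y => ?_
  by_cases hy : y ∈ tsupport fun y => χ y • g y
  swap
  · exact contDiffAt_const.congr_of_eventuallyEq (notMem_tsupport_iff_eventuallyEq.1 hy)
  exact χ.contDiff.contDiffAt.smul
    (hg.contDiffAt (hO.mem_nhds (h (tsupport_cutoff_subset χ hy))))

theorem hasCompactSupport_cutoff (χ : ContDiffBump c) :
    HasCompactSupport (fun y => χ y • g y) :=
  χ.hasCompactSupport.smul_right

end Cutoff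

/-! ### How far a plane is from being tangent to a coordinate hypersurface -/

section PlaneHeight

/-- The sum is the squared norm of l, and l(v)² ≤ |l|²|v|² with equality at the Riesz representative
w. The right side mentions no basis, whereas the orthonormal bases of planes are chosen without any
continuity; this is what makes `planeHeight` measurable. -/
theorem exists_lt_sq_iff {H : Type*} [NormedAddCommGroup H] [InnerProductSpace ℝ H]
    [FiniteDimensional ℝ H] (l : H →ₗ[ℝ] ℝ) {ι : Type*} [Fintype ι] (b : OrthonormalBasis ι ℝ H)
    {a : ℝ} (ha : 0 ≤ a) : a < ∑ j, l (b j) ^ 2 ↔ ∃ v, a * inner ℝ v v < l v ^ 2 := by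
  set w : H := ∑ j, l (b j) • b j with hw
  have hl : ∀ v, l v = inner ℝ w v := fun v => by
    conv_lhs => rw [← b.sum_repr' v]
    rw [hw, map_sum, sum_inner]
    refine Finset.sum_congr rfl fun j _ => ?_
    rw [map_smul, inner_smul_left, smul_eq_mul, mul_comm]
    rfl
  have hs : ∑ j, l (b j) ^ 2 = inner ℝ w w := by
    rw [← hl w, hw, map_sum]
    exact Finset.sum_congr rfl fun j _ => by rw [map_smul, smul_eq_mul, sq]
  rw [hs]
  constructor
  · intro h
    refine ⟨w, ?_⟩
    rw [hl w, sq]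
    exact mul_lt_mul_of_pos_right h (ha.trans_lt h)
  · rintro ⟨v, hv⟩
    rw [hl v, sq] at hv
    have h1 := real_inner_mul_inner_self_le w v
    have h2 : a * inner ℝ v v < inner ℝ w w * inner ℝ v v := hv.trans_le h1
    exact lt_of_mul_lt_mul_right h2 real_inner_self_nonneg

variable {m n : ℕ} {M : Type*} [TopologicalSpace M] [ChartedSpace 𝔼[n] M]
  [RiemannianBundle (fun x : M => TangentSpace (𝓡 n) x)]
  {φ : OpenPartialHomeomorph M 𝔼[n]}

/-- The squared norm of the restriction of the differential of the `i`-th coordinate to a plane. -/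
def planeHeight (φ : OpenPartialHomeomorph M 𝔼[n]) (i : Fin n) (p : GrBundle n m M) : ℝ :=
  ∑ j, planeCoord φ p j i ^ 2

theorem planeHeight_nonneg (i : Fin n) (p : GrBundle n m M) : 0 ≤ planeHeight φ i p :=
  Finset.sum_nonneg fun _ _ => sq_nonneg _

theorem lt_planeHeight_iff (i : Fin n) (p : GrBundle n m M) {a : ℝ} (ha : 0 ≤ a) :
    a < planeHeight φ i p ↔ ∃ v ∈ p.2.1, a * inner ℝ v v < coframe φ p.1 v i ^ 2 := by
  set l : p.2.1 →ₗ[ℝ] ℝ := (((EuclideanSpace.proj i : 𝔼[n] →L[ℝ] ℝ).comp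
    (coframe φ p.1)).toLinearMap).comp p.2.1.subtype with hl
  have h := exists_lt_sq_iff l (stdOrthonormalBasis ℝ p.2.1) ha
  rw [planeHeight]
  refine h.trans ⟨?_, ?_⟩
  · rintro ⟨v, hv⟩
    exact ⟨v, v.2, hv⟩
  · rintro ⟨v, hv, h⟩
    exact ⟨⟨v, hv⟩, h⟩

theorem coframe_eq_zero_of_planeHeight {i : Fin n} {p : GrBundle n m M}
    (h : planeHeight φ i p = 0) {v : TangentSpace (𝓡 n) p.1} (hv : v ∈ p.2.1) :
    coframe φ p.1 v i = 0 := by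
  by_contra hne
  have := (lt_planeHeight_iff (φ := φ) i p le_rfl).2 ⟨v, hv, by
    rw [zero_mul]; positivity⟩
  exact this.ne' h

variable [IsManifold (𝓡 n) 2 M]
  [IsContMDiffRiemannianBundle (𝓡 n) 1 𝔼[n] (fun x : M => TangentSpace (𝓡 n) x)]

theorem measurable_indicator_planeHeight (hφ : φ ∈ IsManifold.maximalAtlas (𝓡 n) 2 M)
    (i : Fin n) : Measurable ((GrBundle.proj ⁻¹' φ.source).indicator
      (planeHeight (m := m) φ i)) := by
  refine measurable_of_Ioi fun a => ?_
  rcases lt_or_ge a 0 with ha | ha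
  · convert! MeasurableSet.univ
    refine eq_univ_of_forall fun p => ?_
    exact ha.trans_le (indicator_nonneg (fun p _ => planeHeight_nonneg i p) p)
  · have hopen : IsOpen (TotalSpace.proj ⁻¹' φ.source : Set (TangentBundle (𝓡 n) M)) :=
      φ.open_source.preimage (FiberBundle.continuous_proj 𝔼[n] (TangentSpace (𝓡 n) : M → Type))
    -- For a ≥ 0 the superlevel set consists of the planes containing a vector of this open set of
    -- tangent vectors, so it is open.
    have hW : IsOpen ((TotalSpace.proj ⁻¹' φ.source : Set (TangentBundle (𝓡 n) M)) ∩
        {q | a * normSq q < (coordOfTangent φ q).2 i ^ 2}) := by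
      have h1 : ContinuousOn (fun q : TangentBundle (𝓡 n) M =>
          (coordOfTangent φ q).2 i ^ 2 - a * normSq q) (TotalSpace.proj ⁻¹' φ.source) := by
        refine ContinuousOn.sub (ContinuousOn.pow ?_ 2)
          (continuous_const.mul contMDiff_normSq.continuous).continuousOn
        exact ((EuclideanSpace.proj i : 𝔼[n] →L[ℝ] ℝ).continuous.comp
          continuous_snd).comp_continuousOn (contMDiffOn_coordOfTangent hφ).continuousOn
      have h2 := h1.isOpen_inter_preimage hopen (isOpen_Ioi (a := (0 : ℝ)))
      convert! h2 using 2
      ext q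
      exact (sub_pos (a := (coordOfTangent φ q).2 i ^ 2) (b := a * normSq q)).symm
    convert! (isOpen_exists_mem_plane (m := m) hW).measurableSet using 1
    ext p
    simp only [mem_preimage, mem_Ioi]
    by_cases hp : p.1 ∈ φ.source
    · rw [indicator_of_mem (show p ∈ GrBundle.proj ⁻¹' φ.source from hp), lt_planeHeight_iff i p ha]
      exact exists_congr fun v => and_congr_right fun _ => ⟨fun h => ⟨hp, h⟩, fun h => h.2⟩
    · rw [indicator_of_notMem (show p ∉ GrBundle.proj ⁻¹' φ.source from hp)]
      exact ⟨fun h => absurd h (not_lt.2 ha), fun ⟨v, _, h, _⟩ => absurd h hp⟩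

end PlaneHeight

/-! ### Stationarity forces the planes to be tangent -/

section TangentAE

variable {m n : ℕ} {M : Type*} [TopologicalSpace M] [ChartedSpace 𝔼[n] M]
  [RiemannianBundle (fun x : M => TangentSpace (𝓡 n) x)]
  {φ : OpenPartialHomeomorph M 𝔼[n]}

theorem chartMetric_mul_self_le (y u v : 𝔼[n]) :
    chartMetric φ y u v ^ 2 ≤ chartMetric φ y u u * chartMetric φ y v v := by
  rw [sq]
  exact real_inner_mul_inner_self_le _ _

theorem chartMetric_planeCoord (hφ : φ ∈ IsManifold.maximalAtlas (𝓡 n) 2 M) {p : GrBundle n m M}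
    (hp : p.1 ∈ φ.source) (j k : Fin (Module.finrank ℝ p.2.1)) :
    chartMetric φ (φ p.1) (planeCoord φ p j) (planeCoord φ p k) = if j = k then 1 else 0 := by
  rw [planeCoord, planeCoord, ← inner_eq_chartMetric hφ hp]
  exact orthonormal_iff_ite.1 (stdOrthonormalBasis ℝ p.2.1).orthonormal j k

/-- Cauchy–Schwarz for the pairing of ∇y_i with each of the m unit vectors; the squared length of
∇y_i is its own i-th coordinate. -/
theorem planeHeight_le (hφ : φ ∈ IsManifold.maximalAtlas (𝓡 n) 2 M) (i : Fin n)
    {p : GrBundle n m M} (hp : p.1 ∈ φ.source) :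
    planeHeight φ i p ≤ m * coordGradient φ i (φ p.1) i := by
  have h : ∀ j, planeCoord φ p j i ^ 2 ≤ coordGradient φ i (φ p.1) i := fun j => by
    have h1 := chartMetric_mul_self_le (φ := φ) (φ p.1) (coordGradient φ i (φ p.1)) (planeCoord φ p j)
    rwa [chartMetric_coordGradient hφ (φ.map_source hp),
      chartMetric_coordGradient hφ (φ.map_source hp), chartMetric_planeCoord hφ hp, if_pos rfl,
      mul_one] at h1
  refine (Finset.sum_le_card_nsmul Finset.univ _ _ fun j _ => h j).trans ?_
  rw [Finset.card_univ, Fintype.card_fin, p.2.2, nsmul_eq_mul]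

variable [IsManifold (𝓡 n) 2 M]
  [IsContMDiffRiemannianBundle (𝓡 n) 1 𝔼[n] (fun x : M => TangentSpace (𝓡 n) x)]

/-- Where y_i = 0 the field vanishes, so the derivative of the metric drops out, and only dy_i(u) χ
∇y_i remains of the derivative of the field. Pairing with u gives χ dy_i(u)². -/
theorem partialDiv_coordGradient [T2Space M] (hφ : φ ∈ IsManifold.maximalAtlas (𝓡 n) 2 M)
    {c : 𝔼[n]} (χ : ContDiffBump c) (hχ : Metric.closedBall c χ.rOut ⊆ φ.target) {i : Fin n}
    {p : GrBundle n m M} (hp : p.1 ∈ φ.source) (hpi : φ p.1 i = 0) :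
    partialDiv (fieldOfCoord φ fun y => χ y • (y i • coordGradient φ i y)) p =
      χ (φ p.1) * planeHeight φ i p := by
  have hG := contDiffOn_coordGradient (φ := φ) hφ i
  have hi : ContDiff ℝ 1 fun y : 𝔼[n] => y i := (EuclideanSpace.proj i : 𝔼[n] →L[ℝ] ℝ).contDiff
  have hy := φ.map_source hp
  rw [partialDiv_fieldOfCoord hφ (F := fun y => χ y • (y i • coordGradient φ i y))
    (contDiff_cutoff φ.open_target χ hχ (hi.contDiffOn.smul hG)) (hasCompactSupport_cutoff χ) ((tsupport_cutoff_subset χ).trans hχ) p hp, planeHeight,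
    Finset.mul_sum]
  refine Finset.sum_congr rfl fun j _ => ?_
  set u := planeCoord φ p j
  have hd : fderiv ℝ (fun y => χ y • (y i • coordGradient φ i y)) (φ p.1) u =
      u i • (χ (φ p.1) • coordGradient φ i (φ p.1)) := by
    have h1 : HasFDerivAt (fun y : 𝔼[n] => y i) (EuclideanSpace.proj i : 𝔼[n] →L[ℝ] ℝ) (φ p.1) :=
      (EuclideanSpace.proj i : 𝔼[n] →L[ℝ] ℝ).hasFDerivAt
    have h2 := ((contDiff_cutoff φ.open_target χ hχ hG).differentiable one_ne_zero
      (φ p.1)).hasFDerivAt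
    have h3 := (h1.smul h2).congr_of_eventuallyEq (f₁ := fun y => χ y • (y i • coordGradient φ i y))
      (Filter.Eventually.of_forall fun y => smul_comm _ _ _)
    rw [h3.fderiv]
    simp [hpi]
  rw [fderiv_coordNormSq hφ hy, hd, hpi, zero_smul, smul_zero, map_zero, chartMetric_smul_left,
    chartMetric_smul_left, chartMetric_coordGradient hφ hy]
  ring

variable [MeasurableSpace M] [BorelSpace M]

theorem integrable_of_bounded_of_proj [T2Space M] {V : Measure (GrBundle n m M)}
    [IsFiniteMeasureOnCompacts V] {K : Set M} (hK : IsCompact K) {f : GrBundle n m M → ℝ} {C : ℝ}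
    (hf : AEStronglyMeasurable f V) (hC : ∀ p, |f p| ≤ C) (h0 : ∀ p, p.1 ∉ K → f p = 0) :
    Integrable f V := by
  have h1 : V (GrBundle.proj ⁻¹' K) < ⊤ := by
    have h2 : weight V K < ⊤ := hK.measure_lt_top
    rwa [weight, Measure.map_apply GrBundle.continuous_proj.measurable hK.measurableSet] at h2
  have h2 : Function.support f ⊆ GrBundle.proj ⁻¹' K := fun p hp => by
    by_contra h
    exact hp (h0 p h)
  exact (integrableOn_iff_integrable_of_support_subset h2).1
    (Measure.integrableOn_of_bounded h1.ne hf (Filter.Eventually.of_forall hC))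

theorem measurable_indicator_comp_chart {f : 𝔼[n] → ℝ} (hf : ContinuousOn f φ.target) :
    Measurable (φ.source.indicator fun x => f (φ x)) := by
  classical
  rw [← piecewise_eq_indicator]
  exact ContinuousOn.measurable_piecewise
    (hf.comp φ.continuousOn fun x hx => φ.map_source hx) continuousOn_const
    φ.open_source.measurableSet

/-- The planes of a stationary varifold supported in `{φ i = 0}` are almost everywhere tangent
to that hypersurface. -/
theorem exists_ae_planeHeight_eq_zero [T2Space M] (hφ : φ ∈ IsManifold.maximalAtlas (𝓡 n) 2 M)
    {V : Measure (GrBundle n m M)} [IsFiniteMeasureOnCompacts V] (hV : IsStationary V) {i : Fin n}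
    (hs : ∀ᵐ p ∂V, p.1 ∈ φ.source → φ p.1 i = 0) {x : M} (hx : x ∈ φ.source) :
    ∃ U ∈ 𝓝 x, ∀ᵐ p ∂V, p.1 ∈ U → planeHeight φ i p = 0 := by
  obtain ⟨r, hr, hrt⟩ := Metric.nhds_basis_closedBall.mem_iff.1
    (φ.open_target.mem_nhds (φ.map_source hx))
  let χ : ContDiffBump (φ x) := ⟨r / 2, r, by positivity, by linarith⟩
  have hχ : Metric.closedBall (φ x) χ.rOut ⊆ φ.target := hrt
  have hG := contDiffOn_coordGradient (φ := φ) hφ i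
  have hi : ContDiff ℝ 1 fun y : 𝔼[n] => y i := (EuclideanSpace.proj i : 𝔼[n] →L[ℝ] ℝ).contDiff
  set F : 𝔼[n] → 𝔼[n] := fun y => χ y • (y i • coordGradient φ i y) with hF
  have hF1 : ContDiff ℝ 1 F := contDiff_cutoff φ.open_target χ hχ (hi.contDiffOn.smul hG)
  have hF2 : HasCompactSupport F := hasCompactSupport_cutoff χ
  have hF3 : tsupport F ⊆ φ.target := (tsupport_cutoff_subset χ).trans hχ
  -- A globally measurable nonnegative representative, equal almost everywhere to the divergence of
  -- the test field.
  set h : GrBundle n m M → ℝ := fun p => φ.source.indicator (fun x => χ (φ x)) p.1 *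
    (GrBundle.proj ⁻¹' φ.source).indicator (planeHeight φ i) p with hh
  have hmem : ∀ {p : GrBundle n m M}, p.1 ∈ φ.source → h p = χ (φ p.1) * planeHeight φ i p :=
    fun {p} hp => by
      rw [hh]
      simp only
      rw [indicator_of_mem hp, indicator_of_mem (show p ∈ GrBundle.proj ⁻¹' φ.source from hp)]
  have hnot : ∀ {p : GrBundle n m M}, p.1 ∉ φ.source → h p = 0 := fun {p} hp => by
    rw [hh]
    simp only
    rw [indicator_of_notMem hp, zero_mul]
  have hdiv : (fun p => partialDiv (fieldOfCoord φ F) p) =ᵐ[V] h := by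
    filter_upwards [hs] with p hp
    by_cases hps : p.1 ∈ φ.source
    · rw [hmem hps, ← partialDiv_coordGradient hφ χ hχ hps (hp hps)]
    · rw [hnot hps]
      refine partialDiv_fieldOfCoord_eq_zero hφ hF1 hF2 hF3 p ?_
      rintro ⟨y, hy, h⟩
      exact hps (h ▸ φ.map_target (hF3 hy))
  have hh0 : ∀ p, 0 ≤ h p := fun p => by
    by_cases hps : p.1 ∈ φ.source
    · rw [hmem hps]
      exact mul_nonneg χ.nonneg (planeHeight_nonneg i p)
    · rw [hnot hps]
  have hcs : HasCompactSupport fun y => χ y • coordGradient φ i y := hasCompactSupport_cutoff χ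
  obtain ⟨C, hC⟩ := hcs.exists_bound_of_continuous
    (contDiff_cutoff φ.open_target χ hχ hG).continuous
  have hC0 : 0 ≤ C := (norm_nonneg _).trans (hC 0)
  have hbd : ∀ p, |h p| ≤ m * C := fun p => by
    rw [abs_of_nonneg (hh0 p)]
    by_cases hps : p.1 ∈ φ.source
    · rw [hmem hps]
      have h1 := mul_le_mul_of_nonneg_left (planeHeight_le hφ i hps) (χ.nonneg (x := φ p.1))
      have h2 : χ (φ p.1) * coordGradient φ i (φ p.1) i ≤ C :=
        (le_abs_self _).trans ((PiLp.norm_apply_le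
          (χ (φ p.1) • coordGradient φ i (φ p.1)) i).trans (hC (φ p.1)))
      calc χ (φ p.1) * planeHeight φ i p ≤ m * (χ (φ p.1) * coordGradient φ i (φ p.1) i) := by
            linarith
        _ ≤ m * C := mul_le_mul_of_nonneg_left h2 (Nat.cast_nonneg m)
    · rw [hnot hps]
      positivity
  have hK : IsCompact (φ.symm '' Metric.closedBall (φ x) r) :=
    (isCompact_closedBall _ _).image_of_continuousOn (φ.continuousOn_symm.mono hrt)
  have hmeas : Measurable h := ((measurable_indicator_comp_chart
    χ.continuous.continuousOn).comp GrBundle.continuous_proj.measurable).mul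
      (measurable_indicator_planeHeight hφ i)
  -- Essential: the Bochner integral of a non-integrable function is zero by convention, so a
  -- vanishing integral alone would prove nothing.
  have hint : Integrable h V := by
    refine integrable_of_bounded_of_proj hK hmeas.aestronglyMeasurable hbd fun p hp => ?_
    by_cases hps : p.1 ∈ φ.source
    · rw [hmem hps, χ.zero_of_le_dist, zero_mul]
      by_contra hlt
      exact hp ⟨φ p.1, Metric.mem_closedBall.2 (not_le.1 hlt).le, φ.left_inv hps⟩
    · exact hnot hps
  have hzero : ∫ p, h p ∂V = 0 := by
    rw [← integral_congr_ae hdiv]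
    exact hV _ (contMDiff_fieldOfCoord hφ hF1 hF2 hF3) (isCompact_closure_fieldOfCoord hF2 hF3)
  have hae := (integral_eq_zero_iff_of_nonneg hh0 hint).1 hzero
  refine ⟨φ.source ∩ φ ⁻¹' Metric.ball (φ x) (r / 2),
    Filter.inter_mem (φ.open_source.mem_nhds hx)
      ((φ.continuousAt hx).preimage_mem_nhds (Metric.ball_mem_nhds _ (by positivity))), ?_⟩
  filter_upwards [hae] with p hp hpU
  rw [hmem hpU.1, χ.one_of_mem_closedBall (Metric.ball_subset_closedBall hpU.2), one_mul] at hp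
  exact hp

theorem ae_of_locally_of_proj [SecondCountableTopology M] {V : Measure (GrBundle n m M)} {Γ : Set M}
    (hs : ∀ᵐ p ∂V, p.1 ∈ Γ) {P : GrBundle n m M → Prop}
    (h : ∀ x ∈ Γ, ∃ U ∈ 𝓝 x, ∀ᵐ p ∂V, p.1 ∈ U → P p) : ∀ᵐ p ∂V, P p := by
  choose! U hU hP using h
  obtain ⟨t, ht, htc, hc⟩ := TopologicalSpace.countable_cover_nhdsWithin (f := U) (s := Γ)
    fun x hx => mem_nhdsWithin_of_mem_nhds (hU x hx)
  have h1 : ∀ᵐ p ∂V, ∀ x ∈ t, p.1 ∈ U x → P p :=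
    (ae_ball_iff htc).2 fun x hx => hP x (ht hx)
  filter_upwards [h1, hs] with p hp hpΓ
  obtain ⟨x, hx, hxU⟩ := mem_iUnion₂.1 (hc hpΓ)
  exact hp x hx hxU

/-- The planes of a stationary varifold supported in a submanifold are almost everywhere
tangent to it. -/
theorem ae_eq_tangentPlane [T2Space M] [SecondCountableTopology M] (hmn : m ≤ n)
    {V : Measure (GrBundle n m M)} [IsFiniteMeasureOnCompacts V] (hV : IsStationary V) {Γ : Set M}
    (hΓ : IsEmbeddedC2Submanifold n m Γ) (hs : ∀ᵐ p ∂V, p.1 ∈ Γ) :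
    ∀ᵐ p ∂V, p.2.1 = tangentPlane Γ p.1 := by
  refine ae_of_locally_of_proj hs fun x hx => ?_
  obtain ⟨φ, hφ, hxφ, h⟩ := hΓ x hx
  have h1 : ∀ i : Fin n, ∃ U ∈ 𝓝 x, m ≤ (i : ℕ) → ∀ᵐ p ∂V, p.1 ∈ U → planeHeight φ i p = 0 := by
    intro i
    by_cases hi : m ≤ (i : ℕ)
    · obtain ⟨U, hU, h'⟩ := exists_ae_planeHeight_eq_zero hφ hV (i := i)
        (hs.mono fun p hp hps => (h p.1 hps).1 hp i hi) hxφ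
      exact ⟨U, hU, fun _ => h'⟩
    · exact ⟨univ, Filter.univ_mem, fun h => absurd h hi⟩
  choose U hU hP using h1
  refine ⟨φ.source ∩ ⋂ i, U i, Filter.inter_mem (φ.open_source.mem_nhds hxφ)
    (Filter.iInter_mem.2 hU), ?_⟩
  have h2 : ∀ᵐ p ∂V, ∀ i : Fin n, m ≤ (i : ℕ) → p.1 ∈ U i → planeHeight φ i p = 0 := by
    refine ae_all_iff.2 fun i => ?_
    by_cases hi : m ≤ (i : ℕ)
    · exact (hP i hi).mono fun p hp _ => hp
    · exact Filter.Eventually.of_forall fun p h => absurd h hi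
  filter_upwards [h2, hs] with p hp hpΓ hpU
  -- All dy_i with i ≥ m vanish on the plane, which gives inclusion; equal dimension gives equality.
  refine Submodule.eq_of_le_of_finrank_eq (fun v hv => ?_) ?_
  · exact mem_tangentPlane_of_coframe hφ h hpU.1 hpΓ fun i hi =>
      coframe_eq_zero_of_planeHeight (hp i hi (mem_iInter.1 hpU.2 i)) hv
  · rw [p.2.2, finrank_tangentPlane_of_mem hmn hΓ hpΓ]

end TangentAE

/-! ### Divergence along a slice -/

section SliceDivergence

theorem sum_inner_smul_map {H : Type*} [NormedAddCommGroup H] [InnerProductSpace ℝ H]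
    (S : Submodule ℝ H) {ι : Type*} [Fintype ι] (b : OrthonormalBasis ι ℝ S) {v : H} (hv : v ∈ S)
    {F : Type*} [AddCommGroup F] [Module ℝ F] (L : H →ₗ[ℝ] F) :
    ∑ j, (inner ℝ (b j : H) v : ℝ) • L (b j) = L v := by
  have h := congrArg (fun s : S => L s) (b.sum_repr' ⟨v, hv⟩)
  simpa [Submodule.coe_sum, Submodule.coe_smul] using h

variable {m n : ℕ} {M : Type*} [TopologicalSpace M] [ChartedSpace 𝔼[n] M] [IsManifold (𝓡 n) 2 M]
  [RiemannianBundle (fun x : M => TangentSpace (𝓡 n) x)]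
  [IsContMDiffRiemannianBundle (𝓡 n) 1 𝔼[n] (fun x : M => TangentSpace (𝓡 n) x)]
  {φ : OpenPartialHomeomorph M 𝔼[n]}

theorem chartMetric_sliceIncl_eq_sum (z u v : 𝔼[m]) :
    chartMetric φ (sliceIncl m n z) (sliceIncl m n u) (sliceIncl m n v) =
      ∑ i, ∑ j, u i * v j * sliceGram m φ z i j := by
  have h : ∀ w : 𝔼[m], w = ∑ i, w i • EuclideanSpace.single i (1 : ℝ) := fun w => by
    ext j; simp [Finset.sum_apply, Pi.single_apply]
  conv_lhs => rw [h u, h v]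
  simp only [chartMetric, map_sum, map_smul, sum_inner]
  refine Finset.sum_congr rfl fun i _ => ?_
  rw [inner_sum]
  refine Finset.sum_congr rfl fun j _ => ?_
  rw [inner_smul_left, inner_smul_right, sliceGram, Matrix.of_apply, chartMetric]
  simp
  ring

/-- The matrix with columns w_k normalises the Gram matrix at z, so `fderiv_sqrt_det` applies: the
logarithmic derivative of the area density is the trace of the derivative of the metric over an
orthonormal frame, halved. -/
theorem fderiv_sliceDensity (hφ : φ ∈ IsManifold.maximalAtlas (𝓡 n) 2 M) {z : 𝔼[m]}
    (hz : z ∈ sliceDomain m φ) (w : Fin m → 𝔼[m])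
    (hw : ∀ j k, chartMetric φ (sliceIncl m n z) (sliceIncl m n (w j)) (sliceIncl m n (w k)) =
      if j = k then 1 else 0) (e : 𝔼[m]) :
    fderiv ℝ (sliceDensity m φ) z e = sliceDensity m φ z * (1 / 2 * ∑ k,
      fderiv ℝ (fun y => chartMetric φ y (sliceIncl m n (w k)) (sliceIncl m n (w k)))
        (sliceIncl m n z) (sliceIncl m n e)) := by
  have hd : ∀ i j, DifferentiableAt ℝ (fun y => sliceGram m φ y i j) z := fun i j =>
    ((contDiffOn_sliceGram hφ i j).differentiableOn one_ne_zero).differentiableAt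
      (isOpen_sliceDomain.mem_nhds hz)
  have hU : (Matrix.of fun i k => w k i).transpose * sliceGram m φ z *
      (Matrix.of fun i k => w k i) = 1 := by
    ext j k
    rw [Matrix.one_apply, ← hw j k, chartMetric_sliceIncl_eq_sum, Matrix.mul_apply]
    simp only [Matrix.mul_apply, Matrix.transpose_apply, Matrix.of_apply, Finset.sum_mul]
    rw [Finset.sum_comm]
    exact Finset.sum_congr rfl fun _ _ => Finset.sum_congr rfl fun _ _ => by ring
  refine (fderiv_sqrt_det (sliceGram m φ) z e hd _ hU).trans ?_
  congr 2
  refine Finset.sum_congr rfl fun k _ => ?_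
  have h1 : HasFDerivAt (fun y => ∑ i, ∑ j, w k i * w k j * sliceGram m φ y i j)
      (∑ i, ∑ j, (w k i * w k j) • fderiv ℝ (fun y => sliceGram m φ y i j) z) z :=
    HasFDerivAt.fun_sum fun i _ => HasFDerivAt.fun_sum fun j _ =>
      (hd i j).hasFDerivAt.const_mul _
  have h2 : DifferentiableAt ℝ (fun y => chartMetric φ y (sliceIncl m n (w k))
      (sliceIncl m n (w k))) (sliceIncl m n z) :=
    ((contDiffOn_chartMetric hφ _ _).differentiableOn one_ne_zero).differentiableAt
      (φ.open_target.mem_nhds hz)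
  have h3 := HasFDerivAt.comp (f := fun y => sliceIncl m n y) z h2.hasFDerivAt
    (sliceIncl m n).hasFDerivAt
  have h4 := h1.unique (h3.congr_of_eventuallyEq (Filter.Eventually.of_forall fun y =>
    (chartMetric_sliceIncl_eq_sum y (w k) (w k)).symm))
  have h5 := congrArg (fun L : 𝔼[m] →L[ℝ] ℝ => L e) h4
  simpa [Matrix.of_apply, _root_.sum_apply] using h5

/-- An orthonormal basis of a tangent plane expands the vectors of the slice. -/
theorem sum_chartMetric_smul_planeCoord (hmn : m ≤ n)
    (hφ : φ ∈ IsManifold.maximalAtlas (𝓡 n) 2 M) {p : GrBundle n m M} (hp : p.1 ∈ φ.source)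
    (hT : p.2.1.map (coframe φ p.1).toLinearMap = (sliceIncl m n).range) (e : 𝔼[m]) :
    ∑ j, chartMetric φ (φ p.1) (sliceIncl m n e) (planeCoord φ p j) •
      sliceProj hmn (planeCoord φ p j) = e := by
  obtain ⟨v, hv, hve⟩ : sliceIncl m n e ∈ p.2.1.map (coframe φ p.1).toLinearMap :=
    hT ▸ ⟨e, rfl⟩
  replace hve : coframe φ p.1 v = sliceIncl m n e := hve
  have h1 : ∑ j, (inner ℝ (stdOrthonormalBasis ℝ p.2.1 j : TangentSpace (𝓡 n) p.1) v : ℝ) •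
      sliceProj hmn (planeCoord φ p j) = sliceProj hmn (coframe φ p.1 v) :=
    sum_inner_smul_map p.2.1 (stdOrthonormalBasis ℝ p.2.1) hv
      ((sliceProj hmn).comp (coframe φ p.1)).toLinearMap
  rw [hve, sliceProj_sliceIncl] at h1
  refine Eq.trans (Finset.sum_congr rfl fun j _ => ?_) h1
  rw [chartMetric_comm, ← hve, inner_eq_chartMetric hφ hp]
  rfl

/-- The divergence of a vector field along a slice, on the tangent planes of the slice. -/
theorem partialDiv_slice [T2Space M] (hmn : m ≤ n)
    (hφ : φ ∈ IsManifold.maximalAtlas (𝓡 n) 2 M) {F : 𝔼[n] → 𝔼[n]} (hF1 : ContDiff ℝ 1 F)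
    (hF2 : HasCompactSupport F) (hF3 : tsupport F ⊆ φ.target) {p : GrBundle n m M}
    (hp : p.1 ∈ slice m φ) {ζ : 𝔼[m] → ℝ} {e : 𝔼[m]}
    (hF : F =ᶠ[𝓝 (φ p.1)] fun y => ζ (sliceProj hmn y) • sliceIncl m n e)
    (hζ : DifferentiableAt ℝ ζ (sliceProj hmn (φ p.1)))
    (hT : p.2.1.map (coframe φ p.1).toLinearMap = (sliceIncl m n).range) :
    partialDiv (fieldOfCoord φ F) p = (sliceDensity m φ (sliceProj hmn (φ p.1)))⁻¹ *
      fderiv ℝ (fun z => sliceDensity m φ z * ζ z) (sliceProj hmn (φ p.1)) e := by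
  set z := sliceProj hmn (φ p.1) with hz
  have hιz : sliceIncl m n z = φ p.1 := sliceIncl_sliceProj hmn hp.2
  have hzD : z ∈ sliceDomain m φ := sliceProj_mem_sliceDomain hmn hp
  have hpos := sliceDensity_pos hmn hφ hzD
  have hy := φ.map_source hp.1
  set u := planeCoord φ p with hu
  have hιu : ∀ j, sliceIncl m n (sliceProj hmn (u j)) = u j := fun j => by
    obtain ⟨w, hw⟩ : u j ∈ (sliceIncl m n).range :=
      hT ▸ ⟨_, (stdOrthonormalBasis ℝ p.2.1 j).2, rfl⟩
    replace hw : sliceIncl m n w = u j := hw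
    rw [← hw, sliceProj_sliceIncl]
  have hFd : ∀ j, fderiv ℝ F (φ p.1) (u j) = fderiv ℝ ζ z (sliceProj hmn (u j)) • sliceIncl m n e := by
    intro j
    have h1 : HasFDerivAt (fun y => ζ (sliceProj hmn y)) ((fderiv ℝ ζ z).comp (sliceProj hmn))
        (φ p.1) :=
      HasFDerivAt.comp (g := ζ) (f := fun y => sliceProj hmn y) (φ p.1) hζ.hasFDerivAt
        (sliceProj hmn).hasFDerivAt
    rw [Filter.EventuallyEq.fderiv_eq hF, (h1.smul_const (sliceIncl m n e)).fderiv]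
    rfl
  have hJ : fderiv ℝ (sliceDensity m φ) z e = sliceDensity m φ z * (1 / 2 * ∑ j,
      fderiv ℝ (fun y => chartMetric φ y (u j) (u j)) (φ p.1) (sliceIncl m n e)) := by
    rw [fderiv_sliceDensity hφ hzD (fun k => sliceProj hmn (u (Fin.cast p.2.2.symm k))) ?_ e]
    · simp only [hιu, hιz]
      congr 2
      exact Equiv.sum_comp (finCongr p.2.2.symm) fun j =>
        fderiv ℝ (fun y => chartMetric φ y (u j) (u j)) (φ p.1) (sliceIncl m n e)
    · intro j k
      rw [hιu, hιu, hιz, chartMetric_planeCoord hφ hp.1]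
      simp [Fin.ext_iff]
  have hζe : ∑ j, chartMetric φ (φ p.1) (sliceIncl m n e) (u j) *
      fderiv ℝ ζ z (sliceProj hmn (u j)) = fderiv ℝ ζ z e := by
    have h1 := congrArg (fderiv ℝ ζ z) (sum_chartMetric_smul_planeCoord hmn hφ hp.1 hT e)
    rw [map_sum] at h1
    rw [← h1]
    exact Finset.sum_congr rfl fun j _ => by rw [map_smul, smul_eq_mul]
  have hJd : DifferentiableAt ℝ (sliceDensity m φ) z :=
    ((contDiffOn_sliceDensity hmn hφ).differentiableOn one_ne_zero).differentiableAt
      (isOpen_sliceDomain.mem_nhds hzD)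
  rw [partialDiv_fieldOfCoord hφ hF1 hF2 hF3 p hp.1, fderiv_fun_mul hJd hζ]
  -- Summed over j, the first part gives ζ ∂_e J / J by `hJ` and the second gives ∂_e ζ by `hζe`:
  -- the product rule for J⁻¹ ∂_e(Jζ).
  have hterm : ∀ j, 1 / 2 * fderiv ℝ (coordNormSq φ) (φ p.1, u j)
      (F (φ p.1), fderiv ℝ F (φ p.1) (u j)) =
      ζ z * (1 / 2 * fderiv ℝ (fun y => chartMetric φ y (u j) (u j)) (φ p.1) (sliceIncl m n e)) +
        chartMetric φ (φ p.1) (sliceIncl m n e) (u j) * fderiv ℝ ζ z (sliceProj hmn (u j)) := by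
    intro j
    rw [fderiv_coordNormSq hφ hy, hFd, hF.self_of_nhds, map_smul, chartMetric_smul_left, smul_eq_mul]
    ring
  rw [Finset.sum_congr rfl fun j _ => hterm j, Finset.sum_add_distrib, hζe, ← Finset.mul_sum,
    ← Finset.mul_sum]
  simp only [_root_.add_apply, _root_.smul_apply, smul_eq_mul, hJ]
  field_simp
  ring

end SliceDivergence

/-! ### Constancy with respect to a weight -/

section WeightedConstancy

variable {F : Type*} [NormedAddCommGroup F] [NormedSpace ℝ F] [MeasurableSpace F]
  [BorelSpace F] [FiniteDimensional ℝ F]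

/-- J is controlled only on D, but the derivative of f has its support inside D. -/
theorem continuous_inv_mul_fderiv {D : Set F} (hD : IsOpen D) {J : F → ℝ} (hJ : ContinuousOn J D)
    (hJ0 : ∀ z ∈ D, 0 < J z) {f : F → ℝ} (hf : ContDiff ℝ 1 f) (hfD : tsupport f ⊆ D) (v : F) :
    Continuous fun z => (J z)⁻¹ * fderiv ℝ f z v := by
  refine ContinuousOn.continuous_of_tsupport_subset (s := D) ?_ hD ?_
  · exact (hJ.inv₀ fun z hz => (hJ0 z hz).ne').mul
      ((hf.continuous_fderiv one_ne_zero).clm_apply continuous_const).continuousOn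
  · refine ((tsupport_mul_subset_right).trans ?_).trans hfD
    exact tsupport_fderiv_apply_subset ℝ v

/-- If the measure `J⁻¹ μ` has vanishing distributional derivative, then `μ` is a multiple of the
measure with density `J`. -/
theorem exists_measure_eq_mul_lintegral {μ lam : Measure F} [lam.IsAddHaarMeasure] {D : Set F}
    {J : F → ℝ} (hJ : ContinuousOn J D) (hJ0 : ∀ z ∈ D, 0 < J z) {c : F} {s : ℝ}
    (hs : Metric.closedBall c s ⊆ D) (hμ : μ (Metric.ball c s) < ⊤)
    (h : ∀ f : F → ℝ, ContDiff ℝ 1 f → HasCompactSupport f → tsupport f ⊆ Metric.ball c s → ∀ v,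
      ∫ z, (J z)⁻¹ * fderiv ℝ f z v ∂μ = 0) :
    ∃ k : ℝ≥0, ∀ A ⊆ Metric.ball c s, MeasurableSet A →
      μ A = k * ∫⁻ z in A, ENNReal.ofReal (J z) ∂lam := by
  classical
  have : ProperSpace F := FiniteDimensional.proper ℝ F
  set B := Metric.ball c s with hB
  have hBD : B ⊆ D := Metric.ball_subset_closedBall.trans hs
  have hBm : MeasurableSet B := Metric.isOpen_ball.measurableSet
  -- The value 1 outside the ball keeps the density measurable, nonzero and finite everywhere, so
  -- that dividing by it and multiplying back recovers the measure.
  set d : F → ℝ≥0∞ := B.piecewise (fun z => ENNReal.ofReal (J z)) fun _ => 1 with hd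
  have hdm : Measurable d := ContinuousOn.measurable_piecewise
    (ENNReal.continuous_ofReal.comp_continuousOn (hJ.mono hBD)) continuousOn_const hBm
  have hdB : ∀ z ∈ B, d z = ENNReal.ofReal (J z) := fun z hz => piecewise_eq_of_mem _ _ _ hz
  have hd0 : ∀ z, d z ≠ 0 := fun z => by
    by_cases hz : z ∈ B
    · rw [hdB z hz]; exact (ENNReal.ofReal_pos.2 (hJ0 z (hBD hz))).ne'
    · rw [hd, piecewise_eq_of_notMem _ _ _ hz]; exact one_ne_zero
  have hdt : ∀ z, d z ≠ ⊤ := fun z => by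
    by_cases hz : z ∈ B
    · rw [hdB z hz]; exact ENNReal.ofReal_ne_top
    · rw [hd, piecewise_eq_of_notMem _ _ _ hz]; exact ENNReal.one_ne_top
  have hdi : ∀ z ∈ B, (d z)⁻¹ = ENNReal.ofReal (J z)⁻¹ := fun z hz => by
    rw [hdB z hz, ENNReal.ofReal_inv_of_pos (hJ0 z (hBD hz))]
  set ν := (μ.restrict B).withDensity d⁻¹ with hν
  obtain ⟨C, hC⟩ := (isCompact_closedBall c s).exists_bound_of_continuousOn
    ((hJ.mono hs).inv₀ fun z hz => (hJ0 z (hs hz)).ne')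
  have hνfin : IsFiniteMeasure ν := by
    refine ⟨?_⟩
    rw [hν, withDensity_apply _ MeasurableSet.univ, Measure.restrict_univ]
    calc ∫⁻ z in B, d⁻¹ z ∂μ ≤ ∫⁻ _ in B, ENNReal.ofReal C ∂μ := by
          refine setLIntegral_mono measurable_const fun z hz => ?_
          rw [Pi.inv_apply, hdi z hz]
          exact ENNReal.ofReal_le_ofReal ((le_abs_self _).trans
            (hC z (Metric.ball_subset_closedBall hz)))
      _ = ENNReal.ofReal C * μ B := by rw [setLIntegral_const]
      _ < ⊤ := ENNReal.mul_lt_top ENNReal.ofReal_lt_top hμ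
  have hint : ∀ f : F → ℝ, ContDiff ℝ 1 f → HasCompactSupport f → tsupport f ⊆ B → ∀ v,
      ∫ z, fderiv ℝ f z v ∂ν = 0 := fun f hf hfc hfB v => by
      rw [hν, integral_withDensity_eq_integral_toReal_smul hdm.inv
        (Filter.Eventually.of_forall fun z => (ENNReal.inv_ne_top.2 (hd0 z)).lt_top)]
      refine Eq.trans ?_ (h f hf hfc hfB v)
      have h1 : ∫ z in B, (d⁻¹ z).toReal • fderiv ℝ f z v ∂μ =
          ∫ z in B, (J z)⁻¹ * fderiv ℝ f z v ∂μ :=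
        setIntegral_congr_fun hBm fun z hz => by
          simp only [Pi.inv_apply]
          rw [hdi z hz, ENNReal.toReal_ofReal (inv_nonneg.2 (hJ0 z (hBD hz)).le), smul_eq_mul]
      rw [h1]
      refine setIntegral_eq_integral_of_forall_compl_eq_zero fun z hz => ?_
      have h0 : fderiv ℝ f z v = 0 := image_eq_zero_of_notMem_tsupport
        (f := fun z => fderiv ℝ f z v) fun hz' => hz (hfB (tsupport_fderiv_apply_subset ℝ v hz'))
      rw [h0, mul_zero]
  obtain ⟨k, hk⟩ := exists_measure_eq_smul_of_integral_fderiv_eq_zero (μ := ν) (lam := lam)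
    (B := B) Metric.isOpen_ball (convex_ball c s) hint
  refine ⟨k, fun A hA hAm => ?_⟩
  have h2 : ν.withDensity d = μ.restrict B := by
    have := withDensity_inv_same₀ (μ := μ.restrict B) (f := d⁻¹) hdm.inv.aemeasurable
      (ae_of_all _ fun z => ENNReal.inv_ne_zero.2 (hdt z))
      (ae_of_all _ fun z => ENNReal.inv_ne_top.2 (hd0 z))
    simpa only [Pi.inv_apply, inv_inv] using this
  have h3 : ν.restrict A = (k : ℝ≥0∞) • lam.restrict A := by
    ext T hT
    rw [Measure.restrict_apply hT, Measure.smul_apply, Measure.restrict_apply hT, smul_eq_mul]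
    exact hk _ (inter_subset_right.trans hA) (hT.inter hAm)
  calc μ A = ν.withDensity d A := by rw [h2, Measure.restrict_apply hAm, inter_eq_left.2 hA]
    _ = k * ∫⁻ z in A, d z ∂lam := by
      rw [withDensity_apply _ hAm, h3, lintegral_smul_measure, smul_eq_mul]
    _ = k * ∫⁻ z in A, ENNReal.ofReal (J z) ∂lam := by
      rw [setLIntegral_congr_fun hAm fun z hz => hdB z (hA hz)]

end WeightedConstancy

/-! ### The weight is locally a multiple of Hausdorff measure -/

section SliceWeight

variable {m n : ℕ} {M : Type*} [TopologicalSpace M] [ChartedSpace 𝔼[n] M] [IsManifold (𝓡 n) 2 M]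
  [RiemannianBundle (fun x : M => TangentSpace (𝓡 n) x)]
  [IsContMDiffRiemannianBundle (𝓡 n) 1 𝔼[n] (fun x : M => TangentSpace (𝓡 n) x)]
  [MeasurableSpace M] [BorelSpace M]
  {φ : OpenPartialHomeomorph M 𝔼[n]}

theorem integral_sliceMeasure_weight (hmn : m ≤ n) (V : Measure (GrBundle n m M)) {k : 𝔼[m] → ℝ}
    (hk : Continuous k) : ∫ z, k z ∂(sliceMeasure hmn φ (weight V)) =
      ∫ p, (slice m φ).indicator (fun x => k (sliceProj hmn (φ x))) p.1 ∂V := by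
  have hm := aemeasurable_sliceProj (φ := φ) hmn (weight V)
  rw [sliceMeasure, integral_map hm hk.aestronglyMeasurable, ← integral_indicator measurableSet_slice]
  rw [weight, integral_map GrBundle.continuous_proj.measurable.aemeasurable]
  · rfl
  · rw [aestronglyMeasurable_indicator_iff measurableSet_slice]
    exact (hk.measurable.comp_aemeasurable hm).aestronglyMeasurable

/-- Stationarity is tested on χ ζ v with ζ = J⁻¹f extended constantly in the normal coordinates.
Along the slice its divergence is J⁻¹ ∂_v(Jζ) = J⁻¹ ∂_v f. -/
theorem integral_sliceMeasure_eq_zero [T2Space M] (hmn : m ≤ n)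
    (hφ : φ ∈ IsManifold.maximalAtlas (𝓡 n) 2 M)
    {V : Measure (GrBundle n m M)} (hV : IsStationary V)
    (hT : ∀ᵐ p ∂V, p.1 ∈ φ.source → p.1 ∈ slice m φ ∧
      p.2.1.map (coframe φ p.1).toLinearMap = (sliceIncl m n).range)
    {x : M} {r : ℝ} (hr : 0 < r)
    (hrO : Metric.closedBall (φ x) (2 * r) ⊆ φ.target ∩ sliceProj hmn ⁻¹' sliceDomain m φ)
    {f : 𝔼[m] → ℝ} (hf : ContDiff ℝ 1 f) (hfD : tsupport f ⊆ sliceDomain m φ)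
    (hfr : tsupport f ⊆ sliceIncl m n ⁻¹' Metric.ball (φ x) r) (v : 𝔼[m]) :
    ∫ z, (sliceDensity m φ z)⁻¹ * fderiv ℝ f z v ∂(sliceMeasure hmn φ (weight V)) = 0 := by
  have hJ := contDiffOn_sliceDensity (φ := φ) hmn hφ
  have hJ0 : ∀ z ∈ sliceDomain m φ, 0 < sliceDensity m φ z := fun z hz => sliceDensity_pos hmn hφ hz
  rw [integral_sliceMeasure_weight hmn V
    (continuous_inv_mul_fderiv isOpen_sliceDomain hJ.continuousOn hJ0 hf hfD v)]
  set ζ : 𝔼[m] → ℝ := fun z => (sliceDensity m φ z)⁻¹ * f z with hζ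
  have hζd : ContDiffOn ℝ 1 ζ (sliceDomain m φ) :=
    (hJ.inv fun z hz => (hJ0 z hz).ne').mul hf.contDiffOn
  let χ : ContDiffBump (φ x) := ⟨r, 2 * r, hr, by linarith⟩
  set O := φ.target ∩ sliceProj hmn ⁻¹' sliceDomain m φ with hO
  have hOo : IsOpen O := φ.open_target.inter (isOpen_sliceDomain.preimage (sliceProj hmn).continuous)
  have hχ : Metric.closedBall (φ x) χ.rOut ⊆ O := hrO
  set g : 𝔼[n] → 𝔼[n] := fun y => ζ (sliceProj hmn y) • sliceIncl m n v with hg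
  have hgd : ContDiffOn ℝ 1 g O :=
    (hζd.comp (sliceProj hmn).contDiff.contDiffOn fun y hy => hy.2).smul contDiffOn_const
  set F : 𝔼[n] → 𝔼[n] := fun y => χ y • g y with hF
  have hF1 : ContDiff ℝ 1 F := contDiff_cutoff hOo χ hχ hgd
  have hF2 : HasCompactSupport F := hasCompactSupport_cutoff χ
  have hF3 : tsupport F ⊆ φ.target :=
    ((tsupport_cutoff_subset χ).trans hχ).trans inter_subset_left
  rw [← hV _ (contMDiff_fieldOfCoord hφ hF1 hF2 hF3) (isCompact_closure_fieldOfCoord hF2 hF3)]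
  refine integral_congr_ae ?_
  filter_upwards [hT] with p hp
  by_cases hps : p.1 ∈ φ.source
  swap
  · rw [indicator_of_notMem fun h => hps h.1]
    refine (partialDiv_fieldOfCoord_eq_zero hφ hF1 hF2 hF3 p ?_).symm
    rintro ⟨y, hy, h⟩
    exact hps (h ▸ φ.map_target (hF3 hy))
  obtain ⟨hsl, hTp⟩ := hp hps
  rw [indicator_of_mem hsl]
  set z := sliceProj hmn (φ p.1) with hz
  have hzD : z ∈ sliceDomain m φ := sliceProj_mem_sliceDomain hmn hsl
  -- Over the support of f the cutoff is 1 nearby; elsewhere f, and with it both fields, vanishes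
  -- nearby. The cutoff thus leaves no trace in the divergence.
  have hFg : F =ᶠ[𝓝 (φ p.1)] g := by
    by_cases hzf : z ∈ tsupport f
    · have h1 : φ p.1 ∈ Metric.ball (φ x) χ.rIn := by
        have := hfr hzf
        rwa [mem_preimage, hz, sliceIncl_sliceProj hmn hsl.2] at this
      filter_upwards [χ.eventuallyEq_one_of_mem_ball h1] with y hy
      rw [hF]
      simp only
      rw [hy, Pi.one_apply, one_smul]
    · have h1 : ∀ᶠ y in 𝓝 (φ p.1), f (sliceProj hmn y) = 0 :=
        (sliceProj hmn).continuous.continuousAt.eventually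
          (notMem_tsupport_iff_eventuallyEq.1 hzf)
      filter_upwards [h1] with y hy
      simp [hF, hg, hζ, hy]
  rw [partialDiv_slice hmn hφ hF1 hF2 hF3 hsl hFg
    ((hζd.differentiableOn one_ne_zero).differentiableAt (isOpen_sliceDomain.mem_nhds hzD)) hTp]
  have h2 : (fun w => sliceDensity m φ w * ζ w) =ᶠ[𝓝 z] f := by
    filter_upwards [isOpen_sliceDomain.mem_nhds hzD] with w hw
    rw [hζ]
    exact mul_inv_cancel_left₀ (hJ0 w hw).ne' _
  rw [Filter.EventuallyEq.fderiv_eq h2]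

end SliceWeight

section LocalConstancy

variable {m n : ℕ} {M : Type*} [MetricSpace M] [ChartedSpace 𝔼[n] M] [IsManifold (𝓡 n) 2 M]
  [RiemannianBundle (fun x : M => TangentSpace (𝓡 n) x)]
  [IsContMDiffRiemannianBundle (𝓡 n) 1 𝔼[n] (fun x : M => TangentSpace (𝓡 n) x)]
  [IsRiemannianManifold (𝓡 n) M] [MeasurableSpace M] [BorelSpace M]
  {φ : OpenPartialHomeomorph M 𝔼[n]} {Γ : Set M}

theorem isAddHaarMeasure_hausdorffMeasure_euclidean :
    (μH[m] : Measure 𝔼[m]).IsAddHaarMeasure := by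
  have := isAddHaarMeasure_hausdorffMeasure (E := 𝔼[m])
  simpa using this

theorem slice_eq_inter (hΓ : ∀ y ∈ φ.source, (y ∈ Γ ↔ ∀ i : Fin n, m ≤ (i : ℕ) → φ y i = 0)) :
    slice m φ = φ.source ∩ Γ := by
  ext y
  exact ⟨fun h => ⟨h.1, (hΓ y h.1).2 h.2⟩, fun h => ⟨h.1, (hΓ y h.1).1 h.2⟩⟩

/-- An embedded submanifold need not be closed, but by the Lindelöf property it is a countable union
of measurable slices. -/
theorem measurableSet_of_isEmbeddedC2Submanifold [SecondCountableTopology M]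
    (hΓ : IsEmbeddedC2Submanifold n m Γ) : MeasurableSet Γ := by
  rcases Γ.eq_empty_or_nonempty with rfl | ⟨x₀, -⟩
  · exact MeasurableSet.empty
  have : Nonempty (OpenPartialHomeomorph M 𝔼[n]) := ⟨chartAt 𝔼[n] x₀⟩
  choose! φ hφ hxφ h using hΓ
  obtain ⟨t, ht, htc, hc⟩ := TopologicalSpace.countable_cover_nhdsWithin
    (f := fun x => (φ x).source) (s := Γ)
    fun x hx => mem_nhdsWithin_of_mem_nhds ((φ x).open_source.mem_nhds (hxφ x hx))
  have h1 : Γ = ⋃ x ∈ t, slice m (φ x) := by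
    ext y
    simp only [mem_iUnion]
    constructor
    · intro hy
      obtain ⟨x, hx, hyx⟩ := mem_iUnion₂.1 (hc hy)
      exact ⟨x, hx, by rw [slice_eq_inter (h x (ht hx))]; exact ⟨hyx, hy⟩⟩
    · rintro ⟨x, hx, hy⟩
      rw [slice_eq_inter (h x (ht hx))] at hy
      exact hy.2
  rw [h1]
  exact MeasurableSet.biUnion htc fun x _ => measurableSet_slice

theorem measurableSet_inter_preimage_sliceParam {B : Set 𝔼[m]} (hB : MeasurableSet B)
    (hBD : B ⊆ sliceDomain m φ) {A : Set M} (hA : MeasurableSet A) :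
    MeasurableSet (B ∩ sliceParam m φ ⁻¹' A) := by
  have h1 : Continuous (B.domRestrict (sliceParam m φ)) := (continuousOn_sliceParam.mono hBD).domRestrict
  have h2 := hB.subtype_image (h1.measurable hA)
  convert! h2 using 1
  ext z
  exact ⟨fun h => ⟨⟨z, h.1⟩, h.2, rfl⟩, by rintro ⟨⟨w, hw⟩, h, rfl⟩; exact ⟨hw, h⟩⟩

/-- By the area formula, this measure bounds the integral of a positive density over a nonempty open
set. Positivity lets the local constants be compared on overlaps. -/
theorem hausdorffMeasure_inter_pos (hmn : m ≤ n) (hΓ : IsEmbeddedC2Submanifold n m Γ) {N : Set M}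
    (hN : IsOpen N) {x : M} (hxN : x ∈ N) (hx : x ∈ Γ) : 0 < (μH[m] : Measure M) (N ∩ Γ) := by
  have := isAddHaarMeasure_hausdorffMeasure_euclidean (m := m)
  obtain ⟨φ, hφ, hxφ, h⟩ := hΓ x hx
  have hxs : x ∈ slice m φ := by rw [slice_eq_inter h]; exact ⟨hxφ, hx⟩
  set W := sliceDomain m φ ∩ sliceParam m φ ⁻¹' N with hW
  have hWo : IsOpen W := continuousOn_sliceParam.isOpen_inter_preimage isOpen_sliceDomain hN
  have hWD : W ⊆ sliceDomain m φ := inter_subset_left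
  have hWne : W.Nonempty := ⟨sliceProj hmn (φ x), sliceProj_mem_sliceDomain hmn hxs, by
    rw [mem_preimage, sliceParam_sliceProj hmn hxs]; exact hxN⟩
  have hsub : sliceParam m φ '' W ⊆ N ∩ Γ := by
    rintro _ ⟨z, hz, rfl⟩
    have := sliceParam_mem_slice hz.1
    rw [slice_eq_inter h] at this
    exact ⟨hz.2, this.2⟩
  refine lt_of_lt_of_le ?_ (measure_mono hsub)
  rw [hausdorffMeasure_image_sliceParam hmn hφ hWD hWo.measurableSet, pos_iff_ne_zero]
  have hJm : AEMeasurable (fun y => ENNReal.ofReal (sliceDensity m φ y))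
      ((μH[m] : Measure 𝔼[m]).restrict W) :=
    (((contDiffOn_sliceDensity hmn hφ).continuousOn.mono hWD).aemeasurable
      hWo.measurableSet).ennreal_ofReal
  intro h0
  rw [lintegral_eq_zero_iff' hJm] at h0
  have h1 : ∀ᵐ y ∂(μH[m] : Measure 𝔼[m]).restrict W, False := by
    filter_upwards [h0, ae_restrict_mem hWo.measurableSet] with y hy hyW
    exact (ENNReal.ofReal_pos.2 (sliceDensity_pos hmn hφ (hWD hyW))).ne' hy
  rw [Filter.eventually_false_iff_eq_bot, ae_eq_bot, Measure.restrict_eq_zero] at h1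
  exact (hWo.measure_pos _ hWne).ne' h1

/-- Near a point of the submanifold, the weight of the varifold is a multiple of the Hausdorff
measure. -/
theorem exists_isOpen_weight_eq [SecondCountableTopology M] (hmn : m ≤ n)
    (hΓ : IsEmbeddedC2Submanifold n m Γ) {V : Measure (GrBundle n m M)}
    [IsFiniteMeasureOnCompacts V] (hV : IsStationary V) (hs : ∀ᵐ p ∂V, p.1 ∈ Γ) {x : M}
    (hx : x ∈ Γ) : ∃ U, IsOpen U ∧ x ∈ U ∧ (μH[m] : Measure M) (U ∩ Γ) < ⊤ ∧
      ∃ k : ℝ≥0, ∀ A ⊆ U ∩ Γ, MeasurableSet A → weight V A = k * (μH[m] : Measure M) A := by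
  have := isAddHaarMeasure_hausdorffMeasure_euclidean (m := m)
  obtain ⟨φ, hφ, hxφ, h⟩ := hΓ x hx
  have hsl := slice_eq_inter h
  have hxs : x ∈ slice m φ := by rw [hsl]; exact ⟨hxφ, hx⟩
  have hT : ∀ᵐ p ∂V, p.1 ∈ φ.source → p.1 ∈ slice m φ ∧
      p.2.1.map (coframe φ p.1).toLinearMap = (sliceIncl m n).range := by
    filter_upwards [hs, ae_eq_tangentPlane hmn hV hΓ hs] with p hp hpT hps
    refine ⟨by rw [hsl]; exact ⟨hps, hp⟩, ?_⟩
    rw [hpT]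
    exact map_coframe_tangentPlane hmn hφ h hps hp
  have hJ := contDiffOn_sliceDensity (φ := φ) hmn hφ
  have hJ0 : ∀ z ∈ sliceDomain m φ, 0 < sliceDensity m φ z := fun z hz => sliceDensity_pos hmn hφ hz
  set z₀ := sliceProj hmn (φ x) with hz₀
  have hz₀D : z₀ ∈ sliceDomain m φ := sliceProj_mem_sliceDomain hmn hxs
  have hO : φ.target ∩ sliceProj hmn ⁻¹' sliceDomain m φ ∈ 𝓝 (φ x) :=
    (φ.open_target.inter (isOpen_sliceDomain.preimage (sliceProj hmn).continuous)).mem_nhds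
      ⟨φ.map_source hxφ, hz₀D⟩
  obtain ⟨r, hr, hrO⟩ := Metric.nhds_basis_closedBall.mem_iff.1 hO
  -- Functions supported in the resulting ball are seen only where a cutoff with inner radius r / 2
  -- and outer radius r is equal to 1.
  have hD : sliceDomain m φ ∩ sliceIncl m n ⁻¹' Metric.ball (φ x) (r / 2) ∈ 𝓝 z₀ := by
    refine (isOpen_sliceDomain.inter
      (Metric.isOpen_ball.preimage (sliceIncl m n).continuous)).mem_nhds ⟨hz₀D, ?_⟩
    rw [mem_preimage, hz₀, sliceIncl_sliceProj hmn hxs.2]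
    exact Metric.mem_ball_self (by positivity)
  obtain ⟨s, hs0, hsD⟩ := Metric.nhds_basis_closedBall.mem_iff.1 hD
  have hcD : Metric.closedBall z₀ s ⊆ sliceDomain m φ := hsD.trans inter_subset_left
  have hbD : Metric.ball z₀ s ⊆ sliceDomain m φ := Metric.ball_subset_closedBall.trans hcD
  have hfin : sliceMeasure hmn φ (weight V) (Metric.ball z₀ s) < ⊤ := by
    rw [sliceMeasure_apply hmn _ hbD Metric.isOpen_ball.measurableSet]
    exact (measure_mono (image_mono Metric.ball_subset_closedBall)).trans_lt
      ((isCompact_closedBall z₀ s).image_of_continuousOn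
        (continuousOn_sliceParam.mono hcD)).measure_lt_top
  obtain ⟨k, hk⟩ := exists_measure_eq_mul_lintegral (lam := (μH[m] : Measure 𝔼[m]))
    hJ.continuousOn hJ0 hcD hfin fun f hf _ hfB v =>
      integral_sliceMeasure_eq_zero hmn hφ hV hT (x := x) (r := r / 2) (by positivity)
        (by rwa [mul_div_cancel₀ r two_ne_zero]) hf (hfB.trans hbD)
        (hfB.trans ((Metric.ball_subset_closedBall.trans hsD).trans inter_subset_right)) v
  set U := φ.source ∩ φ ⁻¹' (sliceProj hmn ⁻¹' Metric.ball z₀ s) with hU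
  have hUo : IsOpen U := φ.isOpen_inter_preimage
    (Metric.isOpen_ball.preimage (sliceProj hmn).continuous)
  have hUΓ : U ∩ Γ = sliceParam m φ '' Metric.ball z₀ s := by
    rw [image_sliceParam hmn hbD, hsl, hU]
    ext y
    exact ⟨fun h => ⟨h.1.2, h.1.1, h.2⟩, fun h => ⟨⟨h.2.1, h.1⟩, h.2.2⟩⟩
  refine ⟨U, hUo, ⟨hxφ, Metric.mem_ball_self hs0⟩, ?_, k, fun A hA hAm => ?_⟩
  · rw [hUΓ, hausdorffMeasure_image_sliceParam hmn hφ hbD Metric.isOpen_ball.measurableSet]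
    obtain ⟨C, hC⟩ := (isCompact_closedBall z₀ s).exists_bound_of_continuousOn
      (hJ.continuousOn.mono hcD)
    calc ∫⁻ y in Metric.ball z₀ s, ENNReal.ofReal (sliceDensity m φ y) ∂μH[m]
        ≤ ∫⁻ _ in Metric.ball z₀ s, ENNReal.ofReal C ∂μH[m] :=
          setLIntegral_mono measurable_const fun y hy => ENNReal.ofReal_le_ofReal
            ((le_abs_self _).trans (hC y (Metric.ball_subset_closedBall hy)))
      _ = ENNReal.ofReal C * (μH[m] : Measure 𝔼[m]) (Metric.ball z₀ s) := by rw [setLIntegral_const]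
      _ < ⊤ := ENNReal.mul_lt_top ENNReal.ofReal_lt_top measure_ball_lt_top
  · set A' := Metric.ball z₀ s ∩ sliceParam m φ ⁻¹' A with hA'
    have hA'm : MeasurableSet A' :=
      measurableSet_inter_preimage_sliceParam Metric.isOpen_ball.measurableSet hbD hAm
    have hA'A : sliceParam m φ '' A' = A := by
      rw [hA', image_inter_preimage, ← hUΓ, inter_eq_right.2 hA]
    have hA'b : A' ⊆ Metric.ball z₀ s := inter_subset_left
    have h1 := hk A' hA'b hA'm
    rwa [sliceMeasure_apply hmn _ (hA'b.trans hbD) hA'm,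
      ← hausdorffMeasure_image_sliceParam hmn hφ (hA'b.trans hbD) hA'm, hA'A] at h1

end LocalConstancy

/-! ### From local to global constancy -/

section Constancy

variable {m n : ℕ} {M : Type*} [MetricSpace M] [ChartedSpace 𝔼[n] M] [IsManifold (𝓡 n) 2 M]
  [RiemannianBundle (fun x : M => TangentSpace (𝓡 n) x)]
  [IsContMDiffRiemannianBundle (𝓡 n) 1 𝔼[n] (fun x : M => TangentSpace (𝓡 n) x)]
  [IsRiemannianManifold (𝓡 n) M] [MeasurableSpace M] [BorelSpace M] [SecondCountableTopology M]
  {Γ : Set M}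

theorem exists_weight_eq (hmn : m ≤ n) (hΓ : IsEmbeddedC2Submanifold n m Γ) (hΓc : IsConnected Γ)
    {V : Measure (GrBundle n m M)} [IsFiniteMeasureOnCompacts V] (hV : IsStationary V)
    (hs : ∀ᵐ p ∂V, p.1 ∈ Γ) : ∃ k : ℝ≥0, ∀ A ⊆ Γ, MeasurableSet A →
      weight V A = k * (μH[m] : Measure M) A := by
  have hΓm := measurableSet_of_isEmbeddedC2Submanifold hΓ
  have h := fun x : Γ => exists_isOpen_weight_eq hmn hΓ hV hs x.2
  choose U hUo hxU hUfin k hk using h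
  have hloc : IsLocallyConstant k := by
    refine (IsLocallyConstant.iff_eventually_eq k).2 fun x => ?_
    filter_upwards [((hUo x).preimage continuous_subtype_val).mem_nhds (hxU x)] with y hy
    have hA : MeasurableSet (U x ∩ U y ∩ Γ) :=
      (((hUo x).inter (hUo y)).measurableSet).inter hΓm
    have h1 := hk x _ (inter_subset_inter_left Γ inter_subset_left) hA
    have h2 := hk y _ (inter_subset_inter_left Γ inter_subset_right) hA
    have hpos := hausdorffMeasure_inter_pos hmn hΓ ((hUo x).inter (hUo y)) ⟨hy, hxU y⟩ y.2
    have hfin : (μH[m] : Measure M) (U x ∩ U y ∩ Γ) < ⊤ :=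
      (measure_mono (inter_subset_inter_left Γ inter_subset_left)).trans_lt (hUfin x)
    rw [h1] at h2
    -- On the overlap both constants multiply the same Hausdorff measure; it cancels because it is
    -- neither zero nor infinite.
    exact_mod_cast ((ENNReal.mul_left_inj hpos.ne' hfin.ne).1 h2).symm
  have : PreconnectedSpace Γ := isPreconnected_iff_preconnectedSpace.1 hΓc.isPreconnected
  obtain ⟨x₀, hx₀⟩ := hΓc.nonempty
  have hconst : ∀ x, k x = k ⟨x₀, hx₀⟩ := fun x => hloc.apply_eq_of_preconnectedSpace x _
  refine ⟨k ⟨x₀, hx₀⟩, fun A hA hAm => ?_⟩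
  have heq : ∀ x : M, ∀ hx : x ∈ Γ, ∀ A ⊆ U ⟨x, hx⟩ ∩ Γ, MeasurableSet A →
      weight V A = ((k ⟨x₀, hx₀⟩ : ℝ≥0∞) • (μH[m] : Measure M)) A := fun x hx A hA hAm => by
    rw [hk ⟨x, hx⟩ A hA hAm, hconst, Measure.smul_apply, smul_eq_mul]
  have h3 : weight V A = ((k ⟨x₀, hx₀⟩ : ℝ≥0∞) • (μH[m] : Measure M)) A :=
    le_antisymm
      (measure_le_of_locally_le (s := Γ) (fun x hx => ⟨U ⟨x, hx⟩, hUo _, hxU ⟨x, hx⟩,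
        fun A hA hAm => (heq x hx A hA hAm).le⟩) hA hAm)
      (measure_le_of_locally_le (s := Γ) (fun x hx => ⟨U ⟨x, hx⟩, hUo _, hxU ⟨x, hx⟩,
        fun A hA hAm => (heq x hx A hA hAm).ge⟩) hA hAm)
  rw [h3, Measure.smul_apply, smul_eq_mul]

/-- A varifold whose planes are almost everywhere tangent to `Γ` is determined by its weight. -/
theorem measure_eq_weight (hmn : m ≤ n) (hΓ : IsEmbeddedC2Submanifold n m Γ)
    {V : Measure (GrBundle n m M)} (hs : ∀ᵐ p ∂V, p.1 ∈ Γ)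
    (hT : ∀ᵐ p ∂V, p.2.1 = tangentPlane Γ p.1) {B : Set (GrBundle n m M)} (hB : MeasurableSet B) :
    MeasurableSet {x ∈ Γ | ∃ S : Gr m (TangentSpace (𝓡 n) x),
      S.1 = tangentPlane Γ x ∧ (⟨x, S⟩ : GrBundle n m M) ∈ B} ∧
    V B = weight V {x ∈ Γ | ∃ S : Gr m (TangentSpace (𝓡 n) x),
      S.1 = tangentPlane Γ x ∧ (⟨x, S⟩ : GrBundle n m M) ∈ B} := by
  have hm : MeasurableSet {x ∈ Γ | ∃ S : Gr m (TangentSpace (𝓡 n) x),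
      S.1 = tangentPlane Γ x ∧ (⟨x, S⟩ : GrBundle n m M) ∈ B} := by
    have h1 := (measurableSet_of_isEmbeddedC2Submanifold hΓ).subtype_image
      ((continuous_tangentSection hmn hΓ).measurable hB)
    convert! h1 using 1
    ext x
    constructor
    · rintro ⟨hx, S, hS, hSB⟩
      refine ⟨⟨x, hx⟩, ?_, rfl⟩
      obtain rfl : S = ⟨tangentPlane Γ x, finrank_tangentPlane_of_mem hmn hΓ hx⟩ := Subtype.ext hS
      exact hSB
    · rintro ⟨⟨x, hx⟩, h, rfl⟩
      exact ⟨hx, _, rfl, h⟩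
  refine ⟨hm, ?_⟩
  rw [weight, Measure.map_apply GrBundle.continuous_proj.measurable hm]
  refine measure_congr ?_
  filter_upwards [hs, hT] with p hp hpT
  refine propext ⟨fun h => ⟨hp, p.2, hpT, h⟩, ?_⟩
  rintro ⟨-, S, hS, hSB⟩
  obtain rfl : S = p.2 := Subtype.ext (hS.trans hpT.symm)
  exact hSB

/-- In a second countable space the complement of the support of a measure is null. -/
theorem ae_mem_of_support_weight_subset {V : Measure (GrBundle n m M)}
    (h : (weight V).support ⊆ Γ) : ∀ᵐ p ∂V, p.1 ∈ Γ :=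
  ae_of_ae_map GrBundle.continuous_proj.measurable.aemeasurable
    (Filter.mem_of_superset (Measure.support_mem_ae (μ := weight V)) h)

end Constancy

end Varifold

end

theorem mainTheorem6 {m n : ℕ} (hm : 1 ≤ m) (hmn : m < n)
    {M : Type*} [MetricSpace M] [CompleteSpace M] [ConnectedSpace M]
    [SecondCountableTopology M] [MeasurableSpace M] [BorelSpace M]
    [ChartedSpace (EuclideanSpace ℝ (Fin n)) M] [IsManifold (𝓡 n) 3 M]
    [RiemannianBundle (fun x : M => TangentSpace (𝓡 n) x)]
    [IsContMDiffRiemannianBundle (𝓡 n) 2 (EuclideanSpace ℝ (Fin n))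
      (fun x : M => TangentSpace (𝓡 n) x)]
    [IsRiemannianManifold (𝓡 n) M]
    (Γ : Set M) (hΓ : Varifold.IsEmbeddedC2Submanifold n m Γ) (hΓc : IsConnected Γ)
    (V : Measure (Varifold.GrBundle n m M)) [V.Regular]
    (hV : Varifold.IsStationary V) (hsupp : (Varifold.weight V).support ⊆ Γ) :
    ∃ θ₀ : ℝ≥0, ∀ B : Set (Varifold.GrBundle n m M), MeasurableSet B →
      V B = Varifold.ofSubmanifold Γ (fun _ => (θ₀ : ℝ≥0∞)) B := by
  have h2 : IsManifold (𝓡 n) 2 M := IsManifold.of_le (n := 3) (by norm_num)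
  have hs := Varifold.ae_mem_of_support_weight_subset hsupp
  obtain ⟨k, hk⟩ := Varifold.exists_weight_eq hmn.le hΓ hΓc hV hs
  set b : ℝ≥0∞ := volume (Metric.ball (0 : EuclideanSpace ℝ (Fin m)) (1 / 2)) with hb
  have hb_ne : b ≠ 0 := (Metric.measure_ball_pos volume _ (by norm_num)).ne'
  have hb_top : b ≠ ⊤ := measure_ball_lt_top.ne
  -- The constant k refers to `μH[m]`, while `hausdorff` is b times `μH[m]`, with b the volume of a
  -- ball of diameter 1; hence the division by b.
  refine ⟨k / b.toNNReal, fun B hB => ?_⟩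
  obtain ⟨hm', hVB⟩ := Varifold.measure_eq_weight hmn.le hΓ hs
    (Varifold.ae_eq_tangentPlane hmn.le hV hΓ hs) hB
  rw [hVB, hk _ (sep_subset _ _) hm', Varifold.ofSubmanifold, setLIntegral_const,
    Varifold.hausdorff, Measure.smul_apply, smul_eq_mul, ← hb, ← mul_assoc,
    ENNReal.coe_div (ENNReal.toNNReal_ne_zero.2 ⟨hb_ne, hb_top⟩), ENNReal.coe_toNNReal hb_top,
    ENNReal.div_mul_cancel hb_ne hb_top]
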